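/- Let $d\ge 0$ and $k\ge 2$ be fixed integers, let $\mathbf T^d=\mathbb R^d/\mathbb Z^d$ carry the uniform probability measure $dx$, and let $F_{in},F_{out}:\mathbf T^d\to[0,1]$ be measurable with $F_{in}(-x)=F_{in}(x)$ and $F_{out}(-x)=F_{out}(x)$ (for instance, functions of $\|x\|$ only). Put $\hat F(z)=\int_{\mathbf T^d}F(x)e^{-2\pi i\langle z,x\rangle}\,dx$ for $z\in\mathbb Z^d$, $\mu_{in}=\int F_{in}$, $\mu_{out}=\int F_{out}$. Assume $\mu_{in}>\mu_{out}>0$ and (i) $F_{in}(0)$ and $F_{out}(0)$ equal the Fourier series of $F_{in}$ and $F_{out}$ at $0$, i.e. $F(0)=\lim_{N\to\infty}\sum_{\|z\|_\infty\le N}\hat F(z)$ for $F=F_{in},F_{out}$; (ii) $\hat F_{in}(z)+(k-1)\hat F_{out}(z)\ne\mu_{in}-\mu_{out}$ for all $z\in\mathbb Z^d$; (iii) $\hat F_{in}(z)-\hat F_{out}(z)\ne\mu_{in}-\mu_{out}$ for all $z\in\mathbb Z^d\setminus\{0\}$. For every $n$ divisible by $k$ let $\sigma=\sigma_n:[n]\to[k]$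 be an assignment with all $k$ communities of size $n/k$. The soft geometric block model (SGBM) is the random graph $G$ on $[n]$ obtained by choosing $X_1,\dots,X_n$ independently and uniformly in $\mathbf T^d$ and then, given the $X_i$, joining each pair $i<j$ independently with probability $F_{in}(X_i-X_j)$ if $\sigma_i=\sigma_j$ and $F_{out}(X_i-X_j)$ otherwise. Let $A$ be its adjacency matrix and $\lambda_*=n(\mu_{in}-\mu_{out})/k$. For $\sigma,\hat\sigma:[n]\to[k]$ let $\ell(\sigma,\hat\sigma)=\frac1n\min_\rho|\{i:\sigma_i\ne\rho_i\}|$, the minimum being over all $\rho:[n]\to[k]$ with $\rho_i=\rho_j\Leftrightarrow\hat\sigma_i=\hat\sigma_j$ for all $i,j$. For points $w_1,\dots,w_n\in\mathbb R^{k-1}$ and $\eta\ge0$, an assignment $\hat\sigma:[n]\to[k]$ is the output of $(1+\eta)$-approximate $k$-means if there are centres $x_1,\dots,x_k\in\mathbb R^{k-1}$ with $\sum_i\|x_{\hat\sigma_i}-w_i\|_2^2\le(1+\eta)\min_{s,y}\sum_i\|y_{s_i}-w_i\|_2^2$, the minimum being over all $s:[n]\to[k]$ and $y_1,\dots,y_k\in\mathbb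 R^{k-1}$ ($\eta=0$ is exact $k$-means). Then there is $\epsilon>0$, depending only on $k,F_{in},F_{out}$, such that for every $\tau\in(0,\epsilon)$, every $\eta\ge0$ and every such sequence $(\sigma_n)$, with probability tending to $1$ as $n\to\infty$ along the multiples of $k$, the following hold together. (a) There are $k-1$ eigenvalues $\lambda'_1,\dots,\lambda'_{k-1}$ of $A$ (counted with multiplicity) with $|\lambda'_j-\lambda_*|\le\tau n$, and every other eigenvalue $\lambda$ of $A$ satisfies $|\lambda-\lambda_*|\ge\epsilon n$. (b) Let $V$ be any $n\times(k-1)$ matrix whose columns are orthonormal eigenvectors of $A$ associated with $\lambda'_1,\dots,\lambda'_{k-1}$. Every output $\hat\sigma$ of $(1+\eta)$-approximate $k$-means on the $n$ rows of $V$ satisfies $\ell(\sigma,\hat\sigma)\le\tau\log n/n$. (c) For every $\hat\sigma$ as in (b) and every $\sigma':[n]\to[k]$ such that, for each vertex $i$, $\sigma'_i$ maximises $m\mapsto|\{j:j\text{ is a neighbour of }i\text{ in }G,\ \hat\sigma_j=m\}|$ over $m\in[k]$ (ties broken arbitrarily), $\ell(\sigma,\sigma')=0$. -/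

import Mathlib

open MeasureTheory Filter Topology
open scoped ENNReal

noncomputable section

namespace SGBM

/-- The uniform (Haar) probability measure on the flat unit torus `ℝ^d / ℤ^d`. -/
def torusMeasure (d : ℕ) : Measure (UnitAddTorus (Fin d)) :=
  Measure.pi fun _ => AddCircle.haarAddCircle

/-- The Fourier coefficient `∫ f(x) exp(-2πi⟨z,x⟩) dx` of a real function on the torus. -/
def fourierCoefficient {d : ℕ} (f : UnitAddTorus (Fin d) → ℝ) (z : Fin d → ℤ) : ℂ :=
  UnitAddTorus.mFourierCoeff (fun x => (f x : ℂ)) z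

/-- The square partial sum, over all frequencies with `‖z‖_∞ ≤ N`, of the Fourier series of `f`
at `x`. -/
def fourierPartialSum {d : ℕ} (f : UnitAddTorus (Fin d) → ℝ) (N : ℕ) (x : UnitAddTorus (Fin d)) :
    ℂ :=
  ∑ z ∈ Finset.Icc (fun _ : Fin d => -(N : ℤ)) (fun _ : Fin d => (N : ℤ)),
    fourierCoefficient f z * UnitAddTorus.mFourier z x

/-- The Fourier series of `f` converges at `x` and its value there is `f x`. -/
def EqFourierSeriesAt {d : ℕ} (f : UnitAddTorus (Fin d) → ℝ) (x : UnitAddTorus (Fin d)) : Prop :=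
  Tendsto (fun N : ℕ => fourierPartialSum f N x) atTop (𝓝 (f x : ℂ))

/-- The expected edge density of a connectivity probability function. -/
def density {d : ℕ} (f : UnitAddTorus (Fin d) → ℝ) : ℝ := ∫ x, f x ∂(torusMeasure d)

/-- A measurable function `T^d → [0,1]` with `f (-x) = f x`, so that `f (X_i - X_j)` depends only on
the unordered pair `{i, j}`. -/
structure IsConnectivity {d : ℕ} (f : UnitAddTorus (Fin d) → ℝ) : Prop where
  measurable : Measurable f
  mem_Icc : ∀ x, f x ∈ Set.Icc (0 : ℝ) 1
  even : ∀ x, f (-x) = f x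

/-- The connection probability of two vertices with labels `s`, `t` and displacement `x`. -/
def connection {d k : ℕ} (Fi Fo : UnitAddTorus (Fin d) → ℝ) (x : UnitAddTorus (Fin d))
    (s t : Fin k) : ℝ :=
  if s = t then Fi x else Fo x

open Classical in
/-- The conditional probability of the graph `G` given the labels `σ` and the positions `X`. -/
def condProb {d k n : ℕ} (Fi Fo : UnitAddTorus (Fin d) → ℝ) (σ : Fin n → Fin k)
    (X : Fin n → UnitAddTorus (Fin d)) (G : SimpleGraph (Fin n)) : ℝ :=
  ∏ p ∈ Finset.univ.filter (fun p : Fin n × Fin n => p.1 < p.2),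
    if G.Adj p.1 p.2 then connection Fi Fo (X p.1 - X p.2) (σ p.1) (σ p.2)
    else 1 - connection Fi Fo (X p.1 - X p.2) (σ p.1) (σ p.2)

/-- The law of the soft geometric block model with labels `σ`: the positions are independent and
uniform on the torus, and given the positions the graph has law `condProb`. -/
def law {d k n : ℕ} (Fi Fo : UnitAddTorus (Fin d) → ℝ) (σ : Fin n → Fin k) :
    Measure (SimpleGraph (Fin n)) :=
  ∑ G : SimpleGraph (Fin n),
    (∫⁻ X, ENNReal.ofReal (condProb Fi Fo σ X G) ∂(Measure.pi fun _ : Fin n => torusMeasure d)) •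
      Measure.dirac G

/-- The assignment `σ` has `k` communities of equal size `n / k`. -/
def IsBalanced {n k : ℕ} (σ : Fin n → Fin k) : Prop :=
  ∀ q : Fin k, k * (Finset.univ.filter fun i => σ i = q).card = n

/-- Two assignments are equivalent if they differ by a relabelling. -/
def Equivalent {n k : ℕ} (σ τ : Fin n → Fin k) : Prop :=
  ∀ i j, σ i = σ j ↔ τ i = τ j

/-- The absolute classification error: the least Hamming distance from `σ` to an assignment
equivalent to `σ'`. -/
def classificationError {n k : ℕ} (σ σ' : Fin n → Fin k) : ℕ :=
  sInf {h : ℕ | ∃ ρ : Fin n → Fin k, Equivalent ρ σ' ∧ h = hammingDist σ ρ}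

/-- The loss rate of the estimator `σ'` of `σ`. -/
def loss {n k : ℕ} (σ σ' : Fin n → Fin k) : ℝ := (classificationError σ σ' : ℝ) / n

open Classical in
/-- The adjacency matrix. -/
def adj {n : ℕ} (G : SimpleGraph (Fin n)) : Matrix (Fin n) (Fin n) ℝ := G.adjMatrix ℝ

theorem adj_isHermitian {n : ℕ} (G : SimpleGraph (Fin n)) : (adj G).IsHermitian := by
  classical
  simp [Matrix.IsHermitian, adj]

/-- The eigenvalues of the adjacency matrix, repeated according to multiplicity. -/
def eig {n : ℕ} (G : SimpleGraph (Fin n)) : Fin n → ℝ := (adj_isHermitian G).eigenvalues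

/-- The `m` (distinct) indices `e 0, …, e (m - 1)` select eigenvalues at distance at most `r` from
`c`, and all the remaining eigenvalues are at distance at least `R` from `c`. -/
def IsSelection {n m : ℕ} (G : SimpleGraph (Fin n)) (c r R : ℝ) (e : Fin m ↪ Fin n) : Prop :=
  (∀ j, |eig G (e j) - c| ≤ r) ∧ ∀ i, i ∉ Set.range e → R ≤ |eig G i - c|

/-- `v 0, …, v (m - 1)` are orthonormal eigenvectors of the adjacency matrix associated with the
eigenvalues selected by `e`. -/
def IsEigenframe {n m : ℕ} (G : SimpleGraph (Fin n)) (e : Fin m ↪ Fin n)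
    (v : Fin m → EuclideanSpace ℝ (Fin n)) : Prop :=
  Orthonormal ℝ v ∧ ∀ j, (adj G).mulVec (v j).ofLp = eig G (e j) • (v j).ofLp

/-- The `i`-th row of the matrix whose columns are `v 0, …, v (m - 1)`. -/
def row {n m : ℕ} (v : Fin m → EuclideanSpace ℝ (Fin n)) (i : Fin n) : EuclideanSpace ℝ (Fin m) :=
  WithLp.toLp 2 fun j => v j i

/-- The `k`-means cost of the assignment `s` of the points `w` to the centres `x`. -/
def kMeansCost {n m k : ℕ} (w : Fin n → EuclideanSpace ℝ (Fin m)) (s : Fin n → Fin k)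
    (x : Fin k → EuclideanSpace ℝ (Fin m)) : ℝ :=
  ∑ i, ‖x (s i) - w i‖ ^ 2

/-- `s` is the assignment of a `(1 + η)`-approximate solution of the `k`-means problem for the
points `w`; for `η = 0` it is the assignment of an exact minimiser. -/
def IsKMeansOutput {n m k : ℕ} (η : ℝ) (w : Fin n → EuclideanSpace ℝ (Fin m))
    (s : Fin n → Fin k) : Prop :=
  ∃ x : Fin k → EuclideanSpace ℝ (Fin m), ∀ (s' : Fin n → Fin k)
    (x' : Fin k → EuclideanSpace ℝ (Fin m)),
      kMeansCost w s x ≤ (1 + η) * kMeansCost w s' x'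

open Classical in
/-- The number of neighbours of `i` in `G` with label `q` under `s`. -/
def labelCount {n k : ℕ} (G : SimpleGraph (Fin n)) (s : Fin n → Fin k) (i : Fin n) (q : Fin k) :
    ℕ :=
  (Finset.univ.filter fun j => G.Adj i j ∧ s j = q).card

/-- `s'` gives each vertex a most frequent label, under `s`, among its neighbours (ties being broken
arbitrarily). -/
def IsRefinement {n k : ℕ} (G : SimpleGraph (Fin n)) (s s' : Fin n → Fin k) : Prop :=
  ∀ i q, labelCount G s i q ≤ labelCount G s i (s' i)

end SGBM

end

/-! Put c = λ_* = n(μ_in − μ_out)/k. Everything rests on two estimates for A − c. On label vectors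
`labelVec σ h` with ∑ h = 0, A − c has size O(√(n log n)), because c is the exact eigenvalue of the
averaged model there (`norm_sq_shift_labelVec_le`). On the vectors w with equal label sums, the
orthogonal complement of the former, ‖(A − c)w‖ ≥ εn‖w‖ (`SpectralFamily.le_norm_shift`). A
dimension count then puts exactly k − 1 eigenvalues within τn of c and all others at distance at
least εn. A label vector with ∑ h = 0 has only a fraction O(log n / n) of its squared norm outside
the selected eigenvectors (`IsEigenframe.norm_sq_sub_le`), so the class means of the rows are well
separated, the true labels have small k-means cost, and an approximate minimiser errs O(log n)
times. The majority margins are linear in n, so the refinement removes these errors.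

The lower bound is the heart. The real characters g of the torus are common eigenfunctions of
convolution with F_in and F_out, so the vectors with entries g(X_i) on one class and 0 elsewhere
span a space that A almost preserves, acting there with eigenvalues near (n/k)(F̂_in + (k−1)F̂_out)
and (n/k)(F̂_in − F̂_out). By (ii) and (iii) these avoid c, except for the constant character with
zero-sum labels, a mode that equal label sums exclude. Hence if (A − c)w is small, w is almost
orthogonal to any fixed finite set of such vectors. But ‖Aw‖² = ⟨w, A²w⟩, the entries of A²
concentrate around `pathMean`, and that kernel is uniformly close to a finite combination of
products of characters; so Aw is too small to be compatible with Aw ≈ cw.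

Passing to A² does two things. The fluctuation of A has Hilbert–Schmidt norm of order n, comparable
with c, whereas that of A² has order n^{3/2} against c² of order n²; so second moments suffice. And
composing with a bounded kernel turns L¹ convergence of the Fourier series into uniform
approximation.

Probabilities are computed in a model with independent positions and independent uniform numbers on
pairs, where resampling all data of one vertex plays the role of conditioning. Markov's inequality
handles the spectral errors; the factor log n in (b) is the room it needs. The degrees use an
exponential moment. -/

namespace SGBM

/-! ### Eigenvalue counting and the mass outside an eigenframe. -/

section Spectral

variable {n k m : ℕ} (G : SimpleGraph (Fin n)) (c : ℝ)

/-- The vector `(A - c) w`, for the adjacency matrix `A`. -/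
noncomputable def shift (w : EuclideanSpace ℝ (Fin n)) : EuclideanSpace ℝ (Fin n) :=
  WithLp.toLp 2 ((adj G).mulVec w.ofLp) - c • w

/-- An orthonormal basis of eigenvectors of the adjacency matrix. -/
noncomputable def eigBasis : OrthonormalBasis (Fin n) ℝ (EuclideanSpace ℝ (Fin n)) :=
  (adj_isHermitian G).eigenvectorBasis

variable {G c}

theorem inner_mulVec_comm (u w : EuclideanSpace ℝ (Fin n)) :
    inner ℝ u (WithLp.toLp 2 ((adj G).mulVec w.ofLp)) =
      inner ℝ (WithLp.toLp 2 ((adj G).mulVec u.ofLp)) w := by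
  have h := (Matrix.isSymmetric_toEuclideanLin_iff.mpr (adj_isHermitian G)) u w
  simpa [Matrix.toLpLin_apply] using h.symm

theorem inner_eigvec_shift {u : EuclideanSpace ℝ (Fin n)} {a : ℝ}
    (hu : (adj G).mulVec u.ofLp = a • u.ofLp) (w : EuclideanSpace ℝ (Fin n)) :
    inner ℝ u (shift G c w) = (a - c) * inner ℝ u w := by
  rw [shift, inner_sub_right, inner_mulVec_comm, hu, WithLp.toLp_smul, WithLp.toLp_ofLp,
    real_inner_smul_left, real_inner_smul_right]
  ring

theorem eigBasis_mulVec (i : Fin n) :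
    (adj G).mulVec (eigBasis G i).ofLp = eig G i • (eigBasis G i).ofLp :=
  (adj_isHermitian G).mulVec_eigenvectorBasis i

theorem inner_eigBasis_shift (i : Fin n) (w : EuclideanSpace ℝ (Fin n)) :
    inner ℝ (eigBasis G i) (shift G c w) = (eig G i - c) * inner ℝ (eigBasis G i) w :=
  inner_eigvec_shift (eigBasis_mulVec i) w

theorem norm_sq_shift (w : EuclideanSpace ℝ (Fin n)) :
    ‖shift G c w‖ ^ 2 = ∑ i, (eig G i - c) ^ 2 * inner ℝ (eigBasis G i) w ^ 2 := by
  rw [← (eigBasis G).sum_sq_inner_right]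
  simp [inner_eigBasis_shift, mul_pow]

theorem inner_eigvec_eq_zero {u v : EuclideanSpace ℝ (Fin n)} {a b : ℝ}
    (hu : (adj G).mulVec u.ofLp = a • u.ofLp) (hv : (adj G).mulVec v.ofLp = b • v.ofLp)
    (hab : a ≠ b) : inner ℝ u v = 0 := by
  have h := inner_eigvec_shift (c := b) hu v
  have hs : shift G b v = 0 := by simp [shift, hv]
  rw [hs, inner_zero_right] at h
  exact (mul_eq_zero.1 h.symm).resolve_left (sub_ne_zero.2 hab)

/-- A linear map into a space of smaller dimension has a nonzero kernel vector. -/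
theorem exists_ne_zero_of_finrank_lt {V W : Type*} [AddCommGroup V] [Module ℝ V]
    [AddCommGroup W] [Module ℝ W] [FiniteDimensional ℝ V] [FiniteDimensional ℝ W]
    (f : V →ₗ[ℝ] W) (h : Module.finrank ℝ W < Module.finrank ℝ V) : ∃ v ≠ 0, f v = 0 := by
  by_contra! hc
  have hf : Function.Injective f := by
    rw [← LinearMap.ker_eq_bot, LinearMap.ker_eq_bot']
    exact fun v hv => by_contra fun h0 => hc v h0 hv
  exact absurd (LinearMap.finrank_le_finrank_of_injective hf) (not_le.2 h)

/-- The vector whose value at `i` is `h (σ i)`. -/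
noncomputable def labelVec (σ : Fin n → Fin k) : (Fin k → ℝ) →ₗ[ℝ] EuclideanSpace ℝ (Fin n) where
  toFun h := WithLp.toLp 2 fun i => h (σ i)
  map_add' _ _ := rfl
  map_smul' _ _ := rfl

@[simp]
theorem labelVec_apply (σ : Fin n → Fin k) (h : Fin k → ℝ) (i : Fin n) :
    labelVec σ h i = h (σ i) := rfl

/-- A Courant–Fischer count. If at most k − 2 eigenvalues were in the window, orthogonality to their
eigenvectors and ∑ h = 0 would be fewer than k conditions on `h`, and `A - c` would expand the
resulting label vector by more than `r`. Surjectivity of `σ` keeps that vector nonzero. -/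
theorem le_card_eig_near {σ : Fin n → Fin k} (hσ : Function.Surjective σ) {r : ℝ} (hr : 0 ≤ r)
    (H : ∀ h : Fin k → ℝ, ∑ q, h q = 0 →
      ‖shift G c (labelVec σ h)‖ ≤ r * ‖labelVec σ h‖) :
    k - 1 ≤ (Finset.univ.filter fun i => |eig G i - c| ≤ r).card := by
  by_contra! hlt
  set S := Finset.univ.filter fun i => |eig G i - c| ≤ r with hS
  let f : (Fin k → ℝ) →ₗ[ℝ] (S → ℝ) × ℝ :=
    LinearMap.prod
      (LinearMap.pi fun i : S => (innerₛₗ ℝ (eigBasis G i)).comp (labelVec σ))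
      (∑ q, LinearMap.proj q)
  obtain ⟨h, h0, hf⟩ := exists_ne_zero_of_finrank_lt f (by
    simp only [Module.finrank_prod, Module.finrank_fintype_fun_eq_card, Fintype.card_coe,
      Module.finrank_self, Fintype.card_fin]
    omega)
  have hsum : ∑ q, h q = 0 := by simpa [f] using congrArg Prod.snd hf
  have hin : ∀ i ∈ S, inner ℝ (eigBasis G i) (labelVec σ h) = 0 := fun i hi => by
    simpa [f] using congrFun (congrArg Prod.fst hf) ⟨i, hi⟩
  have hne : labelVec σ h ≠ 0 := by
    intro hz
    apply h0
    ext q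
    obtain ⟨i, rfl⟩ := hσ q
    exact congrFun (congrArg WithLp.ofLp hz) i
  have h1 := H h hsum
  have h2 : r ^ 2 * ‖labelVec σ h‖ ^ 2 < ‖shift G c (labelVec σ h)‖ ^ 2 := by
    rw [norm_sq_shift, ← (eigBasis G).sum_sq_inner_right, Finset.mul_sum]
    have hle : ∀ i ∈ Finset.univ, r ^ 2 * inner ℝ (eigBasis G i) (labelVec σ h) ^ 2 ≤
        (eig G i - c) ^ 2 * inner ℝ (eigBasis G i) (labelVec σ h) ^ 2 := by
      intro i _
      by_cases hi : i ∈ S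
      · simp [hin i hi]
      · have : r < |eig G i - c| := by simpa [hS] using hi
        gcongr ?_ * _
        rw [← sq_abs (eig G i - c)]
        gcongr
    refine Finset.sum_lt_sum hle ?_
    by_contra! hcon
    apply hne
    have hall : ∀ i, inner ℝ (eigBasis G i) (labelVec σ h) = 0 := by
      intro i
      by_cases hi : i ∈ S
      · exact hin i hi
      · have h3 : r < |eig G i - c| := by simpa [hS] using hi
        have h4 : r ^ 2 < (eig G i - c) ^ 2 := by
          rw [← sq_abs (eig G i - c)]
          gcongr
        by_contra h5
        have h6 := hcon i (Finset.mem_univ i)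
        exact absurd (le_of_mul_le_mul_right h6 (by positivity)) (not_le.2 h4)
    have : ‖labelVec σ h‖ ^ 2 = 0 := by
      rw [← (eigBasis G).sum_sq_inner_right]
      simp [hall]
    simpa using this
  have h3 : ‖shift G c (labelVec σ h)‖ ^ 2 ≤ (r * ‖labelVec σ h‖) ^ 2 := by gcongr
  rw [mul_pow] at h3
  linarith

/-- The dual count: equality of the label sums is k − 1 linear conditions, so the span of k
eigenvectors from the open window would contain a nonzero such vector, whose norm `A - c` multiplies
by less than `r`. -/
theorem card_eig_near_le (hk : 1 ≤ k) {σ : Fin n → Fin k} {r : ℝ}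
    (H : ∀ w : EuclideanSpace ℝ (Fin n),
      (∀ q q', ∑ i with σ i = q, w i = ∑ i with σ i = q', w i) → w ≠ 0 →
      r * ‖w‖ ≤ ‖shift G c w‖) :
    (Finset.univ.filter fun i => |eig G i - c| < r).card ≤ k - 1 := by
  by_contra! hlt
  set S := Finset.univ.filter fun i => |eig G i - c| < r with hS
  let q0 : Fin k := ⟨0, hk⟩
  let comb : (S → ℝ) →ₗ[ℝ] EuclideanSpace ℝ (Fin n) :=
    ∑ i : S, (LinearMap.proj i : (S → ℝ) →ₗ[ℝ] ℝ).smulRight (eigBasis G i)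
  let f : (S → ℝ) →ₗ[ℝ] ({q : Fin k // q ≠ q0} → ℝ) :=
    LinearMap.pi fun q => (∑ i with σ i = q, (EuclideanSpace.proj i : _ →L[ℝ] ℝ).toLinearMap
      - ∑ i with σ i = q0, (EuclideanSpace.proj i : _ →L[ℝ] ℝ).toLinearMap).comp comb
  obtain ⟨a, a0, ha⟩ := exists_ne_zero_of_finrank_lt f (by
    simp only [Module.finrank_fintype_fun_eq_card, Fintype.card_coe, Fintype.card_subtype_compl,
      Fintype.card_fin, Fintype.card_unique]
    omega)
  have hcomb : comb a = ∑ i : S, a i • eigBasis G i := by simp [comb]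
  have hin : ∀ i, inner ℝ (eigBasis G i) (comb a) = if h : i ∈ S then a ⟨i, h⟩ else 0 := by
    intro i
    rw [hcomb, inner_sum]
    simp only [real_inner_smul_right, (eigBasis G).inner_eq_ite]
    split_ifs with h
    · rw [Finset.sum_eq_single ⟨i, h⟩] <;> aesop
    · exact Finset.sum_eq_zero fun j _ => by
        rw [if_neg (by rintro rfl; exact h j.2), mul_zero]
  have hne : comb a ≠ 0 := by
    intro hz
    apply a0
    ext i
    have := hin i
    rw [hz, inner_zero_right, dif_pos i.2] at this
    exact this.symm
  have hq : ∀ q, ∑ i with σ i = q, comb a i = ∑ i with σ i = q0, comb a i := by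
    intro q
    by_cases h : q = q0
    · rw [h]
    · have := congrFun ha ⟨q, h⟩
      simpa [f, sub_eq_zero] using this
  have h1 := H (comb a) (fun q q' => (hq q).trans (hq q').symm) hne
  have hr : 0 < r := by
    obtain ⟨i, hi⟩ : S.Nonempty := Finset.card_pos.1 (by omega)
    exact (abs_nonneg _).trans_lt (Finset.mem_filter.1 hi).2
  have h2 : ‖shift G c (comb a)‖ ^ 2 < r ^ 2 * ‖comb a‖ ^ 2 := by
    rw [norm_sq_shift, ← (eigBasis G).sum_sq_inner_right, Finset.mul_sum]
    have key : ∀ i ∈ S, (eig G i - c) ^ 2 < r ^ 2 := by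
      intro i hi
      rw [← sq_abs (eig G i - c)]
      have := (Finset.mem_filter.1 hi).2
      gcongr
    refine Finset.sum_lt_sum ?_ ?_
    · intro i _
      by_cases hi : i ∈ S
      · have := key i hi
        gcongr
      · simp [hin, hi]
    · obtain ⟨i, hi⟩ := Function.ne_iff.1 a0
      refine ⟨i, Finset.mem_univ _, ?_⟩
      have hi' : a i ≠ 0 := hi
      have : inner ℝ (eigBasis G i) (comb a) = a i := by rw [hin, dif_pos i.2]
      rw [this]
      have := key i i.2
      gcongr
  have h3 : (r * ‖comb a‖) ^ 2 ≤ ‖shift G c (comb a)‖ ^ 2 := by gcongr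
  rw [mul_pow] at h3
  linarith

/-- The closed window of radius `r` holds at least k − 1 eigenvalues and the larger open window of
radius `R` at most k − 1, so the two hold the same ones and nothing lies in between. -/
theorem exists_isSelection (hk : 1 ≤ k) {σ : Fin n → Fin k} (hσ : Function.Surjective σ)
    {r R : ℝ} (hr : 0 ≤ r) (hrR : r < R)
    (H₁ : ∀ h : Fin k → ℝ, ∑ q, h q = 0 →
      ‖shift G c (labelVec σ h)‖ ≤ r * ‖labelVec σ h‖)
    (H₂ : ∀ w : EuclideanSpace ℝ (Fin n),
      (∀ q q', ∑ i with σ i = q, w i = ∑ i with σ i = q', w i) → w ≠ 0 →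
      R * ‖w‖ ≤ ‖shift G c w‖) :
    ∃ e : Fin (k - 1) ↪ Fin n, IsSelection G c r R e := by
  have h1 := le_card_eig_near hσ hr H₁
  have h2 := card_eig_near_le hk H₂
  have hsub : (Finset.univ.filter fun i => |eig G i - c| ≤ r) ⊆
      Finset.univ.filter fun i => |eig G i - c| < R := by
    intro i
    simp only [Finset.mem_filter, Finset.mem_univ, true_and]
    exact fun h => h.trans_lt hrR
  have heq := Finset.eq_of_subset_of_card_le hsub (h2.trans h1)
  have hcard : (Finset.univ.filter fun i => |eig G i - c| ≤ r).card = k - 1 :=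
    le_antisymm (heq ▸ h2) h1
  refine ⟨(Finset.orderEmbOfFin _ hcard).toEmbedding, ?_, ?_⟩
  · intro j
    exact (Finset.mem_filter.1 (Finset.orderEmbOfFin_mem _ hcard j)).2
  · intro i hi
    have : i ∉ Finset.univ.filter fun i => |eig G i - c| ≤ r := by
      intro h
      apply hi
      have := Finset.range_orderEmbOfFin _ hcard
      simpa using (this ▸ Finset.mem_coe.2 h :
        i ∈ Set.range (Finset.orderEmbOfFin _ hcard))
    rw [heq] at this
    simpa using this

/-- The mass of a vector outside the span of an eigenframe is controlled by `(A - c) w`. -/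
theorem IsEigenframe.norm_sq_sub_le {r R : ℝ} {e : Fin m ↪ Fin n} (hrR : r < R) (hr : 0 ≤ r)
    (he : IsSelection G c r R e) {v : Fin m → EuclideanSpace ℝ (Fin n)} (hv : IsEigenframe G e v)
    (w : EuclideanSpace ℝ (Fin n)) :
    R ^ 2 * (‖w‖ ^ 2 - ∑ j, inner ℝ (v j) w ^ 2) ≤ ‖shift G c w‖ ^ 2 := by
  have hperp : ∀ j, ∀ i ∉ Set.range e, inner ℝ (eigBasis G i) (v j) = 0 := by
    intro j i hi
    refine inner_eigvec_eq_zero (eigBasis_mulVec i) (hv.2 j) fun h => ?_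
    have h1 := he.1 j
    have h2 := he.2 i hi
    rw [h] at h2
    linarith
  -- With repeated eigenvalues the frame `v` need not consist of vectors of the chosen basis. It
  -- lies in the span of the selected ones, and `O` is the change of coordinates: a square matrix
  -- with orthonormal rows, hence orthogonal, so both systems capture the same mass of `w`.
  let O : Matrix (Fin m) (Fin m) ℝ := fun j l => inner ℝ (eigBasis G (e l)) (v j)
  have hsum : ∀ x y : EuclideanSpace ℝ (Fin n), (∀ i ∉ Set.range e,
      inner ℝ (eigBasis G i) x = 0) → inner ℝ x y =
      ∑ l, inner ℝ (eigBasis G (e l)) x * inner ℝ (eigBasis G (e l)) y := by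
    intro x y hx
    rw [← (eigBasis G).sum_inner_mul_inner x y]
    rw [← Finset.sum_map Finset.univ e
      (fun i => inner ℝ (eigBasis G i) x * inner ℝ (eigBasis G i) y)]
    symm
    simp_rw [real_inner_comm x]
    refine Finset.sum_subset (Finset.subset_univ _) fun i _ hi => ?_
    rw [real_inner_comm, hx i (by simpa using hi), zero_mul]
  have hO : O * O.transpose = 1 := by
    ext j j'
    rw [Matrix.mul_apply, Matrix.one_apply, ← (orthonormal_iff_ite.1 hv.1) j j',
      hsum _ _ (hperp j)]
    rfl
  have hO' : O.transpose * O = 1 := mul_eq_one_comm.1 hO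
  let β : Fin m → ℝ := fun l => inner ℝ (eigBasis G (e l)) w
  have hvw : ∀ j, inner ℝ (v j) w = O.mulVec β j := fun j => hsum _ _ (hperp j)
  have hβ : ∑ j, inner ℝ (v j) w ^ 2 = ∑ l, β l ^ 2 := by
    have : O.mulVec β ⬝ᵥ O.mulVec β = β ⬝ᵥ β := by
      rw [Matrix.dotProduct_mulVec, Matrix.vecMul_mulVec, hO', Matrix.vecMul_one]
    simpa [hvw, dotProduct, sq] using this
  rw [hβ, norm_sq_shift, ← (eigBasis G).sum_sq_inner_right w]
  have hsplit : ∀ f : Fin n → ℝ, ∑ i, f i =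
      ∑ l, f (e l) + ∑ i ∈ Finset.univ.filter (fun i => i ∉ Set.range e), f i := by
    intro f
    classical
    rw [← Finset.sum_filter_add_sum_filter_not Finset.univ (fun i => i ∈ Set.range e)]
    congr 1
    rw [← Finset.sum_map Finset.univ e]
    refine Finset.sum_congr ?_ fun _ _ => rfl
    ext i
    simp
  rw [hsplit fun i => inner ℝ (eigBasis G i) w ^ 2, hsplit]
  simp only [β, add_sub_cancel_left]
  refine (?_ : _ ≤ _).trans (le_add_of_nonneg_left (by positivity))
  rw [Finset.mul_sum]
  refine Finset.sum_le_sum fun i hi => ?_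
  have := he.2 i (Finset.mem_filter.1 hi).2
  gcongr ?_ * _
  rw [← sq_abs (eig G i - c)]
  have : 0 ≤ R := by linarith
  gcongr

end Spectral

end SGBM

namespace SGBM

/-! ### k-means on the rows, and the majority vote. -/

section KMeans

variable {n k m : ℕ}

theorem IsBalanced.card_mul {σ : Fin n → Fin k} (hσ : IsBalanced σ) (q : Fin k) :
    (k : ℝ) * ((Finset.univ.filter fun i => σ i = q).card : ℝ) = n := by
  exact_mod_cast hσ q

theorem IsBalanced.card_eq {σ : Fin n → Fin k} (hσ : IsBalanced σ) (q : Fin k) :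
    ((Finset.univ.filter fun i => σ i = q).card : ℝ) = n / k := by
  have hk : (k : ℝ) ≠ 0 := by
    have := q.pos
    positivity
  rw [eq_div_iff hk, mul_comm, hσ.card_mul]

theorem IsBalanced.surjective {σ : Fin n → Fin k} (hσ : IsBalanced σ) (hn : 0 < n) :
    Function.Surjective σ := by
  intro q
  have h := hσ q
  have : 0 < (Finset.univ.filter fun i => σ i = q).card := by
    by_contra! h0
    rw [Nat.le_zero.1 h0, mul_zero] at h
    omega
  obtain ⟨i, hi⟩ := Finset.card_pos.1 this
  exact ⟨i, (Finset.mem_filter.1 hi).2⟩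

theorem IsBalanced.sum_comp {σ : Fin n → Fin k} (hσ : IsBalanced σ) (f : Fin k → ℝ) :
    ∑ i, f (σ i) = n / k * ∑ q, f q := by
  rw [← Finset.sum_fiberwise (s := Finset.univ) (g := σ), Finset.mul_sum]
  refine Finset.sum_congr rfl fun q _ => ?_
  rw [Finset.sum_congr rfl (g := fun _ => f q) fun i hi => by rw [(Finset.mem_filter.1 hi).2],
    Finset.sum_const, nsmul_eq_mul, hσ.card_eq]

theorem IsBalanced.norm_sq_labelVec {σ : Fin n → Fin k} (hσ : IsBalanced σ) (h : Fin k → ℝ) :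
    ‖labelVec σ h‖ ^ 2 = n / k * ∑ q, h q ^ 2 := by
  rw [EuclideanSpace.real_norm_sq_eq]
  exact hσ.sum_comp fun q => h q ^ 2

/-- The total of the coordinates with label `q`. -/
def labelSum (σ : Fin n → Fin k) (w : EuclideanSpace ℝ (Fin n)) (q : Fin k) : ℝ :=
  ∑ i with σ i = q, w i

theorem inner_labelVec (σ : Fin n → Fin k) (h : Fin k → ℝ) (w : EuclideanSpace ℝ (Fin n)) :
    inner ℝ w (labelVec σ h) = ∑ q, h q * labelSum σ w q := by
  simp only [labelSum, Finset.mul_sum]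
  rw [PiLp.inner_apply, ← Finset.sum_fiberwise (s := Finset.univ) (g := σ)]
  refine Finset.sum_congr rfl fun q _ => Finset.sum_congr rfl fun i hi => ?_
  simp [(Finset.mem_filter.1 hi).2]

/-- The average of the rows with label `q`. -/
noncomputable def labelMean (σ : Fin n → Fin k) (v : Fin m → EuclideanSpace ℝ (Fin n))
    (q : Fin k) : EuclideanSpace ℝ (Fin m) :=
  WithLp.toLp 2 fun j => k / n * labelSum σ (v j) q

/-- The within-class variance is the total second moment, which is `m` by orthonormality, minus n/k
times the squared norms of the class means. -/
theorem kMeansCost_labelMean {σ : Fin n → Fin k} (hσ : IsBalanced σ) (hn : 0 < n) (hk : 0 < k)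
    {v : Fin m → EuclideanSpace ℝ (Fin n)} (hv : Orthonormal ℝ v) :
    kMeansCost (row v) σ (labelMean σ v) = m - k / n * ∑ j, ∑ q, labelSum σ (v j) q ^ 2 := by
  have hn' : (n : ℝ) ≠ 0 := by positivity
  have hk' : (k : ℝ) ≠ 0 := by positivity
  simp only [kMeansCost, EuclideanSpace.real_norm_sq_eq]
  rw [Finset.sum_comm, Finset.mul_sum]
  have hm : (m : ℝ) = ∑ j : Fin m, 1 := by simp
  rw [hm, ← Finset.sum_sub_distrib]
  refine Finset.sum_congr rfl fun j _ => ?_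
  have h1 : ∑ i, v j i ^ 2 = 1 := by
    rw [← EuclideanSpace.real_norm_sq_eq, hv.1 j, one_pow]
  have h2 := hσ.sum_comp fun q => (k / n * labelSum σ (v j) q) ^ 2
  have h3 := inner_labelVec σ (fun q => k / n * labelSum σ (v j) q) (v j)
  rw [PiLp.inner_apply] at h3
  simp only [labelVec_apply, RCLike.inner_apply, conj_trivial] at h3
  simp only [labelMean, row, PiLp.sub_apply, sub_sq, Finset.sum_add_distrib,
    Finset.sum_sub_distrib, h1]
  rw [h2]
  rw [Finset.sum_congr rfl fun i _ => mul_assoc 2 _ _, ← Finset.mul_sum, h3]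
  simp only [mul_pow, mul_assoc, ← Finset.mul_sum, ← sq]
  field_simp
  ring

/-- The vectors `v` capture almost all the mass of the differences of label indicators. -/
theorem sum_labelSum_sub_sq {σ : Fin n → Fin k} (hσ : IsBalanced σ)
    {v : Fin m → EuclideanSpace ℝ (Fin n)} {δ : ℝ}
    (H : ∀ h : Fin k → ℝ, ∑ q, h q = 0 →
      ‖labelVec σ h‖ ^ 2 - ∑ j, inner ℝ (v j) (labelVec σ h) ^ 2 ≤ δ * ‖labelVec σ h‖ ^ 2)
    {q q' : Fin k} (hq : q ≠ q') :
    (1 - δ) * (2 * n / k) ≤ ∑ j, (labelSum σ (v j) q - labelSum σ (v j) q') ^ 2 := by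
  -- The difference of two class indicators has squared norm 2n/k, and its inner product with `v j`
  -- is a difference of label sums.
  have h := H (Pi.single q 1 - Pi.single q' 1) (by simp)
  have hn : ∑ p, (Pi.single q (1 : ℝ) - Pi.single q' 1 : Fin k → ℝ) p ^ 2 = 2 := by
    have : ∀ p, (Pi.single q (1 : ℝ) - Pi.single q' 1 : Fin k → ℝ) p ^ 2 =
        (Pi.single q (1 : ℝ) + Pi.single q' 1 : Fin k → ℝ) p := by
      intro p
      by_cases h1 : p = q
      · subst h1; simp [hq]
      · by_cases h2 : p = q'
        · subst h2; simp [h1]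
        · simp [h1, h2]
    simp only [this]
    simp [Finset.sum_add_distrib]
    norm_num
  rw [hσ.norm_sq_labelVec, hn] at h
  simp only [inner_labelVec, Pi.sub_apply, sub_mul, Finset.sum_sub_distrib] at h
  simp only [Pi.single_apply, ite_mul, one_mul, zero_mul, Finset.sum_ite_eq', Finset.mem_univ,
    if_true] at h
  rw [show (n : ℝ) / k * 2 = 2 * n / k by ring] at h
  linarith

/-- Summing the pairwise separations over ordered pairs bounds the between-class variance from
below, since ∑_{q,q'} (a_q − a_{q'})² ≤ 2k ∑ a_q². There are exactly k − 1 columns, so the main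
terms cancel and (k − 1)δ remains. -/
theorem kMeansCost_labelMean_le {σ : Fin n → Fin k} (hσ : IsBalanced σ) (hn : 0 < n)
    (hk : 0 < k) {v : Fin (k - 1) → EuclideanSpace ℝ (Fin n)} (hv : Orthonormal ℝ v) {δ : ℝ}
    (H : ∀ h : Fin k → ℝ, ∑ q, h q = 0 →
      ‖labelVec σ h‖ ^ 2 - ∑ j, inner ℝ (v j) (labelVec σ h) ^ 2 ≤ δ * ‖labelVec σ h‖ ^ 2) :
    kMeansCost (row v) σ (labelMean σ v) ≤ k * δ - δ := by
  rw [kMeansCost_labelMean hσ hn hk hv]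
  have hn' : (0 : ℝ) < n := by positivity
  have hk' : (0 : ℝ) < k := by positivity
  have h1 : ∑ q : Fin k, ∑ q' : Fin k, (if q = q' then 0 else (1 - δ) * (2 * n / k)) ≤
      ∑ q : Fin k, ∑ q' : Fin k, ∑ j, (labelSum σ (v j) q - labelSum σ (v j) q') ^ 2 := by
    refine Finset.sum_le_sum fun q _ => Finset.sum_le_sum fun q' _ => ?_
    split_ifs with h
    · positivity
    · exact sum_labelSum_sub_sq hσ H h
  have h2 : ∑ q : Fin k, ∑ q' : Fin k, (if q = q' then 0 else (1 - δ) * (2 * n / k)) =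
      2 * n * (k - 1) * (1 - δ) := by
    have : ∀ q q' : Fin k, (if q = q' then 0 else (1 - δ) * (2 * n / k)) =
        (1 - δ) * (2 * n / k) - if q = q' then (1 - δ) * (2 * n / k) else 0 := by
      intro q q'
      split_ifs <;> ring
    simp only [this, Finset.sum_sub_distrib, Finset.sum_const, Finset.card_univ, Fintype.card_fin,
      Finset.sum_ite_eq, Finset.mem_univ, if_true, nsmul_eq_mul]
    field_simp
  have h3 : ∑ q : Fin k, ∑ q' : Fin k, ∑ j, (labelSum σ (v j) q - labelSum σ (v j) q') ^ 2 ≤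
      2 * k * ∑ j, ∑ q, labelSum σ (v j) q ^ 2 := by
    calc _ = ∑ j, ∑ q : Fin k, ∑ q' : Fin k,
          (labelSum σ (v j) q - labelSum σ (v j) q') ^ 2 := by
          rw [Finset.sum_comm (s := (Finset.univ : Finset (Fin (k - 1))))]
          exact Finset.sum_congr rfl fun q _ => Finset.sum_comm
      _ ≤ _ := by
          rw [Finset.mul_sum]
          refine Finset.sum_le_sum fun j _ => ?_
          simp only [sub_sq, Finset.sum_add_distrib, Finset.sum_sub_distrib, Finset.sum_const,
            Finset.card_univ, Fintype.card_fin, nsmul_eq_mul, ← Finset.mul_sum, ← Finset.sum_mul]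
          nlinarith [sq_nonneg (∑ q, labelSum σ (v j) q)]
  rw [h2] at h1
  have h4 := h1.trans h3
  have h5 : (k - 1) * (1 - δ) ≤ k / n * ∑ j, ∑ q, labelSum σ (v j) q ^ 2 := by
    rw [div_mul_eq_mul_div, le_div_iff₀ hn']
    linarith
  rw [Nat.cast_sub (by omega : 1 ≤ k)]
  push_cast
  linarith

theorem labelMean_dist {σ : Fin n → Fin k} (hσ : IsBalanced σ) (hn : 0 < n)
    {v : Fin m → EuclideanSpace ℝ (Fin n)} {δ : ℝ} (hδ : δ ≤ 1 / 2)
    (H : ∀ h : Fin k → ℝ, ∑ q, h q = 0 →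
      ‖labelVec σ h‖ ^ 2 - ∑ j, inner ℝ (v j) (labelVec σ h) ^ 2 ≤ δ * ‖labelVec σ h‖ ^ 2)
    {q q' : Fin k} (hq : q ≠ q') :
    (k : ℝ) / n ≤ ‖labelMean σ v q - labelMean σ v q'‖ ^ 2 := by
  have hn' : (0 : ℝ) < n := by positivity
  have hk' : (0 : ℝ) < k := by
    have := q.pos
    positivity
  have h1 := sum_labelSum_sub_sq hσ H hq
  rw [EuclideanSpace.real_norm_sq_eq]
  simp only [labelMean, PiLp.sub_apply, ← mul_sub, mul_pow, ← Finset.mul_sum]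
  have h2 : 1 / 2 * (2 * n / k) ≤ (1 - δ) * (2 * n / k : ℝ) := by
    gcongr
    linarith
  calc (k : ℝ) / n = (k / n) ^ 2 * (1 / 2 * (2 * n / k)) := by field_simp
    _ ≤ _ := by
      gcongr
      exact h2.trans h1

/-- Class means are at distance at least √(k/n). Call a vertex bad if its assigned centre is at
least half of that away from its class mean. Two good vertices with the same centre then belong to
the same class. Comparing the cost with that of the true labels shows that there are fewer bad
vertices than the n/k members of a class, so every class has a good vertex, and the centres of these
representatives define `π`. -/
theorem exists_perm_of_kMeans {σ : Fin n → Fin k} (hσ : IsBalanced σ) (hn : 0 < n) (hk : 0 < k)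
    {v : Fin (k - 1) → EuclideanSpace ℝ (Fin n)} (hv : Orthonormal ℝ v) {δ η : ℝ}
    (hη : 0 ≤ η) (hδ : 16 * (1 + η) * k * δ < 1) (hδ0 : 0 ≤ δ)
    (H : ∀ h : Fin k → ℝ, ∑ q, h q = 0 →
      ‖labelVec σ h‖ ^ 2 - ∑ j, inner ℝ (v j) (labelVec σ h) ^ 2 ≤ δ * ‖labelVec σ h‖ ^ 2)
    {s : Fin n → Fin k} (hs : IsKMeansOutput η (row v) s) :
    ∃ π : Equiv.Perm (Fin k),
      ((Finset.univ.filter fun i => s i ≠ π (σ i)).card : ℝ) ≤ 16 * (1 + η) * n * δ := by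
  have hn' : (0 : ℝ) < n := by positivity
  have hk' : (1 : ℝ) ≤ k := by exact_mod_cast hk
  have hδ2 : δ ≤ 1 / 2 := by
    have : 1 * 1 * δ ≤ (1 + η) * k * δ := by gcongr; linarith
    nlinarith
  obtain ⟨x, hx⟩ := hs
  set y := labelMean σ v with hy
  have hcost := kMeansCost_labelMean_le hσ hn hk hv H
  have hx' := hx σ y
  -- The threshold is a quarter of the squared separation in `labelMean_dist`.
  set B := Finset.univ.filter fun i => (k : ℝ) / (4 * n) ≤ ‖x (s i) - y (σ i)‖ ^ 2 with hB
  have hBsum : (B.card : ℝ) * (k / (4 * n)) ≤ 4 * (1 + η) * (k * δ - δ) := by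
    calc (B.card : ℝ) * (k / (4 * n)) = ∑ i ∈ B, (k : ℝ) / (4 * n) := by simp
      _ ≤ ∑ i ∈ B, ‖x (s i) - y (σ i)‖ ^ 2 :=
          Finset.sum_le_sum fun i hi => (Finset.mem_filter.1 hi).2
      _ ≤ ∑ i, ‖x (s i) - y (σ i)‖ ^ 2 :=
          Finset.sum_le_sum_of_subset_of_nonneg (Finset.subset_univ _) fun _ _ _ => by positivity
      _ ≤ ∑ i, (2 * ‖x (s i) - row v i‖ ^ 2 + 2 * ‖y (σ i) - row v i‖ ^ 2) := by
          refine Finset.sum_le_sum fun i _ => ?_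
          have h1 : ‖x (s i) - y (σ i)‖ ≤ ‖x (s i) - row v i‖ + ‖y (σ i) - row v i‖ := by
            have := norm_sub_le (x (s i) - row v i) (y (σ i) - row v i)
            simpa using this
          have h2 : ‖x (s i) - y (σ i)‖ ^ 2 ≤ (‖x (s i) - row v i‖ + ‖y (σ i) - row v i‖) ^ 2 := by
            gcongr
          nlinarith [sq_nonneg (‖x (s i) - row v i‖ - ‖y (σ i) - row v i‖)]
      _ = 2 * kMeansCost (row v) s x + 2 * kMeansCost (row v) σ y := by
          simp [kMeansCost, Finset.sum_add_distrib, Finset.mul_sum]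
      _ ≤ 2 * ((1 + η) * (k * δ - δ)) + 2 * ((1 + η) * (k * δ - δ)) := by
          have h0 : 0 ≤ k * δ - δ := by nlinarith
          have h1 : (1 + η) * kMeansCost (row v) σ y ≤ (1 + η) * (k * δ - δ) := by gcongr
          have h2 : k * δ - δ ≤ (1 + η) * (k * δ - δ) := by nlinarith
          linarith
      _ = _ := by ring
  have hBcard : (B.card : ℝ) ≤ 16 * (1 + η) * n * δ := by
    have h1 : (B.card : ℝ) * k ≤ 16 * (1 + η) * n * (k * δ - δ) := by
      have := mul_le_mul_of_nonneg_right hBsum (by positivity : (0 : ℝ) ≤ 4 * n)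
      have h3 : (B.card : ℝ) * (k / (4 * n)) * (4 * n) = B.card * k := by field_simp
      rw [h3] at this
      linarith
    have h2 : 16 * (1 + η) * n * (k * δ - δ) ≤ 16 * (1 + η) * n * δ * k := by
      have : 0 ≤ 16 * (1 + η) * n * δ := by positivity
      nlinarith
    exact le_of_mul_le_mul_right (h1.trans h2) (by linarith)
  have hgood : ∀ i j, i ∉ B → j ∉ B → s i = s j → σ i = σ j := by
    intro i j hi hj hij
    by_contra hne
    have h1 := labelMean_dist hσ hn hδ2 H hne
    have hi' : ‖x (s i) - y (σ i)‖ ^ 2 < k / (4 * n) := by simpa [hB] using hi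
    have hj' : ‖x (s j) - y (σ j)‖ ^ 2 < k / (4 * n) := by simpa [hB] using hj
    rw [hij] at hi'
    have h2 : ‖y (σ i) - y (σ j)‖ ≤ ‖x (s j) - y (σ j)‖ + ‖x (s j) - y (σ i)‖ := by
      have := norm_sub_le (x (s j) - y (σ j)) (x (s j) - y (σ i))
      simpa using this
    have h3 : ‖y (σ i) - y (σ j)‖ ^ 2 ≤
        (‖x (s j) - y (σ j)‖ + ‖x (s j) - y (σ i)‖) ^ 2 := by gcongr
    have h4 : (k : ℝ) / n = 4 * (k / (4 * n)) := by field_simp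
    rw [← hy] at h1
    nlinarith [sq_nonneg (‖x (s j) - y (σ j)‖ - ‖x (s j) - y (σ i)‖)]
  -- A class contained in `B` would give n ≤ k * |B| ≤ 16(1 + η)kδ n < n.
  have hrep : ∀ q, ∃ i, σ i = q ∧ i ∉ B := by
    intro q
    by_contra! hc
    have h1 : (Finset.univ.filter fun i => σ i = q) ⊆ B := fun i hi =>
      hc i (Finset.mem_filter.1 hi).2
    have h2 : ((Finset.univ.filter fun i => σ i = q).card : ℝ) ≤ B.card := by
      exact_mod_cast Finset.card_le_card h1
    have h3 := hσ.card_mul q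
    have h4 : (k : ℝ) * ((Finset.univ.filter fun i => σ i = q).card : ℝ) ≤
        k * (16 * (1 + η) * n * δ) := by gcongr; linarith
    nlinarith
  choose r hr hrB using hrep
  have hinj : Function.Injective fun q => s (r q) := fun q q' h => by
    rw [← hr q, ← hr q']
    exact hgood _ _ (hrB q) (hrB q') h
  refine ⟨Equiv.ofBijective _ (Finite.injective_iff_bijective.1 hinj), le_trans ?_ hBcard⟩
  refine Nat.cast_le.2 (Finset.card_le_card fun i hi => ?_)
  by_contra hiB
  apply (Finset.mem_filter.1 hi).2
  obtain ⟨q, hq⟩ := (Finite.injective_iff_bijective.1 hinj).2 (s i)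
  have h1 := hgood i (r q) hiB (hrB q) hq.symm
  rw [Equiv.ofBijective_apply, h1, hr, ← hq]

theorem classificationError_le {σ s : Fin n → Fin k} (π : Equiv.Perm (Fin k)) :
    classificationError σ s ≤ (Finset.univ.filter fun i => s i ≠ π (σ i)).card := by
  refine Nat.sInf_le ⟨fun i => π.symm (s i), fun i j => by simp, ?_⟩
  rw [hammingDist]
  congr 1
  ext i
  simp [Equiv.eq_symm_apply, eq_comm]

theorem labelCount_le_add {G : SimpleGraph (Fin n)} {s t : Fin n → Fin k} {q q' : Fin k} {b : ℕ}
    (h : (Finset.univ.filter fun i => s i = q ∧ t i ≠ q').card ≤ b) (i : Fin n) :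
    labelCount G s i q ≤ labelCount G t i q' + b := by
  classical
  rw [labelCount, labelCount]
  refine le_trans ?_ (Nat.add_le_add_left h _)
  refine (Finset.card_le_card ?_).trans (Finset.card_union_le _ _)
  intro j
  simp only [Finset.mem_filter, Finset.mem_univ, true_and, Finset.mem_union]
  tauto

/-- If the true labels win the majority votes by a margin of twice the number of errors, then the
refinement recovers the labels exactly. -/
theorem loss_refinement_eq_zero {G : SimpleGraph (Fin n)} {σ s s' : Fin n → Fin k}
    (π : Equiv.Perm (Fin k)) {b : ℕ} (hb : (Finset.univ.filter fun i => s i ≠ π (σ i)).card ≤ b)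
    (hG : ∀ i q, q ≠ σ i → labelCount G σ i q + 2 * b < labelCount G σ i (σ i))
    (hs' : IsRefinement G s s') : loss σ s' = 0 := by
  have h : ∀ i, s' i = π (σ i) := by
    intro i
    by_contra hne
    have h1 := hs' i (π (σ i))
    have h2 := hG i (π.symm (s' i)) (by rwa [ne_eq, Equiv.symm_apply_eq])
    have h3 : labelCount G s i (s' i) ≤ labelCount G σ i (π.symm (s' i)) + b := by
      refine labelCount_le_add ((Finset.card_le_card fun j => ?_).trans hb) i
      simp only [Finset.mem_filter, Finset.mem_univ, true_and]
      rintro ⟨h4, h5⟩ h6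
      exact h5 (by rw [Equiv.eq_symm_apply, ← h6, h4])
    have h4 : labelCount G σ i (σ i) ≤ labelCount G s i (π (σ i)) + b := by
      refine labelCount_le_add ((Finset.card_le_card fun j => ?_).trans hb) i
      simp only [Finset.mem_filter, Finset.mem_univ, true_and]
      rintro ⟨h4, h5⟩ h6
      exact h5 (by rw [h6, h4])
    omega
  have h0 : classificationError σ s' = 0 := by
    have := classificationError_le (σ := σ) (s := s') π
    simpa [h] using this
  simp [loss, h0]

end KMeans

end SGBM

namespace SGBM

/-! ### Replacing coordinates of a product measure by independent copies. -/

section Resampling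

theorem measurePreserving_piecewise {ι : Type*} [Fintype ι] {α : ι → Type*}
    [∀ i, MeasurableSpace (α i)] (μ : ∀ i, Measure (α i)) [∀ i, IsProbabilityMeasure (μ i)]
    (s : ι → Prop) [DecidablePred s] :
    MeasurePreserving (fun p : (∀ i, α i) × (∀ i, α i) => fun i => if s i then p.2 i else p.1 i)
      ((Measure.pi μ).prod (Measure.pi μ)) (Measure.pi μ) := by
  have hm : Measurable
      (fun p : (∀ i, α i) × (∀ i, α i) => fun i => if s i then p.2 i else p.1 i) := by
    refine measurable_pi_lambda _ fun i => ?_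
    by_cases h : s i <;> simp only [h, if_true, if_false] <;> fun_prop
  refine ⟨hm, (Measure.pi_eq fun t ht => ?_).symm⟩
  rw [Measure.map_apply hm (MeasurableSet.univ_pi ht)]
  have : (fun p : (∀ i, α i) × (∀ i, α i) => fun i => if s i then p.2 i else p.1 i) ⁻¹'
      Set.univ.pi t = (Set.univ.pi fun i => if s i then Set.univ else t i) ×ˢ
        (Set.univ.pi fun i => if s i then t i else Set.univ) := by
    ext p
    simp only [Set.mem_preimage, Set.mem_pi, Set.mem_univ, true_imp_iff, Set.mem_prod,
      ← forall_and]
    refine forall_congr' fun i => ?_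
    by_cases h : s i <;> simp [h]
  rw [this, Measure.prod_prod, Measure.pi_pi, Measure.pi_pi, ← Finset.prod_mul_distrib]
  refine Finset.prod_congr rfl fun i _ => ?_
  by_cases h : s i <;> simp [h]

theorem measurePreserving_prodProdProdComm {α β γ δ : Type*} [MeasurableSpace α]
    [MeasurableSpace β] [MeasurableSpace γ] [MeasurableSpace δ] (a : Measure α) (b : Measure β)
    (c : Measure γ) (d : Measure δ) [IsProbabilityMeasure a] [IsProbabilityMeasure b]
    [IsProbabilityMeasure c] [IsProbabilityMeasure d] :
    MeasurePreserving (fun p : (α × β) × (γ × δ) => ((p.1.1, p.2.1), (p.1.2, p.2.2)))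
      ((a.prod b).prod (c.prod d)) ((a.prod c).prod (b.prod d)) := by
  have h1 := measurePreserving_prodAssoc a b (c.prod d)
  have h2 := (MeasurePreserving.id a).prod
    (MeasurePreserving.symm MeasurableEquiv.prodAssoc (measurePreserving_prodAssoc b c d))
  have h3 := (MeasurePreserving.id a).prod
    ((Measure.measurePreserving_swap (μ := b) (ν := c)).prod (MeasurePreserving.id d))
  have h4 := (MeasurePreserving.id a).prod (measurePreserving_prodAssoc c b d)
  have h5 := MeasurePreserving.symm MeasurableEquiv.prodAssoc
    (measurePreserving_prodAssoc a c (b.prod d))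
  exact h5.comp (h4.comp (h3.comp (h2.comp h1)))

end Resampling

/-! ### The independent model, and moments by resampling one vertex. -/

section Space

instance (d : ℕ) : IsProbabilityMeasure (torusMeasure d) := by
  unfold torusMeasure; infer_instance

/-- The uniform distribution on the unit interval. -/
noncomputable def uniform : Measure ℝ := volume.restrict (Set.Ico 0 1)

instance : IsProbabilityMeasure uniform := ⟨by simp [uniform]⟩

theorem uniform_Iio {p : ℝ} (h : p ∈ Set.Icc (0 : ℝ) 1) :
    uniform (Set.Iio p) = ENNReal.ofReal p := by
  rw [uniform, Measure.restrict_apply measurableSet_Iio]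
  have : Set.Iio p ∩ Set.Ico 0 1 = Set.Ico 0 p := by
    ext x
    simp only [Set.mem_inter_iff, Set.mem_Iio, Set.mem_Ico]
    exact ⟨fun hx => ⟨hx.2.1, hx.1⟩, fun hx => ⟨hx.2, hx.1, hx.2.trans_le h.2⟩⟩
  rw [this, Real.volume_Ico, sub_zero]

theorem uniform_Ici {p : ℝ} (h : p ∈ Set.Icc (0 : ℝ) 1) :
    uniform (Set.Ici p) = ENNReal.ofReal (1 - p) := by
  rw [← Set.compl_Iio, measure_compl measurableSet_Iio (measure_ne_top _ _), uniform_Iio h,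
    measure_univ, ENNReal.ofReal_sub _ h.1, ENNReal.ofReal_one]

/-- Positions of the vertices, together with one number for every unordered pair of vertices. -/
abbrev Space (d n : ℕ) : Type := (Fin n → UnitAddTorus (Fin d)) × (Sym2 (Fin n) → ℝ)

/-- All the positions and all the numbers attached to pairs are independent and uniform. -/
noncomputable def prob (d n : ℕ) : Measure (Space d n) :=
  (Measure.pi fun _ => torusMeasure d).prod (Measure.pi fun _ => uniform)

instance (d n : ℕ) : IsProbabilityMeasure (prob d n) := by
  unfold prob; infer_instance

variable {d n k : ℕ}

/-- Replace the data attached to the vertex `l` in `p.1` by those in `p.2`. -/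
def resample (l : Fin n) (p : Space d n × Space d n) : Space d n :=
  (fun i => if i = l then p.2.1 i else p.1.1 i, fun e => if l ∈ e then p.2.2 e else p.1.2 e)

/-- Averaging over the second copy is the conditional expectation given all data not attached to
`l`; invariance of the law is the tower property, and no σ-algebras are needed. -/
theorem measurePreserving_resample (l : Fin n) :
    MeasurePreserving (resample l) ((prob d n).prod (prob d n)) (prob d n) :=
  ((measurePreserving_piecewise (fun _ => torusMeasure d) fun i => i = l).prod
    (measurePreserving_piecewise (fun _ => uniform) fun e : Sym2 (Fin n) => l ∈ e)).comp
    (measurePreserving_prodProdProdComm _ _ _ _)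

theorem integral_comp_eq {α β : Type*} [MeasurableSpace α] [MeasurableSpace β] {μ : Measure α}
    {ν : Measure β} {φ : α → β} (h : MeasurePreserving φ μ ν) {f : β → ℝ} (hf : Measurable f) :
    ∫ x, f (φ x) ∂μ = ∫ y, f y ∂ν := by
  rw [← h.map_eq, integral_map h.measurable.aemeasurable hf.aestronglyMeasurable]

theorem integrable_of_bdd {α : Type*} [MeasurableSpace α] {μ : Measure α} [IsFiniteMeasure μ]
    {f : α → ℝ} (hf : Measurable f) {b : ℝ} (hb : ∀ x, |f x| ≤ b) : Integrable f μ :=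
  Integrable.of_bound hf.aestronglyMeasurable b (ae_of_all _ hb)

/-- If `g` does not depend on the data of `l` and the mean of `f` over the data of `l` is `c`,
then the mean of `f g` is `c` times that of `g`. -/
theorem integral_mul_of_resample {f g : Space d n → ℝ} (hf : Measurable f) (hg : Measurable g)
    {b b' : ℝ} (hfb : ∀ ω, |f ω| ≤ b) (hgb : ∀ ω, |g ω| ≤ b') (l : Fin n) {c : ℝ}
    (hfl : ∀ ω, ∫ z, f (resample l (ω, z)) ∂prob d n = c)
    (hgl : ∀ ω z, g (resample l (ω, z)) = g ω) :
    ∫ ω, f ω * g ω ∂prob d n = c * ∫ ω, g ω ∂prob d n := by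
  have hmp := measurePreserving_resample (d := d) l
  have hfg : Measurable fun ω => f ω * g ω := hf.mul hg
  have hfgb : ∀ ω, |f ω * g ω| ≤ b * b' := fun ω => by
    rw [abs_mul]
    exact mul_le_mul (hfb ω) (hgb ω) (abs_nonneg _) ((abs_nonneg _).trans (hfb ω))
  have hint : Integrable (fun p => f (resample l p) * g (resample l p))
      ((prob d n).prod (prob d n)) :=
    integrable_of_bdd (hfg.comp hmp.measurable) fun p => hfgb _
  rw [← integral_comp_eq hmp hfg, integral_prod _ hint]
  simp_rw [hgl, integral_mul_const, hfl]
  rw [integral_const_mul]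

/-- The cross terms vanish: averaging over the data of `l` kills `f l` and leaves `f j` unchanged.
-/
theorem integral_sum_sq_le {f : Fin n → Space d n → ℝ} {J : Finset (Fin n)} {b : ℝ}
    (hf : ∀ j, Measurable (f j)) (hb : ∀ j ω, |f j ω| ≤ b)
    (hmean : ∀ l ∈ J, ∀ ω, ∫ z, f l (resample l (ω, z)) ∂prob d n = 0)
    (hind : ∀ l ∈ J, ∀ j ∈ J, j ≠ l → ∀ ω z, f j (resample l (ω, z)) = f j ω) :
    ∫ ω, (∑ j ∈ J, f j ω) ^ 2 ∂prob d n ≤ b ^ 2 * J.card := by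
  have hint : ∀ i j, Integrable (fun ω => f i ω * f j ω) (prob d n) := fun i j =>
    integrable_of_bdd ((hf i).mul (hf j)) (b := b * b) fun ω => by
      rw [abs_mul]
      exact mul_le_mul (hb i ω) (hb j ω) (abs_nonneg _) ((abs_nonneg _).trans (hb i ω))
  have h1 : ∫ ω, (∑ j ∈ J, f j ω) ^ 2 ∂prob d n =
      ∑ l ∈ J, ∑ j ∈ J, ∫ ω, f l ω * f j ω ∂prob d n := by
    simp_rw [sq, Finset.sum_mul_sum]
    rw [integral_finsetSum _ fun i _ => integrable_finsetSum _ fun j _ => hint i j]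
    exact Finset.sum_congr rfl fun i _ => integral_finsetSum _ fun j _ => hint i j
  rw [h1, mul_comm, ← nsmul_eq_mul]
  refine Finset.sum_le_card_nsmul _ _ _ fun l hl => ?_
  rw [Finset.sum_eq_single l]
  · calc ∫ ω, f l ω * f l ω ∂prob d n ≤ ∫ ω, b ^ 2 ∂prob d n := by
          refine integral_mono (hint l l) (integrable_const _) fun ω => ?_
          have := hb l ω
          simp only
          rw [← sq, ← sq_abs]
          gcongr
      _ = b ^ 2 := by simp
  · intro j hj hjl
    rw [integral_mul_of_resample (hf l) (hf j) (hb l) (hb j) l (hmean l hl) (hind l hl j hj hjl),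
      zero_mul]
  · exact fun h => absurd hl h

/-- The vertices are integrated out one at a time, each contributing a factor `c`, although the
factors share data such as the position of a fixed vertex. -/
theorem integral_prod_of_resample {f : Fin n → Space d n → ℝ} {b c : ℝ}
    (hf : ∀ j, Measurable (f j)) (hb : ∀ j ω, |f j ω| ≤ b) (J : Finset (Fin n))
    (hmean : ∀ l ∈ J, ∀ ω, ∫ z, f l (resample l (ω, z)) ∂prob d n = c)
    (hind : ∀ l ∈ J, ∀ j ∈ J, j ≠ l → ∀ ω z, f j (resample l (ω, z)) = f j ω) :
    ∫ ω, ∏ j ∈ J, f j ω ∂prob d n = c ^ J.card := by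
  induction J using Finset.induction_on with
  | empty => simp
  | insert l J hl ih =>
    simp only [Finset.prod_insert hl]
    rw [integral_mul_of_resample (hf l) (Finset.measurable_fun_prod J fun j _ => hf j) (hb l)
      (b' := ∏ j ∈ J, b) (fun ω => ?_) l (hmean l (Finset.mem_insert_self _ _)),
      ih (fun i hi => hmean i (Finset.mem_insert_of_mem hi))
        (fun i hi j hj => hind i (Finset.mem_insert_of_mem hi) j (Finset.mem_insert_of_mem hj)),
      Finset.card_insert_of_notMem hl, pow_succ']
    · intro ω z
      refine Finset.prod_congr rfl fun j hj => ?_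
      exact hind l (Finset.mem_insert_self _ _) j (Finset.mem_insert_of_mem hj)
        (fun h => hl (h ▸ hj)) ω z
    · rw [Finset.abs_prod]
      exact Finset.prod_le_prod (fun _ _ => abs_nonneg _) fun j _ => hb j ω

/-- For |x| ≤ 1 one has e^x ≤ 1 + x + x². The majorants 1 + t f + t² have conditional mean 1 + t² ≤
e^{t²}, and the mean of their product factorises. -/
theorem integral_exp_sum_le {f : Fin n → Space d n → ℝ} {t : ℝ} (ht : |t| ≤ 1)
    (hf : ∀ j, Measurable (f j)) (hb : ∀ j ω, |f j ω| ≤ 1) (J : Finset (Fin n))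
    (hmean : ∀ l ∈ J, ∀ ω, ∫ z, f l (resample l (ω, z)) ∂prob d n = 0)
    (hind : ∀ l ∈ J, ∀ j ∈ J, j ≠ l → ∀ ω z, f j (resample l (ω, z)) = f j ω) :
    ∫ ω, Real.exp (t * ∑ j ∈ J, f j ω) ∂prob d n ≤ Real.exp (t ^ 2 * J.card) := by
  have hmul : ∀ j ω, |t * f j ω| ≤ 1 := fun j ω => by
    rw [abs_mul]
    exact mul_le_one₀ ht (abs_nonneg _) (hb j ω)
  have hle : ∀ j ω, Real.exp (t * f j ω) ≤ 1 + t * f j ω + t ^ 2 := by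
    intro j ω
    have h1 := Real.abs_exp_sub_one_sub_id_le (hmul j ω)
    have h2 := (abs_le.1 h1).2
    have h3 : (t * f j ω) ^ 2 ≤ t ^ 2 := by
      rw [mul_pow]
      have : f j ω ^ 2 ≤ 1 := by
        rw [← sq_abs]
        exact pow_le_one₀ (abs_nonneg _) (hb j ω)
      nlinarith [sq_nonneg t]
    linarith
  have hm : ∀ j, Measurable fun ω => 1 + t * f j ω + t ^ 2 := fun j => by
    have := hf j
    fun_prop
  have hbd : ∀ j ω, |1 + t * f j ω + t ^ 2| ≤ 3 := by
    intro j ω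
    have h1 := abs_le.1 (hmul j ω)
    have h2 : t ^ 2 ≤ 1 := by
      rw [← sq_abs]
      exact pow_le_one₀ (abs_nonneg _) ht
    rw [abs_le]
    constructor <;> nlinarith [sq_nonneg t]
  have hmean' : ∀ l ∈ J, ∀ ω,
      ∫ z, (1 + t * f l (resample l (ω, z)) + t ^ 2) ∂prob d n = 1 + t ^ 2 := by
    intro l hl ω
    have hi : Integrable (fun z => f l (resample l (ω, z))) (prob d n) :=
      integrable_of_bdd ((hf l).comp ((measurePreserving_resample l).measurable.comp
        measurable_prodMk_left)) fun z => hb l _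
    have hi' : Integrable (fun z => 1 + t * f l (resample l (ω, z))) (prob d n) :=
      (integrable_const _).add (hi.const_mul t)
    rw [integral_add hi' (integrable_const _),
      integral_add (integrable_const _) (hi.const_mul t), integral_const_mul, hmean l hl ω]
    simp
  have hprod := integral_prod_of_resample hm hbd J hmean' fun l hl j hj hjl ω z => by
    rw [hind l hl j hj hjl]
  calc ∫ ω, Real.exp (t * ∑ j ∈ J, f j ω) ∂prob d n
      = ∫ ω, ∏ j ∈ J, Real.exp (t * f j ω) ∂prob d n := by
        simp_rw [Finset.mul_sum, Real.exp_sum]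
    _ ≤ ∫ ω, ∏ j ∈ J, (1 + t * f j ω + t ^ 2) ∂prob d n := by
        refine integral_mono (integrable_of_bdd (b := ∏ j ∈ J, 3)
          (Finset.measurable_fun_prod J fun j _ => ?_) fun ω => ?_)
          (integrable_of_bdd (b := ∏ j ∈ J, 3) (Finset.measurable_fun_prod J fun j _ => hm j)
          fun ω => ?_) fun ω => ?_
        · have := hf j
          fun_prop
        · rw [Finset.abs_prod]
          refine Finset.prod_le_prod (fun _ _ => abs_nonneg _) fun j _ => ?_
          rw [abs_of_pos (Real.exp_pos _)]
          exact (hle j ω).trans ((le_abs_self _).trans (hbd j ω))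
        · rw [Finset.abs_prod]
          exact Finset.prod_le_prod (fun _ _ => abs_nonneg _) fun j _ => hbd j ω
        · exact Finset.prod_le_prod (fun _ _ => (Real.exp_pos _).le) fun j _ => hle j ω
    _ = (1 + t ^ 2) ^ J.card := hprod
    _ ≤ Real.exp (t ^ 2) ^ J.card := by
        gcongr
        linarith [Real.add_one_le_exp (t ^ 2)]
    _ = _ := by rw [← Real.exp_nat_mul, mul_comm]

/-- The integral of a function of one position and two distinct edge variables. -/
theorem integral_position_edges (l : Fin n) {p p' g : UnitAddTorus (Fin d) → ℝ}
    (hp : Measurable p) (hp' : Measurable p') (hg : Measurable g)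
    (h : ∀ x, p x ∈ Set.Icc (0 : ℝ) 1) (h' : ∀ x, p' x ∈ Set.Icc (0 : ℝ) 1) {b : ℝ}
    (hb : ∀ x, |g x| ≤ b) {e e' : Sym2 (Fin n)} (he : e ≠ e') :
    ∫ z : Space d n, (if z.2 e < p (z.1 l) then 1 else 0) * (if z.2 e' < p' (z.1 l) then 1 else 0) *
      g (z.1 l) ∂prob d n = ∫ y, p y * p' y * g y ∂torusMeasure d := by
  have hm : Measurable fun z : Space d n => (if z.2 e < p (z.1 l) then (1 : ℝ) else 0) *
      (if z.2 e' < p' (z.1 l) then 1 else 0) * g (z.1 l) := by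
    refine ((Measurable.ite (measurableSet_lt (by fun_prop) (by fun_prop)) measurable_const
      measurable_const).mul (Measurable.ite (measurableSet_lt (by fun_prop) (by fun_prop))
      measurable_const measurable_const)).mul (by fun_prop)
  have hbd : ∀ z : Space d n, |(if z.2 e < p (z.1 l) then (1 : ℝ) else 0) *
      (if z.2 e' < p' (z.1 l) then 1 else 0) * g (z.1 l)| ≤ b := by
    intro z
    have h0 : 0 ≤ b := (abs_nonneg _).trans (hb 0)
    split_ifs <;> simp [h0, hb]
  rw [prob, integral_prod _ (integrable_of_bdd hm hbd)]
  have key : ∀ x : Fin n → UnitAddTorus (Fin d), ∫ u : Sym2 (Fin n) → ℝ,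
      (if u e < p (x l) then (1 : ℝ) else 0) * (if u e' < p' (x l) then 1 else 0) * g (x l)
        ∂(Measure.pi fun _ => uniform) = p (x l) * p' (x l) * g (x l) := by
    intro x
    rw [integral_mul_const]
    congr 1
    -- For fixed positions the product is the indicator of a box that constrains only the
    -- coordinates `e` and `e'`.
    have hset : ∀ u : Sym2 (Fin n) → ℝ, (if u e < p (x l) then (1 : ℝ) else 0) *
        (if u e' < p' (x l) then 1 else 0) = Set.indicator (Set.univ.pi fun a =>
          if a = e then Set.Iio (p (x l)) else if a = e' then Set.Iio (p' (x l)) else Set.univ)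
          1 u := by
      intro u
      have : (u ∈ Set.univ.pi fun a => if a = e then Set.Iio (p (x l)) else
          if a = e' then Set.Iio (p' (x l)) else Set.univ) ↔
          u e < p (x l) ∧ u e' < p' (x l) := by
        simp only [Set.mem_pi, Set.mem_univ, true_imp_iff]
        constructor
        · intro H
          exact ⟨by simpa using H e, by simpa [he.symm] using H e'⟩
        · rintro ⟨h1, h2⟩ a
          split_ifs with h3 h4
          · subst h3; exact h1
          · subst h4; exact h2
          · trivial
      classical
      rw [Set.indicator_apply, if_congr this rfl rfl]
      by_cases h1 : u e < p (x l) <;> by_cases h2 : u e' < p' (x l) <;> simp [h1, h2]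
    rw [integral_congr_ae (ae_of_all _ hset), integral_indicator_one (MeasurableSet.univ_pi fun a => by
      split_ifs <;> simp [measurableSet_Iio]), measureReal_def, Measure.pi_pi]
    rw [← Finset.mul_prod_erase _ _ (Finset.mem_univ e),
      ← Finset.mul_prod_erase _ _ (Finset.mem_erase.2 ⟨he.symm, Finset.mem_univ e'⟩),
      Finset.prod_eq_one, if_pos rfl, if_neg he.symm, if_pos rfl, uniform_Iio (h _),
      uniform_Iio (h' _), mul_one, ENNReal.toReal_mul, ENNReal.toReal_ofReal (h _).1,
      ENNReal.toReal_ofReal (h' _).1]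
    intro a ha
    simp only [Finset.mem_erase] at ha
    rw [if_neg ha.2.1, if_neg ha.1, measure_univ]
  simp only [key]
  have hmp := measurePreserving_eval (fun _ : Fin n => torusMeasure d) l
  exact integral_comp_eq hmp ((hp.mul hp').mul hg)

theorem integral_position_edge (l : Fin n) {p g : UnitAddTorus (Fin d) → ℝ}
    (hp : Measurable p) (hg : Measurable g)
    (h : ∀ x, p x ∈ Set.Icc (0 : ℝ) 1) {b : ℝ} (hb : ∀ x, |g x| ≤ b) (e : Sym2 (Fin n)) :
    ∫ z : Space d n, (if z.2 e < p (z.1 l) then 1 else 0) * g (z.1 l) ∂prob d n =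
      ∫ y, p y * g y ∂torusMeasure d := by
  have hm : Measurable fun z : Space d n =>
      (if z.2 e < p (z.1 l) then (1 : ℝ) else 0) * g (z.1 l) :=
    (Measurable.ite (measurableSet_lt (by fun_prop) (by fun_prop)) measurable_const
      measurable_const).mul (by fun_prop)
  have hbd : ∀ z : Space d n, |(if z.2 e < p (z.1 l) then (1 : ℝ) else 0) * g (z.1 l)| ≤ b := by
    intro z
    have h0 : 0 ≤ b := (abs_nonneg _).trans (hb 0)
    split_ifs <;> simp [h0, hb]
  rw [prob, integral_prod _ (integrable_of_bdd hm hbd)]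
  have key : ∀ x : Fin n → UnitAddTorus (Fin d), ∫ u : Sym2 (Fin n) → ℝ,
      (if u e < p (x l) then (1 : ℝ) else 0) * g (x l) ∂(Measure.pi fun _ => uniform) =
      p (x l) * g (x l) := by
    intro x
    rw [integral_mul_const]
    congr 1
    have hmp := measurePreserving_eval (fun _ : Sym2 (Fin n) => uniform) e
    have : ∀ u : Sym2 (Fin n) → ℝ, (if u e < p (x l) then (1 : ℝ) else 0) =
        Set.indicator (Function.eval e ⁻¹' Set.Iio (p (x l))) 1 u := fun u => by
      classical
      rw [Set.indicator_apply]
      rfl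
    rw [integral_congr_ae (ae_of_all _ this),
      integral_indicator_one (hmp.measurable measurableSet_Iio), measureReal_def,
      hmp.measure_preimage measurableSet_Iio.nullMeasurableSet, uniform_Iio (h _),
      ENNReal.toReal_ofReal (h _).1]
  simp only [key]
  have hmp := measurePreserving_eval (fun _ : Fin n => torusMeasure d) l
  exact integral_comp_eq hmp (hp.mul hg)

end Space

end SGBM

namespace SGBM

/-! ### Coupling the block model with the independent variables. -/

section RandomGraph

variable {d n k : ℕ} {Fi Fo : UnitAddTorus (Fin d) → ℝ}

theorem connection_mem_Icc (hFi : IsConnectivity Fi) (hFo : IsConnectivity Fo)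
    (x : UnitAddTorus (Fin d)) (s t : Fin k) :
    connection Fi Fo x s t ∈ Set.Icc (0 : ℝ) 1 := by
  unfold connection
  split_ifs
  exacts [hFi.mem_Icc x, hFo.mem_Icc x]

theorem connection_symm (hFi : IsConnectivity Fi) (hFo : IsConnectivity Fo)
    (x y : UnitAddTorus (Fin d)) (s t : Fin k) :
    connection Fi Fo (x - y) s t = connection Fi Fo (y - x) t s := by
  unfold connection
  rw [← neg_sub y x, hFi.even, hFo.even]
  simp [eq_comm]

theorem measurable_connection (hFi : IsConnectivity Fi) (hFo : IsConnectivity Fo) (s t : Fin k) :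
    Measurable fun x => connection Fi Fo x s t := by
  unfold connection
  split_ifs
  exacts [hFi.measurable, hFo.measurable]

/-- The graph in which `i` and `j` are joined if the number attached to `{i, j}` is below the
connection probability. -/
def randomGraph (hFi : IsConnectivity Fi) (hFo : IsConnectivity Fo) (σ : Fin n → Fin k)
    (ω : Space d n) : SimpleGraph (Fin n) where
  Adj i j := i ≠ j ∧ ω.2 s(i, j) < connection Fi Fo (ω.1 i - ω.1 j) (σ i) (σ j)
  symm := ⟨fun i j h => ⟨h.1.symm, by
    rw [Sym2.eq_swap, connection_symm hFi hFo]
    exact h.2⟩⟩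
  loopless := ⟨fun _ h => h.1 rfl⟩

variable (hFi : IsConnectivity Fi) (hFo : IsConnectivity Fo) (σ : Fin n → Fin k)

theorem randomGraph_adj (ω : Space d n) (i j : Fin n) : (randomGraph hFi hFo σ ω).Adj i j ↔
    i ≠ j ∧ ω.2 s(i, j) < connection Fi Fo (ω.1 i - ω.1 j) (σ i) (σ j) := Iff.rfl

theorem measurableSet_randomGraph_adj (i j : Fin n) :
    MeasurableSet {ω : Space d n | (randomGraph hFi hFo σ ω).Adj i j} := by
  have h1 : Measurable fun ω : Space d n =>
      connection Fi Fo (ω.1 i - ω.1 j) (σ i) (σ j) :=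
    (measurable_connection hFi hFo (σ i) (σ j)).comp (by fun_prop)
  exact (MeasurableSet.const (i ≠ j)).inter (measurableSet_lt (by fun_prop) h1)

theorem measurableSet_randomGraph_eq (G : SimpleGraph (Fin n)) :
    MeasurableSet {ω : Space d n | randomGraph hFi hFo σ ω = G} := by
  have : {ω : Space d n | randomGraph hFi hFo σ ω = G} =
      ⋂ i, ⋂ j, {ω | (randomGraph hFi hFo σ ω).Adj i j ↔ G.Adj i j} := by
    ext ω
    simp [SimpleGraph.ext_iff, funext_iff]
  rw [this]
  refine MeasurableSet.iInter fun i => MeasurableSet.iInter fun j => ?_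
  have h1 := measurableSet_randomGraph_adj hFi hFo σ i j
  by_cases h : G.Adj i j
  · simpa [h] using h1
  · simp only [h, iff_false]
    exact h1.compl

/-- For fixed positions the event is a box: the number on each non-diagonal pair lies below or above
its threshold, and the diagonal pairs are free. Its measure is the product defining `condProb`. -/
theorem prob_randomGraph_eq (G : SimpleGraph (Fin n)) :
    prob d n {ω | randomGraph hFi hFo σ ω = G} =
      ∫⁻ X, ENNReal.ofReal (condProb Fi Fo σ X G) ∂(Measure.pi fun _ : Fin n => torusMeasure d) := by
  classical
  rw [prob, Measure.prod_apply (measurableSet_randomGraph_eq hFi hFo σ G)]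
  refine lintegral_congr fun X => ?_
  let p : Sym2 (Fin n) → ℝ := Sym2.lift
    ⟨fun i j => connection Fi Fo (X i - X j) (σ i) (σ j), fun i j =>
      connection_symm hFi hFo _ _ _ _⟩
  have hp : ∀ i j, p s(i, j) = connection Fi Fo (X i - X j) (σ i) (σ j) := fun i j => rfl
  let box : Sym2 (Fin n) → Set ℝ := fun e =>
    if e.IsDiag then Set.univ else if e ∈ G.edgeSet then Set.Iio (p e) else Set.Ici (p e)
  have hbox : Prod.mk X ⁻¹' {ω : Space d n | randomGraph hFi hFo σ ω = G} = Set.univ.pi box := by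
    ext u
    simp only [Set.mem_preimage, Set.mem_ofPred_eq, Set.mem_pi, Set.mem_univ, true_imp_iff,
      SimpleGraph.ext_iff, funext_iff, randomGraph_adj, eq_iff_iff]
    constructor
    · intro h e
      induction e using Sym2.ind with
      | _ i j =>
        have hij := h i j
        simp only [box, Sym2.mk_isDiag_iff, SimpleGraph.mem_edgeSet, hp]
        split_ifs with h1 h2
        · trivial
        · exact (hij.2 h2).2
        · exact not_lt.1 fun h3 => h2 (hij.1 ⟨h1, h3⟩)
    · intro h i j
      have hij := h s(i, j)
      simp only [box, Sym2.mk_isDiag_iff, SimpleGraph.mem_edgeSet, hp] at hij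
      split_ifs at hij with h1 h2
      · subst h1
        simp
      · exact ⟨fun _ => h2, fun _ => ⟨h1, hij⟩⟩
      · exact ⟨fun h3 => absurd h3.2 (not_lt.2 hij), fun h3 => absurd h3 h2⟩
  rw [hbox, Measure.pi_pi, condProb, ENNReal.ofReal_prod_of_nonneg]
  · symm
    -- The pairs i < j enumerate the non-diagonal elements of `Sym2`; diagonal ones contribute the
    -- factor 1.
    refine Finset.prod_of_injOn (fun q : Fin n × Fin n => s(q.1, q.2)) ?_ (by simp) ?_ ?_
    · rintro ⟨a, b⟩ h ⟨a', b'⟩ h' hab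
      simp only [Finset.coe_filter, Finset.mem_univ, true_and, Set.mem_ofPred_eq] at h h'
      rcases Sym2.eq_iff.1 hab with ⟨h1, h2⟩ | ⟨h1, h2⟩
      · exact Prod.ext h1 h2
      · simp only at h1 h2
        subst h1 h2
        exact absurd h (not_lt.2 h'.le)
    · intro e _ he
      induction e using Sym2.ind with
      | _ i j =>
        have : i = j := by
          by_contra hne
          apply he
          rcases lt_or_gt_of_ne hne with h | h
          · exact ⟨(i, j), by simpa using h, rfl⟩
          · exact ⟨(j, i), by simpa using h, Sym2.eq_swap⟩
        simp [box, this]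
    · rintro ⟨i, j⟩ h
      have h : i < j := by simpa using h
      have hc := connection_mem_Icc hFi hFo (X i - X j) (σ i) (σ j)
      simp only [box, Sym2.mk_isDiag_iff, h.ne, if_false, SimpleGraph.mem_edgeSet, hp]
      split_ifs
      · rw [uniform_Iio hc]
      · rw [uniform_Ici hc]
  · rintro ⟨i, j⟩ _
    have hc := connection_mem_Icc hFi hFo (X i - X j) (σ i) (σ j)
    split_ifs
    · exact hc.1
    · linarith [hc.2]

/-- One inequality suffices for the lower bound on the probability, and it needs no measurability of
`S`: a Dirac measure always gives a set containing its point mass at least 1. -/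
theorem prob_le_law (S : Set (SimpleGraph (Fin n))) :
    prob d n {ω | randomGraph hFi hFo σ ω ∈ S} ≤ law Fi Fo σ S := by
  classical
  have h1 : {ω : Space d n | randomGraph hFi hFo σ ω ∈ S} =
      ⋃ G ∈ Finset.univ.filter (· ∈ S), {ω | randomGraph hFi hFo σ ω = G} := by
    ext ω
    simp
  rw [h1, law, Measure.finsetSum_apply]
  refine (measure_biUnion_finset_le _ _).trans ?_
  rw [Finset.sum_filter]
  refine Finset.sum_le_sum fun G _ => ?_
  split_ifs with h
  · rw [prob_randomGraph_eq, Measure.smul_apply, smul_eq_mul]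
    refine le_mul_of_one_le_right zero_le ?_
    exact (Measure.le_dirac_apply (s := S) (a := G)).trans' (by simp [h])
  · exact zero_le

include hFi hFo in
theorem law_le_one (S : Set (SimpleGraph (Fin n))) : law Fi Fo σ S ≤ 1 := by
  classical
  refine (measure_mono (Set.subset_univ S)).trans ?_
  rw [law, Measure.finsetSum_apply]
  simp only [Measure.smul_apply, measure_univ, smul_eq_mul, mul_one]
  simp_rw [← prob_randomGraph_eq hFi hFo σ]
  rw [← measure_biUnion_finset]
  · exact prob_le_one
  · intro G _ G' _ hne
    exact Set.disjoint_left.2 fun ω h h' => hne (h.symm.trans h')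
  · exact fun G _ => measurableSet_randomGraph_eq hFi hFo σ G

/-- The adjacency matrix of the random graph. -/
noncomputable def randomAdj (ω : Space d n) (i j : Fin n) : ℝ := adj (randomGraph hFi hFo σ ω) i j

theorem randomAdj_self (ω : Space d n) (i : Fin n) : randomAdj hFi hFo σ ω i i = 0 := by
  simp [randomAdj, adj]

theorem randomAdj_of_ne (ω : Space d n) {i j : Fin n} (h : i ≠ j) :
    randomAdj hFi hFo σ ω i j =
      if ω.2 s(i, j) < connection Fi Fo (ω.1 i - ω.1 j) (σ i) (σ j) then 1 else 0 := by
  classical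
  rw [randomAdj, adj, SimpleGraph.adjMatrix_apply]
  simp [randomGraph_adj, h]

theorem randomAdj_mem_Icc (ω : Space d n) (i j : Fin n) :
    randomAdj hFi hFo σ ω i j ∈ Set.Icc (0 : ℝ) 1 := by
  classical
  rw [randomAdj, adj, SimpleGraph.adjMatrix_apply]
  split_ifs <;> simp

theorem randomAdj_comm (ω : Space d n) (i j : Fin n) :
    randomAdj hFi hFo σ ω i j = randomAdj hFi hFo σ ω j i := by
  classical
  simp only [randomAdj, adj, SimpleGraph.adjMatrix_apply, SimpleGraph.adj_comm]

theorem measurable_randomAdj (i j : Fin n) : Measurable fun ω => randomAdj hFi hFo σ ω i j := by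
  classical
  simp only [randomAdj, adj, SimpleGraph.adjMatrix_apply]
  exact Measurable.ite (measurableSet_randomGraph_adj hFi hFo σ i j) measurable_const
    measurable_const

theorem randomAdj_resample_of_ne {i j l : Fin n} (hi : i ≠ l) (hj : j ≠ l) (ω z : Space d n) :
    randomAdj hFi hFo σ (resample l (ω, z)) i j = randomAdj hFi hFo σ ω i j := by
  by_cases h : i = j
  · subst h; simp [randomAdj_self]
  · simp [randomAdj_of_ne _ _ _ _ h, resample, hi, hj, hi.symm, hj.symm]

theorem randomAdj_resample {i l : Fin n} (hi : i ≠ l) (ω z : Space d n) :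
    randomAdj hFi hFo σ (resample l (ω, z)) i l =
      if z.2 s(i, l) < connection Fi Fo (ω.1 i - z.1 l) (σ i) (σ l) then 1 else 0 := by
  simp [randomAdj_of_ne _ _ _ _ hi, resample, hi]

end RandomGraph

/-! ### Second and exponential moments of the fluctuations. -/

section Moments

variable {d n k : ℕ} {Fi Fo : UnitAddTorus (Fin d) → ℝ}

/-- `g` is an eigenfunction of all the convolution operators with kernels
`connection Fi Fo · s t`, with eigenvalues `κ s t`. -/
structure IsEigenfunction (Fi Fo : UnitAddTorus (Fin d) → ℝ) (g : UnitAddTorus (Fin d) → ℝ)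
    (κ : Fin k → Fin k → ℝ) : Prop where
  measurable : Measurable g
  abs_le_one : ∀ x, |g x| ≤ 1
  abs_eigenvalue_le_one : ∀ s t, |κ s t| ≤ 1
  integral_eq : ∀ s t x, ∫ y, connection Fi Fo (x - y) s t * g y ∂torusMeasure d = κ s t * g x

variable (hFi : IsConnectivity Fi) (hFo : IsConnectivity Fo) (σ : Fin n → Fin k)

/-- The contribution of `j` to the `i`-th coordinate of `A φ - E[A φ]`, for the vector `φ` of the
values of `g` at the positions. -/
noncomputable def rowDeviation (g : UnitAddTorus (Fin d) → ℝ) (κ : Fin k → Fin k → ℝ) (i j : Fin n)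
    (ω : Space d n) : ℝ :=
  randomAdj hFi hFo σ ω i j * g (ω.1 j) - κ (σ i) (σ j) * g (ω.1 i)

variable {g : UnitAddTorus (Fin d) → ℝ} {κ : Fin k → Fin k → ℝ}

theorem measurable_rowDeviation (hg : IsEigenfunction Fi Fo g κ) (i j : Fin n) :
    Measurable (rowDeviation hFi hFo σ g κ i j) := by
  have := measurable_randomAdj hFi hFo σ i j
  have := hg.measurable
  unfold rowDeviation
  fun_prop

theorem abs_rowDeviation_le (hg : IsEigenfunction Fi Fo g κ) (i j : Fin n) (ω : Space d n) :
    |rowDeviation hFi hFo σ g κ i j ω| ≤ 2 := by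
  have h1 := randomAdj_mem_Icc hFi hFo σ ω i j
  have h2 : |randomAdj hFi hFo σ ω i j * g (ω.1 j)| ≤ 1 := by
    rw [abs_mul, abs_of_nonneg h1.1]
    exact mul_le_one₀ h1.2 (abs_nonneg _) (hg.abs_le_one _)
  have h3 : |κ (σ i) (σ j) * g (ω.1 i)| ≤ 1 := by
    rw [abs_mul]
    exact mul_le_one₀ (hg.abs_eigenvalue_le_one _ _) (abs_nonneg _) (hg.abs_le_one _)
  exact (abs_sub _ _).trans (by linarith)

/-- Integrating out the edge and the position of `l` turns A_il g(X_l) into the convolution at X_i,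
which the eigenfunction equation evaluates. -/
theorem integral_rowDeviation (hg : IsEigenfunction Fi Fo g κ) {i l : Fin n} (h : i ≠ l)
    (ω : Space d n) :
    ∫ z, rowDeviation hFi hFo σ g κ i l (resample l (ω, z)) ∂prob d n = 0 := by
  have hmeas : Measurable fun z : Space d n =>
      (if z.2 s(i, l) < connection Fi Fo (ω.1 i - z.1 l) (σ i) (σ l) then (1 : ℝ) else 0) *
        g (z.1 l) := by
    have h1 : Measurable fun z : Space d n => connection Fi Fo (ω.1 i - z.1 l) (σ i) (σ l) :=
      (measurable_connection hFi hFo _ _).comp (by fun_prop)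
    have := hg.measurable
    exact (Measurable.ite (measurableSet_lt (by fun_prop) h1) measurable_const
      measurable_const).mul (by fun_prop)
  have h1 : ∀ z, rowDeviation hFi hFo σ g κ i l (resample l (ω, z)) =
      (if z.2 s(i, l) < connection Fi Fo (ω.1 i - z.1 l) (σ i) (σ l) then 1 else 0) * g (z.1 l) -
        κ (σ i) (σ l) * g (ω.1 i) := by
    intro z
    rw [rowDeviation, randomAdj_resample _ _ _ h]
    simp [resample, h]
  simp_rw [h1]
  rw [integral_sub (integrable_of_bdd hmeas (b := 1) fun z => ?_) (integrable_const _),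
    integral_position_edge l (p := fun y => connection Fi Fo (ω.1 i - y) (σ i) (σ l))
      ((measurable_connection hFi hFo _ _).comp (by fun_prop)) hg.measurable
      (fun x => connection_mem_Icc hFi hFo _ _ _) hg.abs_le_one, hg.integral_eq]
  · simp
  · split_ifs
    · simpa using hg.abs_le_one _
    · simp

theorem rowDeviation_resample (g : UnitAddTorus (Fin d) → ℝ) (κ : Fin k → Fin k → ℝ)
    {i j l : Fin n} (hi : i ≠ l) (hj : j ≠ l) (ω z : Space d n) :
    rowDeviation hFi hFo σ g κ i j (resample l (ω, z)) = rowDeviation hFi hFo σ g κ i j ω := by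
  rw [rowDeviation, rowDeviation, randomAdj_resample_of_ne _ _ _ hi hj]
  simp [resample, hi, hj]

theorem integrable_sum_rowDeviation_sq (hg : IsEigenfunction Fi Fo g κ) (i : Fin n)
    (J : Finset (Fin n)) :
    Integrable (fun ω => (∑ j ∈ J, rowDeviation hFi hFo σ g κ i j ω) ^ 2) (prob d n) := by
  refine integrable_of_bdd ((Finset.measurable_fun_sum J fun j _ =>
    measurable_rowDeviation hFi hFo σ hg i j).pow_const 2) (b := (∑ j ∈ J, 2) ^ 2) fun ω => ?_
  rw [abs_pow]
  gcongr
  exact (Finset.abs_sum_le_sum_abs _ _).trans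
    (Finset.sum_le_sum fun j _ => abs_rowDeviation_le hFi hFo σ hg i j ω)

/-- The term j = i is not centred, because A_ii = 0, and is split off with its bound 2. This gives
2·4n + 2·2² ≤ 16n. -/
theorem integral_sum_rowDeviation_sq_le (hg : IsEigenfunction Fi Fo g κ) (i : Fin n)
    (J : Finset (Fin n)) :
    ∫ ω, (∑ j ∈ J, rowDeviation hFi hFo σ g κ i j ω) ^ 2 ∂prob d n ≤ 16 * n := by
  have hn : (1 : ℝ) ≤ n := by exact_mod_cast i.pos
  have hmeas := measurable_rowDeviation hFi hFo σ hg i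
  have hb := abs_rowDeviation_le hFi hFo σ hg i
  have h1 := integral_sum_sq_le (J := J.erase i) hmeas hb
    (fun l hl => integral_rowDeviation hFi hFo σ hg (Finset.ne_of_mem_erase hl).symm)
    (fun l hl j _ hjl => rowDeviation_resample hFi hFo σ g κ (Finset.ne_of_mem_erase hl).symm hjl)
  have hcard : ((J.erase i).card : ℝ) ≤ n := by
    exact_mod_cast (Finset.card_le_univ _).trans_eq (Fintype.card_fin n)
  have hint := integrable_sum_rowDeviation_sq hFi hFo σ hg i
  have h2 : ∀ ω, (∑ j ∈ J, rowDeviation hFi hFo σ g κ i j ω) ^ 2 ≤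
      2 * (∑ j ∈ J.erase i, rowDeviation hFi hFo σ g κ i j ω) ^ 2 + 8 := by
    intro ω
    by_cases hi : i ∈ J
    · rw [← Finset.add_sum_erase _ _ hi]
      have := abs_le.1 (hb i ω)
      nlinarith [sq_nonneg (rowDeviation hFi hFo σ g κ i i ω -
        ∑ j ∈ J.erase i, rowDeviation hFi hFo σ g κ i j ω)]
    · rw [Finset.erase_eq_of_notMem hi]
      nlinarith [sq_nonneg (∑ j ∈ J, rowDeviation hFi hFo σ g κ i j ω)]
  calc _ ≤ ∫ ω, (2 * (∑ j ∈ J.erase i, rowDeviation hFi hFo σ g κ i j ω) ^ 2 + 8) ∂prob d n :=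
        integral_mono (hint J) (((hint _).const_mul 2).add (integrable_const 8)) h2
    _ = 2 * ∫ ω, (∑ j ∈ J.erase i, rowDeviation hFi hFo σ g κ i j ω) ^ 2 ∂prob d n + 8 := by
        rw [integral_add ((hint _).const_mul 2) (integrable_const 8), integral_const_mul]
        simp
    _ ≤ _ := by linarith

/-- The squared norm of the deviation of `A φ` from its mean, for the vector `φ` of the values of
`g` at the positions of the vertices labelled `q`. -/
noncomputable def quasimodeError (g : UnitAddTorus (Fin d) → ℝ) (κ : Fin k → Fin k → ℝ) (q : Fin k)
    (ω : Space d n) : ℝ :=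
  ∑ i, (∑ j with σ j = q, rowDeviation hFi hFo σ g κ i j ω) ^ 2

theorem prob_quasimodeError_ge (hg : IsEigenfunction Fi Fo g κ) (q : Fin k) (a : ℝ) :
    a * (prob d n).real {ω | a ≤ quasimodeError hFi hFo σ g κ q ω} ≤ 16 * n ^ 2 := by
  refine (mul_meas_ge_le_integral_of_nonneg (ae_of_all _ fun ω => ?_) ?_ a).trans ?_
  · exact Finset.sum_nonneg fun i _ => sq_nonneg _
  · exact integrable_finsetSum _ fun i _ => integrable_sum_rowDeviation_sq hFi hFo σ hg i _
  · unfold quasimodeError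
    rw [integral_finsetSum _ fun i _ => integrable_sum_rowDeviation_sq hFi hFo σ hg i _]
    refine (Finset.sum_le_card_nsmul _ _ (16 * n : ℝ) fun i _ =>
      integral_sum_rowDeviation_sq_le hFi hFo σ hg i _).trans_eq ?_
    simp
    ring

theorem prob_abs_sum_rowDeviation_ge (hg : IsEigenfunction Fi Fo g κ) (i : Fin n)
    {J : Finset (Fin n)} (hJ : i ∉ J)
    (hb : ∀ j ω, |rowDeviation hFi hFo σ g κ i j ω| ≤ 1) {t : ℝ} (ht0 : 0 ≤ t) (ht : t ≤ 1)
    (a : ℝ) :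
    (prob d n).real {ω | a ≤ |∑ j ∈ J, rowDeviation hFi hFo σ g κ i j ω|} ≤
      2 * Real.exp (t ^ 2 * n - t * a) := by
  have hmeas := measurable_rowDeviation hFi hFo σ hg i
  have hcard : (J.card : ℝ) ≤ n := by
    exact_mod_cast (Finset.card_le_univ _).trans_eq (Fintype.card_fin n)
  have key : ∀ s : ℝ, |s| ≤ 1 →
      Real.exp (t * a) * (prob d n).real {ω | Real.exp (t * a) ≤
        Real.exp (s * ∑ j ∈ J, rowDeviation hFi hFo σ g κ i j ω)} ≤ Real.exp (s ^ 2 * n) := by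
    intro s hs
    refine (mul_meas_ge_le_integral_of_nonneg (ae_of_all _ fun ω => (Real.exp_pos _).le)
      ?_ _).trans ((integral_exp_sum_le hs hmeas hb J
        (fun l hl => integral_rowDeviation hFi hFo σ hg fun h => hJ (h ▸ hl))
        (fun l hl j _ hjl => rowDeviation_resample hFi hFo σ g κ (fun h => hJ (h ▸ hl)) hjl)).trans
        ?_)
    · have hm : Measurable fun ω => ∑ j ∈ J, rowDeviation hFi hFo σ g κ i j ω :=
        Finset.measurable_fun_sum J fun j _ => hmeas j
      refine integrable_of_bdd (b := Real.exp (∑ j ∈ J, 1)) (by fun_prop) fun ω => ?_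
      rw [abs_of_pos (Real.exp_pos _), Real.exp_le_exp]
      refine (le_abs_self _).trans ?_
      rw [abs_mul]
      refine (mul_le_of_le_one_left (abs_nonneg _) hs).trans ?_
      exact (Finset.abs_sum_le_sum_abs _ _).trans (Finset.sum_le_sum fun j _ => hb j ω)
    · gcongr
  have h1 := key t (by rwa [abs_of_nonneg ht0])
  have h2 := key (-t) (by rwa [abs_neg, abs_of_nonneg ht0])
  rw [neg_sq] at h2
  rw [Real.exp_sub, ← mul_div_assoc, le_div_iff₀ (Real.exp_pos _), mul_comm]
  have hsub : {ω | a ≤ |∑ j ∈ J, rowDeviation hFi hFo σ g κ i j ω|} ⊆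
      {ω | Real.exp (t * a) ≤ Real.exp (t * ∑ j ∈ J, rowDeviation hFi hFo σ g κ i j ω)} ∪
      {ω | Real.exp (t * a) ≤ Real.exp (-t * ∑ j ∈ J, rowDeviation hFi hFo σ g κ i j ω)} := by
    intro ω hω
    simp only [Set.mem_union, Set.mem_ofPred_eq, Real.exp_le_exp] at hω ⊢
    rcases le_abs.1 hω with h | h
    · left; gcongr
    · right
      rw [neg_mul, ← mul_neg]
      gcongr
  have h3 := (measureReal_mono (μ := prob d n) hsub).trans (measureReal_union_le _ _)
  have h4 := mul_le_mul_of_nonneg_left h3 (Real.exp_pos (t * a)).le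
  linarith

/-- The mean of the number of paths of length two between two given positions through a vertex with
label `q`. -/
noncomputable def pathMean (Fi Fo : UnitAddTorus (Fin d) → ℝ) (s q t : Fin k)
    (x x' : UnitAddTorus (Fin d)) : ℝ :=
  ∫ y, connection Fi Fo (x - y) s q * connection Fi Fo (y - x') q t ∂torusMeasure d

include hFi hFo in
theorem pathMean_mem_Icc (s q t : Fin k) (x x' : UnitAddTorus (Fin d)) :
    pathMean Fi Fo s q t x x' ∈ Set.Icc (0 : ℝ) 1 := by
  have h := fun y => connection_mem_Icc hFi hFo (x - y) s q
  have h' := fun y => connection_mem_Icc hFi hFo (y - x') q t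
  refine ⟨integral_nonneg fun y => mul_nonneg (h y).1 (h' y).1, ?_⟩
  refine (integral_mono_of_nonneg (ae_of_all _ fun y => mul_nonneg (h y).1 (h' y).1)
    (integrable_const (1 : ℝ)) (ae_of_all _ fun y => ?_)).trans_eq (by simp)
  exact mul_le_one₀ (h y).2 (h' y).1 (h' y).2

include hFi hFo in
theorem measurable_pathMean (s q t : Fin k) :
    Measurable fun p : UnitAddTorus (Fin d) × UnitAddTorus (Fin d) =>
      pathMean Fi Fo s q t p.1 p.2 := by
  have h1 := measurable_connection hFi hFo s q
  have h2 := measurable_connection hFi hFo q t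
  have : Measurable fun p : (UnitAddTorus (Fin d) × UnitAddTorus (Fin d)) ×
      UnitAddTorus (Fin d) => connection Fi Fo (p.1.1 - p.2) s q *
        connection Fi Fo (p.2 - p.1.2) q t :=
    (h1.comp (by fun_prop)).mul (h2.comp (by fun_prop))
  exact this.stronglyMeasurable.integral_prod_right.measurable

/-- The deviation of the indicator of the path `i`, `l`, `j` from its mean. -/
noncomputable def pathDeviation (i j l : Fin n) (ω : Space d n) : ℝ :=
  randomAdj hFi hFo σ ω i l * randomAdj hFi hFo σ ω l j -
    pathMean Fi Fo (σ i) (σ l) (σ j) (ω.1 i) (ω.1 j)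

theorem measurable_pathDeviation (i j l : Fin n) :
    Measurable (pathDeviation hFi hFo σ i j l) := by
  refine ((measurable_randomAdj hFi hFo σ i l).mul (measurable_randomAdj hFi hFo σ l j)).sub ?_
  exact (measurable_pathMean hFi hFo (σ i) (σ l) (σ j)).comp
    (f := fun ω : Space d n => (ω.1 i, ω.1 j)) (by fun_prop)

theorem abs_pathDeviation_le (i j l : Fin n) (ω : Space d n) :
    |pathDeviation hFi hFo σ i j l ω| ≤ 1 := by
  have h1 := randomAdj_mem_Icc hFi hFo σ ω i l
  have h2 := randomAdj_mem_Icc hFi hFo σ ω l j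
  have h3 := pathMean_mem_Icc hFi hFo (σ i) (σ l) (σ j) (ω.1 i) (ω.1 j)
  have h4 := mul_nonneg h1.1 h2.1
  have h5 := mul_le_one₀ h1.2 h2.1 h2.2
  rw [pathDeviation, abs_le]
  constructor <;> linarith [h3.1, h3.2]

/-- For i ≠ j the edges {i, l} and {j, l} use different numbers, so given the position of `l` they
are independent. This fails for i = j, where A_il A_li = A_il. -/
theorem integral_pathDeviation {i j l : Fin n} (hij : i ≠ j) (hi : i ≠ l) (hj : j ≠ l)
    (ω : Space d n) :
    ∫ z, pathDeviation hFi hFo σ i j l (resample l (ω, z)) ∂prob d n = 0 := by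
  have h1 : ∀ z, pathDeviation hFi hFo σ i j l (resample l (ω, z)) =
      (if z.2 s(i, l) < connection Fi Fo (ω.1 i - z.1 l) (σ i) (σ l) then 1 else 0) *
        (if z.2 s(j, l) < connection Fi Fo (ω.1 j - z.1 l) (σ j) (σ l) then 1 else 0) * 1 -
        pathMean Fi Fo (σ i) (σ l) (σ j) (ω.1 i) (ω.1 j) := by
    intro z
    rw [pathDeviation, randomAdj_resample _ _ _ hi, randomAdj_comm, randomAdj_resample _ _ _ hj]
    simp [resample, hi, hj]
  have hm : ∀ i : Fin n, Measurable fun z : Space d n =>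
      connection Fi Fo (ω.1 i - z.1 l) (σ i) (σ l) := fun i =>
    (measurable_connection hFi hFo _ _).comp (by fun_prop)
  have hmeas : Measurable fun z : Space d n =>
      (if z.2 s(i, l) < connection Fi Fo (ω.1 i - z.1 l) (σ i) (σ l) then (1 : ℝ) else 0) *
        (if z.2 s(j, l) < connection Fi Fo (ω.1 j - z.1 l) (σ j) (σ l) then 1 else 0) * 1 :=
    ((Measurable.ite (measurableSet_lt (by fun_prop) (hm i)) measurable_const
      measurable_const).mul (Measurable.ite (measurableSet_lt (by fun_prop) (hm j))
      measurable_const measurable_const)).mul measurable_const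
  simp_rw [h1]
  rw [integral_sub (integrable_of_bdd hmeas (b := 1) fun z => ?_) (integrable_const _),
    integral_position_edges l (p := fun y => connection Fi Fo (ω.1 i - y) (σ i) (σ l))
      (p' := fun y => connection Fi Fo (ω.1 j - y) (σ j) (σ l)) (g := fun _ => 1)
      ((measurable_connection hFi hFo _ _).comp (by fun_prop))
      ((measurable_connection hFi hFo _ _).comp (by fun_prop)) measurable_const
      (fun x => connection_mem_Icc hFi hFo _ _ _) (fun x => connection_mem_Icc hFi hFo _ _ _)
      (b := 1) (by simp) (by simp [hij, hi])]
  · simp [pathMean, connection_symm hFi hFo (ω.1 j)]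
  · split_ifs <;> simp

theorem pathDeviation_resample {i j l m : Fin n} (hi : i ≠ l) (hj : j ≠ l) (hm : m ≠ l)
    (ω z : Space d n) :
    pathDeviation hFi hFo σ i j m (resample l (ω, z)) = pathDeviation hFi hFo σ i j m ω := by
  rw [pathDeviation, pathDeviation, randomAdj_resample_of_ne _ _ _ hi hm,
    randomAdj_resample_of_ne _ _ _ hm hj]
  simp [resample, hi, hj]

theorem integrable_sum_pathDeviation_sq (i j : Fin n) (J : Finset (Fin n)) :
    Integrable (fun ω => (∑ l ∈ J, pathDeviation hFi hFo σ i j l ω) ^ 2) (prob d n) := by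
  refine integrable_of_bdd ((Finset.measurable_fun_sum J fun l _ =>
    measurable_pathDeviation hFi hFo σ i j l).pow_const 2) (b := (∑ l ∈ J, 1) ^ 2) fun ω => ?_
  rw [abs_pow]
  gcongr
  exact (Finset.abs_sum_le_sum_abs _ _).trans
    (Finset.sum_le_sum fun l _ => abs_pathDeviation_le hFi hFo σ i j l ω)

/-- The two middle vertices l = i and l = j are not covered by the centring and are split off; their
sum is at most 2 in absolute value, whence 2n + 2·2² ≤ 10n. -/
theorem integral_sum_pathDeviation_sq_le {i j : Fin n} (hij : i ≠ j) :
    ∫ ω, (∑ l, pathDeviation hFi hFo σ i j l ω) ^ 2 ∂prob d n ≤ 10 * n := by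
  have hn : (1 : ℝ) ≤ n := by exact_mod_cast i.pos
  set J := (Finset.univ.erase i).erase j with hJ
  have hJi : ∀ l ∈ J, i ≠ l := fun l hl h => by
    subst h; simp [hJ] at hl
  have hJj : ∀ l ∈ J, j ≠ l := fun l hl h => by
    subst h; simp [hJ] at hl
  have h1 := integral_sum_sq_le (J := J) (measurable_pathDeviation hFi hFo σ i j)
    (abs_pathDeviation_le hFi hFo σ i j)
    (fun l hl => integral_pathDeviation hFi hFo σ hij (hJi l hl) (hJj l hl))
    (fun l hl m _ hm => pathDeviation_resample hFi hFo σ (hJi l hl) (hJj l hl) hm)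
  have hcard : (J.card : ℝ) ≤ n := by
    exact_mod_cast (Finset.card_le_univ _).trans_eq (Fintype.card_fin n)
  have h2 : ∀ ω, (∑ l, pathDeviation hFi hFo σ i j l ω) ^ 2 ≤
      2 * (∑ l ∈ J, pathDeviation hFi hFo σ i j l ω) ^ 2 + 8 := by
    intro ω
    rw [← Finset.add_sum_erase _ _ (Finset.mem_univ i),
      ← Finset.add_sum_erase _ _ (Finset.mem_erase.2 ⟨hij.symm, Finset.mem_univ j⟩), ← hJ]
    have h3 := abs_le.1 (abs_pathDeviation_le hFi hFo σ i j i ω)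
    have h4 := abs_le.1 (abs_pathDeviation_le hFi hFo σ i j j ω)
    generalize pathDeviation hFi hFo σ i j i ω = a at *
    generalize pathDeviation hFi hFo σ i j j ω = b at *
    generalize ∑ l ∈ J, pathDeviation hFi hFo σ i j l ω = c at *
    have h5 : (a + b) ^ 2 ≤ 4 := by nlinarith
    nlinarith [sq_nonneg (a + b - c)]
  calc _ ≤ ∫ ω, (2 * (∑ l ∈ J, pathDeviation hFi hFo σ i j l ω) ^ 2 + 8) ∂prob d n :=
        integral_mono (integrable_sum_pathDeviation_sq hFi hFo σ i j _)
          (((integrable_sum_pathDeviation_sq hFi hFo σ i j J).const_mul 2).add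
            (integrable_const 8)) h2
    _ = 2 * ∫ ω, (∑ l ∈ J, pathDeviation hFi hFo σ i j l ω) ^ 2 ∂prob d n + 8 := by
        rw [integral_add ((integrable_sum_pathDeviation_sq hFi hFo σ i j J).const_mul 2)
          (integrable_const 8), integral_const_mul]
        simp
    _ ≤ _ := by linarith

/-- The squared Hilbert-Schmidt norm of the deviation of the square of the adjacency matrix from its
conditional mean. -/
noncomputable def squareError (ω : Space d n) : ℝ :=
  ∑ i, ∑ j, (∑ l, pathDeviation hFi hFo σ i j l ω) ^ 2

/-- Markov's inequality. The diagonal entries of A² are uncontrolled, but there is one per row and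
n² bounds its square, so a row costs at most n² + n·10n. -/
theorem prob_squareError_ge (a : ℝ) :
    a * (prob d n).real {ω | a ≤ squareError hFi hFo σ ω} ≤ 11 * n ^ 3 := by
  have hint := integrable_sum_pathDeviation_sq hFi hFo σ
  refine (mul_meas_ge_le_integral_of_nonneg (ae_of_all _ fun ω => ?_) ?_ a).trans ?_
  · exact Finset.sum_nonneg fun i _ => Finset.sum_nonneg fun j _ => sq_nonneg _
  · exact integrable_finsetSum _ fun i _ => integrable_finsetSum _ fun j _ => hint i j _
  · unfold squareError
    rw [integral_finsetSum _ fun i _ => integrable_finsetSum _ fun j _ => hint i j _]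
    have hrow : ∀ i ∈ (Finset.univ : Finset (Fin n)), ∫ ω, ∑ j,
        (∑ l, pathDeviation hFi hFo σ i j l ω) ^ 2 ∂prob d n ≤ 11 * n ^ 2 := by
      intro i _
      rw [integral_finsetSum _ fun j _ => hint i j _,
        ← Finset.add_sum_erase _ _ (Finset.mem_univ i)]
      have h1 : ∫ ω, (∑ l, pathDeviation hFi hFo σ i i l ω) ^ 2 ∂prob d n ≤ n ^ 2 := by
        refine (integral_mono (hint i i _) (integrable_const ((n : ℝ) ^ 2)) fun ω => ?_).trans_eq
          (by simp)
        simp only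
        rw [← sq_abs]
        gcongr
        refine (Finset.abs_sum_le_sum_abs _ _).trans
          ((Finset.sum_le_sum fun l _ => abs_pathDeviation_le hFi hFo σ i i l ω).trans_eq
          (by simp))
      have h2 : ∑ j ∈ Finset.univ.erase i, ∫ ω,
          (∑ l, pathDeviation hFi hFo σ i j l ω) ^ 2 ∂prob d n ≤ n * (10 * n) := by
        refine (Finset.sum_le_card_nsmul _ _ (10 * n : ℝ) fun j hj =>
          integral_sum_pathDeviation_sq_le hFi hFo σ (Finset.ne_of_mem_erase hj).symm).trans ?_
        rw [nsmul_eq_mul]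
        gcongr
        exact (Finset.card_le_univ _).trans_eq (Fintype.card_fin n)
      nlinarith
    refine (Finset.sum_le_card_nsmul _ _ _ hrow).trans_eq ?_
    simp
    ring

end Moments

end SGBM

namespace SGBM

/-! ### Characters as eigenfunctions, and L¹ approximation of the kernels. -/

section Fourier

open UnitAddTorus

variable {d : ℕ} {F : UnitAddTorus (Fin d) → ℝ}

instance (d : ℕ) : (torusMeasure d).IsAddLeftInvariant := by unfold torusMeasure; infer_instance

instance (d : ℕ) : (torusMeasure d).IsNegInvariant := by
  refine ⟨?_⟩
  exact (measurePreserving_pi (fun _ : Fin d => (AddCircle.haarAddCircle (T := 1)))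
    (fun _ => AddCircle.haarAddCircle) fun _ => Measure.measurePreserving_neg _).map_eq

theorem mFourier_sub_apply (z : Fin d → ℤ) (x y : UnitAddTorus (Fin d)) :
    mFourier z (x - y) = mFourier z x * mFourier (-z) y := by
  simp only [mFourier, ContinuousMap.coe_mk, ← Finset.prod_mul_distrib]
  refine Finset.prod_congr rfl fun i _ => ?_
  rw [fourier_apply, fourier_apply, fourier_apply, Pi.sub_apply, Pi.neg_apply, sub_eq_add_neg,
    smul_add, smul_neg, neg_smul, AddCircle.toCircle_add, Circle.coe_mul]

theorem norm_mFourier_apply (z : Fin d → ℤ) (x : UnitAddTorus (Fin d)) : ‖mFourier z x‖ = 1 := by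
  simp only [mFourier, ContinuousMap.coe_mk, norm_prod, fourier_apply, Circle.norm_coe,
    Finset.prod_const_one]

theorem fourierCoefficient_eq_integral (z : Fin d → ℤ) :
    fourierCoefficient F z = ∫ y, mFourier (-z) y * (F y : ℂ) ∂torusMeasure d := rfl

theorem norm_fourierCoefficient_le (hF : IsConnectivity F) (z : Fin d → ℤ) :
    ‖fourierCoefficient F z‖ ≤ 1 := by
  rw [fourierCoefficient_eq_integral]
  refine (norm_integral_le_of_norm_le_const (C := 1) (ae_of_all _ fun y => ?_)).trans_eq (by simp)
  rw [norm_mul, norm_mFourier_apply, one_mul, Complex.norm_real, Real.norm_eq_abs,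
    abs_of_nonneg (hF.mem_Icc y).1]
  exact (hF.mem_Icc y).2

/-- The substitution y ↦ −y conjugates the character and preserves the even function F. -/
theorem fourierCoefficient_im (hF : IsConnectivity F) (z : Fin d → ℤ) :
    (fourierCoefficient F z).im = 0 := by
  rw [← Complex.conj_eq_iff_im, fourierCoefficient_eq_integral, ← integral_conj]
  rw [← integral_neg_eq_self]
  refine integral_congr_ae (ae_of_all _ fun y => ?_)
  have h : mFourier (-z) (-y) = mFourier z y := by
    have := mFourier_sub_apply (-z) 0 y
    rw [zero_sub, neg_neg] at this
    rw [this]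
    simp [mFourier]
  simp only [h, map_mul, Complex.conj_ofReal, ← mFourier_neg, hF.even]

theorem fourierCoefficient_eq_re (hF : IsConnectivity F) (z : Fin d → ℤ) :
    fourierCoefficient F z = ((fourierCoefficient F z).re : ℂ) :=
  Complex.ext (by simp) (by simp [fourierCoefficient_im hF])

theorem integral_convolution_mFourier (z : Fin d → ℤ) (x : UnitAddTorus (Fin d)) :
    ∫ y, (F (x - y) : ℂ) * mFourier z y ∂torusMeasure d =
      mFourier z x * fourierCoefficient F z := by
  rw [← integral_sub_left_eq_self _ (torusMeasure d) x, fourierCoefficient_eq_integral,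
    ← integral_const_mul]
  refine integral_congr_ae (ae_of_all _ fun y => ?_)
  simp only [sub_sub_cancel, mFourier_sub_apply]
  ring

/-- The real and the imaginary parts of the characters of the torus. -/
noncomputable def realCharacter (p : (Fin d → ℤ) × Bool) (x : UnitAddTorus (Fin d)) : ℝ :=
  if p.2 then (mFourier p.1 x).re else (mFourier p.1 x).im

theorem measurable_realCharacter (p : (Fin d → ℤ) × Bool) : Measurable (realCharacter p) := by
  unfold realCharacter
  split_ifs
  · exact Complex.measurable_re.comp (mFourier p.1).continuous.measurable
  · exact Complex.measurable_im.comp (mFourier p.1).continuous.measurable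

theorem abs_realCharacter_le (p : (Fin d → ℤ) × Bool) (x : UnitAddTorus (Fin d)) :
    |realCharacter p x| ≤ 1 := by
  unfold realCharacter
  split_ifs
  · exact (Complex.abs_re_le_norm _).trans_eq (norm_mFourier_apply _ _)
  · exact (Complex.abs_im_le_norm _).trans_eq (norm_mFourier_apply _ _)

theorem integral_convolution_realCharacter (hF : IsConnectivity F) (p : (Fin d → ℤ) × Bool)
    (x : UnitAddTorus (Fin d)) :
    ∫ y, F (x - y) * realCharacter p y ∂torusMeasure d =
      (fourierCoefficient F p.1).re * realCharacter p x := by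
  have h := integral_convolution_mFourier (F := F) p.1 x
  have hint : Integrable (fun y => (F (x - y) : ℂ) * mFourier p.1 y) (torusMeasure d) := by
    have h1 : Measurable fun y => F (x - y) := hF.measurable.comp (by fun_prop)
    have h2 : Measurable fun y => (F (x - y) : ℂ) * mFourier p.1 y :=
      (Complex.measurable_ofReal.comp h1).mul (mFourier p.1).continuous.measurable
    refine Integrable.of_bound (C := 1) h2.aestronglyMeasurable (ae_of_all _ fun y => ?_)
    rw [norm_mul, norm_mFourier_apply, mul_one, Complex.norm_real, Real.norm_eq_abs,
      abs_of_nonneg (hF.mem_Icc _).1]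
    exact (hF.mem_Icc _).2
  rw [fourierCoefficient_eq_re hF] at h
  unfold realCharacter
  split_ifs
  · have := Complex.reCLM.integral_comp_comm hint
    rw [h] at this
    simpa [mul_comm] using this
  · have := Complex.imCLM.integral_comp_comm hint
    rw [h] at this
    simpa [mul_comm] using this

/-- The addition formula cos(a − b) = cos a cos b + sin a sin b, which splits a
translation-invariant kernel into products of real characters. -/
theorem realCharacter_mul_add (z : Fin d → ℤ) (y x : UnitAddTorus (Fin d)) :
    realCharacter (z, true) y * realCharacter (z, true) x +
      realCharacter (z, false) y * realCharacter (z, false) x = (mFourier z (y - x)).re := by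
  simp [realCharacter, mFourier_sub_apply, mFourier_neg]

/-- The Fourier series of a connectivity function converges in `L¹`. -/
theorem eventually_integral_abs_sub_le (hF : IsConnectivity F) {δ : ℝ} (hδ : 0 < δ) :
    ∀ᶠ S : Finset (Fin d → ℤ) in atTop,
      ∫ y, |F y - ∑ z ∈ S, (fourierCoefficient F z).re * (mFourier z y).re| ∂torusMeasure d ≤ δ := by
  have hFm := hF.measurable
  have hmem : MemLp (fun y => (F y : ℂ)) 2 (torusMeasure d) := by
    refine MemLp.of_bound (by fun_prop) 1 (ae_of_all _ fun y => ?_)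
    rw [Complex.norm_real, Real.norm_eq_abs, abs_of_nonneg (hF.mem_Icc _).1]
    exact (hF.mem_Icc _).2
  set f : Lp ℂ 2 (torusMeasure d) := hmem.toLp _ with hf
  have hfae : f =ᵐ[torusMeasure d] fun y => (F y : ℂ) := hmem.coeFn_toLp
  have hcoef : ∀ z, mFourierCoeff f z = fourierCoefficient F z := by
    intro z
    refine integral_congr_ae (μ := torusMeasure d) ?_
    filter_upwards [hfae] with y hy
    rw [hy]
  have hs : HasSum (fun z => mFourierCoeff f z •
      (ContinuousMap.toLp (E := ℂ) 2 (torusMeasure d) ℂ (mFourier z))) f :=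
    hasSum_mFourier_series_L2 f
  filter_upwards [(Metric.tendsto_nhds.1 hs) δ hδ] with S hS
  set P : C(UnitAddTorus (Fin d), ℂ) := ∑ z ∈ S, fourierCoefficient F z • mFourier z with hP
  have hPsum : ∑ z ∈ S, mFourierCoeff f z •
      (ContinuousMap.toLp (E := ℂ) 2 (torusMeasure d) ℂ (mFourier z)) =
      ContinuousMap.toLp (E := ℂ) 2 (torusMeasure d) ℂ P := by
    simp only [hP, map_sum, map_smul, hcoef]
  rw [hPsum, dist_comm, dist_eq_norm, Lp.norm_def] at hS
  have hae : ↑(f - ContinuousMap.toLp (E := ℂ) 2 (torusMeasure d) ℂ P) =ᵐ[torusMeasure d]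
      fun y => (F y : ℂ) - P y := by
    filter_upwards [Lp.coeFn_sub f (ContinuousMap.toLp (E := ℂ) 2 (torusMeasure d) ℂ P), hfae,
      ContinuousMap.coeFn_toLp (E := ℂ) (p := 2) (𝕜 := ℂ) (torusMeasure d) P] with y h1 h2 h3
    rw [h1, Pi.sub_apply, h2, h3]
  have hm : AEStronglyMeasurable (fun y => (F y : ℂ) - P y) (torusMeasure d) := by fun_prop
  have h2 : MemLp (fun y => (F y : ℂ) - P y) 2 (torusMeasure d) :=
    (memLp_congr_ae hae).1 (Lp.memLp _)
  rw [eLpNorm_congr_ae hae] at hS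
  -- The integrand on the left is the modulus of a real part, and on a probability space the L¹ norm
  -- is at most the L² norm.
  calc ∫ y, |F y - ∑ z ∈ S, (fourierCoefficient F z).re * (mFourier z y).re| ∂torusMeasure d
      ≤ ∫ y, ‖(F y : ℂ) - P y‖ ∂torusMeasure d := by
        refine integral_mono_of_nonneg (ae_of_all _ fun y => abs_nonneg _)
          (h2.integrable (by norm_num)).norm (ae_of_all _ fun y => ?_)
        refine le_trans (le_of_eq ?_) (Complex.abs_re_le_norm _)
        simp only [hP, Complex.sub_re, Complex.ofReal_re, ContinuousMap.sum_apply,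
          ContinuousMap.smul_apply, Complex.re_sum, smul_eq_mul, Complex.mul_re,
          fourierCoefficient_im hF, zero_mul, sub_zero]
    _ = (eLpNorm (fun y => (F y : ℂ) - P y) 1 (torusMeasure d)).toReal := by
        rw [integral_norm_eq_lintegral_enorm hm, eLpNorm_one_eq_lintegral_enorm]
    _ ≤ (eLpNorm (fun y => (F y : ℂ) - P y) 2 (torusMeasure d)).toReal :=
        ENNReal.toReal_mono h2.eLpNorm_ne_top
          (eLpNorm_le_eLpNorm_of_exponent_le (by norm_num) hm)
    _ ≤ δ := hS.le

/-- The kernel `F (y - x')` is close in `L¹` to a finite sum of products of characters. -/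
theorem integral_abs_sub_kernel_le {δ : ℝ} {S : Finset (Fin d → ℤ)}
    (hS : ∫ y, |F y - ∑ z ∈ S, (fourierCoefficient F z).re * (mFourier z y).re| ∂torusMeasure d ≤ δ)
    (x' : UnitAddTorus (Fin d)) :
    ∫ y, |F (y - x') - ∑ p : S × Bool, (fourierCoefficient F p.1).re *
      realCharacter (p.1.1, p.2) y * realCharacter (p.1.1, p.2) x'| ∂torusMeasure d ≤ δ := by
  refine le_trans (le_of_eq ?_) hS
  rw [← integral_sub_right_eq_self
    (fun y => |F y - ∑ z ∈ S, (fourierCoefficient F z).re * (mFourier z y).re|) x']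
  refine integral_congr_ae (ae_of_all _ fun y => ?_)
  simp only
  congr 2
  rw [Fintype.sum_prod_type, ← Finset.sum_coe_sort S]
  refine Finset.sum_congr rfl fun z _ => ?_
  rw [Fintype.sum_bool, ← realCharacter_mul_add]
  ring

end Fourier

end SGBM

namespace SGBM

/-! ### A finite family of modes with a spectral gap. -/

section Family

variable {d k : ℕ} {Fi Fo : UnitAddTorus (Fin d) → ℝ} {ι : Type*} [Fintype ι]

/-- The eigenvalue of the convolution with `connection Fi Fo · s t`. -/
def labelEigenvalue (κi κo : ℝ) (s t : Fin k) : ℝ := if s = t then κi else κo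

/-- A finite family of common eigenfunctions of the convolutions with `Fi` and `Fo` that generates
these operators up to `δ`, such that apart from the constant functions no eigenvalue of the limiting
operator of the block model is closer than `γ / k` to the ideal eigenvalue. -/
structure SpectralFamily (k : ℕ) (Fi Fo : UnitAddTorus (Fin d) → ℝ) (δ γ : ℝ)
    (g : ι → UnitAddTorus (Fin d) → ℝ) (κi κo : ι → ℝ) : Prop where
  eigen : ∀ α, IsEigenfunction Fi Fo (g α) (labelEigenvalue (k := k) (κi α) (κo α))
  abs_le_one : ∀ α, |κo α| ≤ 1
  gap_sum : ∀ α, γ ≤ |κi α + (k - 1) * κo α - (density Fi - density Fo)|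
  gap_diff : ∀ α, (∃ c, ∀ x, g α x = c) ∨ γ ≤ |κi α - κo α - (density Fi - density Fo)|
  approx : ∀ (s t : Fin k) (x' : UnitAddTorus (Fin d)),
    ∫ y, |connection Fi Fo (y - x') s t -
      ∑ α, labelEigenvalue (κi α) (κo α) s t * g α y * g α x'| ∂torusMeasure d ≤ δ

theorem abs_labelEigenvalue_le {κi κo b : ℝ} (hi : |κi| ≤ b) (ho : |κo| ≤ b) (s t : Fin k) :
    |labelEigenvalue κi κo s t| ≤ b := by
  unfold labelEigenvalue
  split_ifs <;> assumption

theorem isEigenfunction_realCharacter (hFi : IsConnectivity Fi) (hFo : IsConnectivity Fo)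
    (p : (Fin d → ℤ) × Bool) :
    IsEigenfunction Fi Fo (realCharacter p) (labelEigenvalue (k := k)
      (fourierCoefficient Fi p.1).re (fourierCoefficient Fo p.1).re) where
  measurable := measurable_realCharacter p
  abs_le_one := abs_realCharacter_le p
  abs_eigenvalue_le_one := abs_labelEigenvalue_le
    ((Complex.abs_re_le_norm _).trans (norm_fourierCoefficient_le hFi _))
    ((Complex.abs_re_le_norm _).trans (norm_fourierCoefficient_le hFo _))
  integral_eq s t x := by
    unfold connection labelEigenvalue
    split_ifs
    exacts [integral_convolution_realCharacter hFi p x, integral_convolution_realCharacter hFo p x]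

theorem exists_pos_le {ι : Type*} [Finite ι] (f : ι → ℝ) (hf : ∀ i, 0 < f i) :
    ∃ γ : ℝ, 0 < γ ∧ ∀ i, γ ≤ f i := by
  cases isEmpty_or_nonempty ι
  · exact ⟨1, one_pos, fun i => isEmptyElim i⟩
  · obtain ⟨i, hi⟩ := Finite.exists_min f
    exact ⟨f i, hf i, hi⟩

/-- Only finitely many frequencies are kept, so the non-equalities (ii) and (iii) become a uniform
gap. Convergence along finite sets lets one `S` serve both functions. At z = 0 the difference does
resonate, but there the characters are constant. -/
theorem exists_spectralFamily (hFi : IsConnectivity Fi) (hFo : IsConnectivity Fo)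
    (hsum : ∀ z : Fin d → ℤ, fourierCoefficient Fi z + ((k : ℂ) - 1) * fourierCoefficient Fo z ≠
        ((density Fi - density Fo : ℝ) : ℂ))
    (hdiff : ∀ z : Fin d → ℤ, z ≠ 0 → fourierCoefficient Fi z - fourierCoefficient Fo z ≠
        ((density Fi - density Fo : ℝ) : ℂ)) {δ : ℝ} (hδ : 0 < δ) :
    ∃ (S : Finset (Fin d → ℤ)) (γ : ℝ), 0 < γ ∧ SpectralFamily k Fi Fo δ γ
      (fun p : S × Bool => realCharacter (p.1.1, p.2)) (fun p => (fourierCoefficient Fi p.1).re)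
      (fun p => (fourierCoefficient Fo p.1).re) := by
  obtain ⟨S, hSi, hSo⟩ := ((eventually_integral_abs_sub_le hFi hδ).and
    (eventually_integral_abs_sub_le hFo hδ)).exists
  have hsum' : ∀ z, (fourierCoefficient Fi z).re + (k - 1) * (fourierCoefficient Fo z).re -
      (density Fi - density Fo) ≠ 0 := by
    intro z h
    apply hsum z
    rw [fourierCoefficient_eq_re hFi, fourierCoefficient_eq_re hFo]
    exact_mod_cast sub_eq_zero.1 h
  have hdiff' : ∀ z, z ≠ 0 → (fourierCoefficient Fi z).re - (fourierCoefficient Fo z).re -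
      (density Fi - density Fo) ≠ 0 := by
    intro z hz h
    apply hdiff z hz
    rw [fourierCoefficient_eq_re hFi, fourierCoefficient_eq_re hFo]
    exact_mod_cast sub_eq_zero.1 h
  obtain ⟨γ₁, hγ₁, h₁⟩ := exists_pos_le (fun z : S => |(fourierCoefficient Fi z).re +
    (k - 1) * (fourierCoefficient Fo z).re - (density Fi - density Fo)|)
    fun z => abs_pos.2 (hsum' z)
  obtain ⟨γ₂, hγ₂, h₂⟩ := exists_pos_le (fun z : {z : S // z.1 ≠ 0} =>
    |(fourierCoefficient Fi z.1).re - (fourierCoefficient Fo z.1).re - (density Fi - density Fo)|)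
    fun z => abs_pos.2 (hdiff' z.1 z.2)
  refine ⟨S, min γ₁ γ₂, lt_min hγ₁ hγ₂, ?_, ?_, ?_, ?_, ?_⟩
  · exact fun p => isEigenfunction_realCharacter hFi hFo (p.1.1, p.2)
  · exact fun p => (Complex.abs_re_le_norm _).trans (norm_fourierCoefficient_le hFo _)
  · exact fun p => (min_le_left _ _).trans (h₁ p.1)
  · rintro ⟨z, b⟩
    by_cases hz : z.1 = 0
    · left
      refine ⟨if b then 1 else 0, fun x => ?_⟩
      simp only [realCharacter, hz, UnitAddTorus.mFourier_zero]
      split_ifs <;> simp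
    · exact Or.inr ((min_le_right _ _).trans (h₂ ⟨z, hz⟩))
  · intro s t x'
    unfold connection labelEigenvalue
    split_ifs
    exacts [integral_abs_sub_kernel_le hSi x', integral_abs_sub_kernel_le hSo x']

variable {δ γ : ℝ} {g : ι → UnitAddTorus (Fin d) → ℝ} {κi κo : ι → ℝ}

/-- Only the second edge of the path is expanded; the first acts on each `g α` through its
eigenvalue. As the first factor is at most 1, the L¹ error in y bounds the difference uniformly in
both endpoints. -/
theorem SpectralFamily.abs_pathMean_sub_le (hF : SpectralFamily k Fi Fo δ γ g κi κo)
    (hFi : IsConnectivity Fi) (hFo : IsConnectivity Fo) (s q t : Fin k)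
    (x x' : UnitAddTorus (Fin d)) :
    |pathMean Fi Fo s q t x x' - ∑ α, labelEigenvalue (κi α) (κo α) s q *
      labelEigenvalue (κi α) (κo α) q t * g α x * g α x'| ≤ δ := by
  have hm1 : Measurable fun y => connection Fi Fo (x - y) s q :=
    (measurable_connection hFi hFo s q).comp (by fun_prop)
  have hm2 : Measurable fun y => connection Fi Fo (y - x') q t :=
    (measurable_connection hFi hFo q t).comp (by fun_prop)
  have hb1 := fun y => connection_mem_Icc hFi hFo (x - y) s q
  have hb2 := fun y => connection_mem_Icc hFi hFo (y - x') q t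
  have hg := fun α => (hF.eigen α).measurable
  have hint1 : Integrable (fun y => connection Fi Fo (x - y) s q * connection Fi Fo (y - x') q t)
      (torusMeasure d) := integrable_of_bdd (hm1.mul hm2) (b := 1) fun y => by
    rw [abs_of_nonneg (mul_nonneg (hb1 y).1 (hb2 y).1)]
    exact mul_le_one₀ (hb1 y).2 (hb2 y).1 (hb2 y).2
  have hint2 : ∀ α, Integrable (fun y => connection Fi Fo (x - y) s q * g α y) (torusMeasure d) :=
    fun α => integrable_of_bdd (hm1.mul (hg α)) (b := 1) fun y => by
      rw [abs_mul, abs_of_nonneg (hb1 y).1]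
      exact mul_le_one₀ (hb1 y).2 (abs_nonneg _) ((hF.eigen α).abs_le_one y)
  have hint3 : ∀ α, Integrable (fun y => connection Fi Fo (x - y) s q *
      (labelEigenvalue (κi α) (κo α) q t * g α y * g α x')) (torusMeasure d) := fun α => by
    have := (hint2 α).const_mul (labelEigenvalue (κi α) (κo α) q t * g α x')
    refine this.congr (ae_of_all _ fun y => ?_)
    simp only
    ring
  have heq : pathMean Fi Fo s q t x x' - ∑ α, labelEigenvalue (κi α) (κo α) s q *
      labelEigenvalue (κi α) (κo α) q t * g α x * g α x' =
      ∫ y, connection Fi Fo (x - y) s q * (connection Fi Fo (y - x') q t -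
        ∑ α, labelEigenvalue (κi α) (κo α) q t * g α y * g α x') ∂torusMeasure d := by
    simp only [mul_sub, Finset.mul_sum]
    rw [integral_sub hint1 (integrable_finsetSum _ fun α _ => hint3 α), pathMean,
      integral_finsetSum _ fun α _ => hint3 α]
    congr 1
    refine Finset.sum_congr rfl fun α _ => ?_
    have h1 := (hF.eigen α).integral_eq s q x
    calc _ = labelEigenvalue (κi α) (κo α) q t * g α x' *
          (labelEigenvalue (κi α) (κo α) s q * g α x) := by ring
      _ = _ := by
          rw [← h1, ← integral_const_mul]
          refine integral_congr_ae (ae_of_all _ fun y => ?_)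
          simp only
          ring
  have hm3 : Measurable fun y => connection Fi Fo (y - x') q t -
      ∑ α, labelEigenvalue (κi α) (κo α) q t * g α y * g α x' :=
    hm2.sub (Finset.measurable_fun_sum _ fun α _ => ((hg α).const_mul _).mul_const _)
  have hb3 : ∀ y, |connection Fi Fo (y - x') q t -
      ∑ α, labelEigenvalue (κi α) (κo α) q t * g α y * g α x'| ≤ 1 + ∑ _α : ι, 1 := by
    intro y
    refine (abs_sub _ _).trans (add_le_add ?_ ((Finset.abs_sum_le_sum_abs _ _).trans
      (Finset.sum_le_sum fun α _ => ?_)))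
    · rw [abs_of_nonneg (hb2 y).1]
      exact (hb2 y).2
    · rw [abs_mul, abs_mul]
      exact mul_le_one₀ (mul_le_one₀ ((hF.eigen α).abs_eigenvalue_le_one _ _) (abs_nonneg _)
        ((hF.eigen α).abs_le_one _)) (abs_nonneg _) ((hF.eigen α).abs_le_one _)
  rw [heq]
  refine (abs_integral_le_integral_abs).trans (le_trans ?_ (hF.approx q t x'))
  refine integral_mono_of_nonneg (ae_of_all _ fun y => abs_nonneg _)
    (integrable_of_bdd hm3 hb3).abs (ae_of_all _ fun y => ?_)
  simp only
  rw [abs_mul, abs_of_nonneg (hb1 y).1]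
  exact mul_le_of_le_one_left (abs_nonneg _) (hb1 y).2

end Family

/-! ### The lower bound on vectors with equal label sums. -/

section Gap

variable {d n k : ℕ} {Fi Fo : UnitAddTorus (Fin d) → ℝ} {ι : Type*} [Fintype ι]
  {δ γ : ℝ} {g : ι → UnitAddTorus (Fin d) → ℝ} {κi κo : ι → ℝ}

/-- The label matrix (a − b − Δ)I + bJ, with J the all-ones matrix, has eigenvalue a + (k−1)b − Δ on
constants and a − b − Δ on zero-sum vectors. Summing over the labels bounds ∑ c by the first gap;
the second gap, or constancy of `c`, then bounds each entry. -/
theorem abs_coefficient_le {c : Fin k → ℝ} {a b Δ γ t : ℝ} (hγ : 0 < γ) (hb : |b| ≤ 1)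
    (ht : 0 ≤ t) (h : ∀ q, |(a - b - Δ) * c q + b * ∑ p, c p| ≤ t)
    (hsum : γ ≤ |a + (k - 1) * b - Δ|)
    (hdiff : (∀ q q', c q = c q') ∨ γ ≤ |a - b - Δ|) (q : Fin k) :
    |c q| ≤ ((k / γ + 1) / γ + k / γ) * t := by
  have hk : (1 : ℝ) ≤ k := by exact_mod_cast q.pos
  have h1 : |(a + (k - 1) * b - Δ) * ∑ p, c p| ≤ k * t := by
    have h2 : (a + (k - 1) * b - Δ) * ∑ p, c p = ∑ q, ((a - b - Δ) * c q + b * ∑ p, c p) := by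
      rw [Finset.sum_add_distrib, ← Finset.mul_sum]
      simp
      ring
    rw [h2]
    refine (Finset.abs_sum_le_sum_abs _ _).trans
      ((Finset.sum_le_card_nsmul _ _ t fun q _ => h q).trans_eq ?_)
    simp
  have hC : |∑ p, c p| ≤ k / γ * t := by
    rw [div_mul_eq_mul_div, le_div_iff₀ hγ]
    rw [abs_mul] at h1
    nlinarith [abs_nonneg (∑ p, c p)]
  have hpos : 0 ≤ k / γ * t := by positivity
  have hpos' : 0 ≤ (k / γ + 1) / γ * t := by positivity
  rw [add_mul]
  rcases hdiff with he | hd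
  · have h3 : ∑ p, c p = k * c q := by
      rw [Finset.sum_congr rfl fun p _ => he p q]
      simp
    have h4 : |c q| ≤ |∑ p, c p| := by
      rw [h3, abs_mul, abs_of_nonneg (by linarith : (0 : ℝ) ≤ k)]
      exact le_mul_of_one_le_left (abs_nonneg _) hk
    linarith
  · have h3 : |(a - b - Δ) * c q| ≤ t + k / γ * t := by
      have h4 : |b * ∑ p, c p| ≤ k / γ * t := by
        rw [abs_mul]
        exact (mul_le_of_le_one_left (abs_nonneg _) hb).trans hC
      have h5 := abs_sub ((a - b - Δ) * c q + b * ∑ p, c p) (b * ∑ p, c p)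
      rw [add_sub_cancel_right] at h5
      linarith [h q]
    have h6 : |c q| ≤ (k / γ + 1) / γ * t := by
      rw [div_mul_eq_mul_div, le_div_iff₀ hγ]
      rw [abs_mul] at h3
      nlinarith [abs_nonneg (c q)]
    linarith

variable (hFi : IsConnectivity Fi) (hFo : IsConnectivity Fo) {σ : Fin n → Fin k}

/-- The correlation of `w` with the values of `g` at the positions of the vertices labelled `q`. -/
def coefficient (σ : Fin n → Fin k) (g : UnitAddTorus (Fin d) → ℝ) (ω : Space d n)
    (w : EuclideanSpace ℝ (Fin n)) (q : Fin k) : ℝ :=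
  ∑ i with σ i = q, g (ω.1 i) * w i

theorem shift_apply (G : SimpleGraph (Fin n)) (c : ℝ) (w : EuclideanSpace ℝ (Fin n)) (i : Fin n) :
    shift G c w i = ∑ j, adj G i j * w j - c * w i := by
  simp [shift, Matrix.mulVec, dotProduct]

theorem abs_sum_mul_le {ι : Type*} (s : Finset ι) (f g : ι → ℝ) {a b : ℝ} (ha : 0 ≤ a) (hb : 0 ≤ b)
    (hf : ∑ i ∈ s, f i ^ 2 ≤ a ^ 2) (hg : ∑ i ∈ s, g i ^ 2 ≤ b ^ 2) :
    |∑ i ∈ s, f i * g i| ≤ a * b := by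
  refine abs_le_of_sq_le_sq ?_ (mul_nonneg ha hb)
  rw [mul_pow]
  exact (Finset.sum_mul_sq_le_sq_mul_sq s f g).trans
    (mul_le_mul hf hg (Finset.sum_nonneg fun _ _ => sq_nonneg _) (sq_nonneg _))

/-- Let φ carry the values of `g` on the class `q`. In ⟨φ, (A − c)w⟩ the matrix A is moved to φ,
where it acts as (n/k)((a − b)I + bJ) on the label index, up to the row deviations. -/
theorem coefficient_identity (hσ : IsBalanced σ) (g : UnitAddTorus (Fin d) → ℝ) (a b Δ : ℝ)
    (ω : Space d n) (w : EuclideanSpace ℝ (Fin n)) (q : Fin k) :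
    n / k * ((a - b - Δ) * coefficient σ g ω w q + b * ∑ p, coefficient σ g ω w p) =
      ∑ i with σ i = q, g (ω.1 i) * shift (randomGraph hFi hFo σ ω) (n * Δ / k) w i -
      ∑ i, (∑ j with σ j = q, rowDeviation hFi hFo σ g (labelEigenvalue a b) i j ω) * w i := by
  have h1 : ∑ i, (∑ j with σ j = q, rowDeviation hFi hFo σ g (labelEigenvalue a b) i j ω) * w i =
      ∑ j with σ j = q, g (ω.1 j) * ∑ i, randomAdj hFi hFo σ ω j i * w i -
      n / k * ∑ i, labelEigenvalue a b (σ i) q * (g (ω.1 i) * w i) := by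
    have h2 : ∀ i, (∑ j with σ j = q, rowDeviation hFi hFo σ g (labelEigenvalue a b) i j ω) * w i =
        ∑ j with σ j = q, g (ω.1 j) * (randomAdj hFi hFo σ ω j i * w i) -
        n / k * (labelEigenvalue a b (σ i) q * (g (ω.1 i) * w i)) := by
      intro i
      have h3 : ∑ j with σ j = q, rowDeviation hFi hFo σ g (labelEigenvalue a b) i j ω =
          ∑ j with σ j = q, randomAdj hFi hFo σ ω i j * g (ω.1 j) -
          n / k * (labelEigenvalue a b (σ i) q * g (ω.1 i)) := by
        simp only [rowDeviation, Finset.sum_sub_distrib]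
        congr 1
        rw [Finset.sum_congr rfl (g := fun _ => labelEigenvalue a b (σ i) q * g (ω.1 i))
          fun j hj => by rw [(Finset.mem_filter.1 hj).2], Finset.sum_const, nsmul_eq_mul,
          hσ.card_eq]
      rw [h3, sub_mul, Finset.sum_mul]
      congr 1
      · refine Finset.sum_congr rfl fun j _ => ?_
        rw [randomAdj_comm]
        ring
      · ring
    simp only [h2, Finset.sum_sub_distrib, Finset.mul_sum]
    rw [Finset.sum_comm]
  have h4 : ∑ i, labelEigenvalue a b (σ i) q * (g (ω.1 i) * w i) =
      (a - b) * coefficient σ g ω w q + b * ∑ p, coefficient σ g ω w p := by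
    have h5 : ∑ i, labelEigenvalue a b (σ i) q * (g (ω.1 i) * w i) =
        ∑ p, labelEigenvalue a b p q * coefficient σ g ω w p := by
      rw [← Finset.sum_fiberwise (s := Finset.univ) (g := σ)]
      refine Finset.sum_congr rfl fun p _ => ?_
      rw [coefficient, Finset.mul_sum]
      exact Finset.sum_congr rfl fun i hi => by rw [(Finset.mem_filter.1 hi).2]
    have h6 : ∀ p, labelEigenvalue a b p q = (if p = q then a - b else 0) + b := by
      intro p
      unfold labelEigenvalue
      split_ifs <;> ring
    rw [h5]
    simp only [h6, add_mul, Finset.sum_add_distrib, ite_mul, zero_mul, Finset.sum_ite_eq',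
      Finset.mem_univ, if_true, Finset.mul_sum]
  rw [h1, h4]
  simp only [shift_apply, mul_sub, Finset.sum_sub_distrib]
  have h7 : ∑ i with σ i = q, g (ω.1 i) * (n * Δ / k * w i) = n / k * (Δ * coefficient σ g ω w q) := by
    rw [coefficient, Finset.mul_sum, Finset.mul_sum]
    exact Finset.sum_congr rfl fun i _ => by ring
  rw [h7]
  simp only [randomAdj]
  ring

/-- By Cauchy–Schwarz both terms of `coefficient_identity` are at most εn√n‖w‖: the first because φ
has norm at most √n, the second by the quasimode bound. Equal label sums are used only for constant
`g α`, whose coefficients they make independent of the label. -/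
theorem SpectralFamily.abs_coefficient_le (hF : SpectralFamily k Fi Fo δ γ g κi κo) (hγ : 0 < γ)
    (hσ : IsBalanced σ) (hn : 0 < n) {ω : Space d n} {ε : ℝ} (hε : 0 ≤ ε)
    (hω : ∀ α q, quasimodeError hFi hFo σ (g α) (labelEigenvalue (κi α) (κo α)) q ω ≤ ε ^ 2 * n ^ 3)
    {w : EuclideanSpace ℝ (Fin n)}
    (hw : ∀ q q', ∑ i with σ i = q, w i = ∑ i with σ i = q', w i)
    (hsh : ‖shift (randomGraph hFi hFo σ ω) (n * (density Fi - density Fo) / k) w‖ ≤ ε * n * ‖w‖)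
    (α : ι) (q : Fin k) :
    |coefficient σ (g α) ω w q| ≤
      ((k / γ + 1) / γ + k / γ) * (2 * k * ε * (√n * ‖w‖)) := by
  have hn' : (0 : ℝ) < n := by positivity
  have hk' : (0 : ℝ) < k := by
    have := q.pos
    positivity
  have hsq : √(n : ℝ) ^ 2 = n := Real.sq_sqrt hn'.le
  refine SGBM.abs_coefficient_le hγ (hF.abs_le_one α) (by positivity) (fun p => ?_)
    (hF.gap_sum α) ?_ q
  · have h1 := coefficient_identity hFi hFo hσ (g α) (κi α) (κo α) (density Fi - density Fo) ω w p
    have h2 : |∑ i with σ i = p, g α (ω.1 i) *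
        shift (randomGraph hFi hFo σ ω) (n * (density Fi - density Fo) / k) w i| ≤
        √n * (ε * n * ‖w‖) := by
      refine abs_sum_mul_le _ _ _ (by positivity) (by positivity) ?_ ?_
      · rw [hsq]
        refine (Finset.sum_le_card_nsmul _ _ 1 fun i _ => ?_).trans ?_
        · rw [← sq_abs]
          exact pow_le_one₀ (abs_nonneg _) ((hF.eigen α).abs_le_one _)
        · rw [nsmul_eq_mul, mul_one]
          exact_mod_cast (Finset.card_le_univ _).trans_eq (Fintype.card_fin n)
      · refine (Finset.sum_le_sum_of_subset_of_nonneg (Finset.subset_univ _)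
          fun _ _ _ => sq_nonneg _).trans ?_
        rw [← EuclideanSpace.real_norm_sq_eq]
        gcongr
    have h3 : |∑ i, (∑ j with σ j = p, rowDeviation hFi hFo σ (g α)
        (labelEigenvalue (κi α) (κo α)) i j ω) * w i| ≤ (ε * n * √n) * ‖w‖ := by
      refine abs_sum_mul_le _ _ _ (by positivity) (by positivity) ?_
        (EuclideanSpace.real_norm_sq_eq w).ge
      refine (hω α p).trans_eq ?_
      rw [mul_pow, hsq]
      ring
    have h4 := (abs_sub _ _).trans (add_le_add h2 h3)
    rw [← h1, abs_mul, abs_of_pos (by positivity), div_mul_eq_mul_div, div_le_iff₀ hk'] at h4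
    refine le_of_mul_le_mul_left (h4.trans_eq ?_) hn'
    ring
  · refine (hF.gap_diff α).imp_left ?_
    rintro ⟨c, hc⟩ p p'
    simp only [coefficient, hc, ← Finset.mul_sum, hw p p']

theorem norm_sq_mulVec (ω : Space d n) (w : EuclideanSpace ℝ (Fin n)) :
    ∑ i, (∑ j, randomAdj hFi hFo σ ω i j * w j) ^ 2 =
      ∑ p : Fin n × Fin n, (∑ l, pathDeviation hFi hFo σ p.1 p.2 l ω) * (w p.1 * w p.2) +
      ∑ p : Fin n × Fin n, (∑ l, pathMean Fi Fo (σ p.1) (σ l) (σ p.2) (ω.1 p.1) (ω.1 p.2)) *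
        (w p.1 * w p.2) := by
  rw [← Finset.sum_add_distrib]
  simp only [← add_mul, ← Finset.sum_add_distrib, pathDeviation, sub_add_cancel, sq,
    Finset.sum_mul_sum]
  rw [Fintype.sum_prod_type]
  simp only [Finset.sum_mul]
  rw [Finset.sum_comm]
  refine Finset.sum_congr rfl fun i _ => ?_
  rw [Finset.sum_comm]
  refine Finset.sum_congr rfl fun j _ => Finset.sum_congr rfl fun l _ => ?_
  rw [randomAdj_comm hFi hFo σ ω l i]
  ring

theorem sum_mul_sq_le (w : EuclideanSpace ℝ (Fin n)) :
    ∑ p : Fin n × Fin n, (w p.1 * w p.2) ^ 2 = (‖w‖ ^ 2) ^ 2 := by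
  rw [Fintype.sum_prod_type, EuclideanSpace.real_norm_sq_eq, sq (∑ i, w i ^ 2), Finset.sum_mul_sum]
  simp only [mul_pow]

/-- The finite-rank part factorises, for each middle label and each α, into two sums over labels of
coefficients of `w`, each at most k b. The remainder is an entrywise bound nδ, used through the
Hilbert–Schmidt norm. -/
theorem SpectralFamily.abs_sum_pathMean_le (hF : SpectralFamily k Fi Fo δ γ g κi κo)
    (hFi : IsConnectivity Fi) (hFo : IsConnectivity Fo) (hδ : 0 ≤ δ)
    (hσ : IsBalanced σ) (hk : 0 < k) (ω : Space d n) {w : EuclideanSpace ℝ (Fin n)} {b : ℝ}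
    (hb : ∀ α q, |coefficient σ (g α) ω w q| ≤ b) :
    ∑ p : Fin n × Fin n, (∑ l, pathMean Fi Fo (σ p.1) (σ l) (σ p.2) (ω.1 p.1) (ω.1 p.2)) *
        (w p.1 * w p.2) ≤ n ^ 2 * δ * ‖w‖ ^ 2 + n * k ^ 2 * Fintype.card ι * b ^ 2 := by
  have hk' : (k : ℝ) ≠ 0 := by positivity
  let Q : Fin k → Fin k → Fin k → UnitAddTorus (Fin d) → UnitAddTorus (Fin d) → ℝ :=
    fun s q t x x' => ∑ α, labelEigenvalue (κi α) (κo α) s q *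
      labelEigenvalue (κi α) (κo α) q t * g α x * g α x'
  have h1 : ∑ p : Fin n × Fin n, (∑ l, (pathMean Fi Fo (σ p.1) (σ l) (σ p.2) (ω.1 p.1) (ω.1 p.2) -
      Q (σ p.1) (σ l) (σ p.2) (ω.1 p.1) (ω.1 p.2))) * (w p.1 * w p.2) ≤ n ^ 2 * δ * ‖w‖ ^ 2 := by
    refine (le_abs_self _).trans ?_
    have := abs_sum_mul_le (Finset.univ : Finset (Fin n × Fin n)) (fun p =>
      ∑ l, (pathMean Fi Fo (σ p.1) (σ l) (σ p.2) (ω.1 p.1) (ω.1 p.2) -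
        Q (σ p.1) (σ l) (σ p.2) (ω.1 p.1) (ω.1 p.2))) (fun p => w p.1 * w p.2)
      (a := n ^ 2 * δ) (b := ‖w‖ ^ 2) (by positivity) (by positivity) ?_ (sum_mul_sq_le w).le
    · exact this
    · refine (Finset.sum_le_card_nsmul _ _ ((n * δ) ^ 2) fun p _ => ?_).trans_eq ?_
      · rw [← sq_abs]
        gcongr
        refine (Finset.abs_sum_le_sum_abs _ _).trans ((Finset.sum_le_card_nsmul _ _ δ fun l _ =>
          hF.abs_pathMean_sub_le hFi hFo _ _ _ _ _).trans_eq ?_)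
        simp
      · simp
        ring
  have h2 : ∑ p : Fin n × Fin n, (∑ l, Q (σ p.1) (σ l) (σ p.2) (ω.1 p.1) (ω.1 p.2)) *
      (w p.1 * w p.2) ≤ n * k ^ 2 * Fintype.card ι * b ^ 2 := by
    have h3 : ∑ p : Fin n × Fin n, (∑ l, Q (σ p.1) (σ l) (σ p.2) (ω.1 p.1) (ω.1 p.2)) *
        (w p.1 * w p.2) = n / k * ∑ q, ∑ α, (∑ s, labelEigenvalue (κi α) (κo α) s q *
          coefficient σ (g α) ω w s) * ∑ t, labelEigenvalue (κi α) (κo α) q t *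
          coefficient σ (g α) ω w t := by
      have h4 : ∀ (f : Fin k → ℝ) (α : ι), ∑ i, f (σ i) * (g α (ω.1 i) * w i) =
          ∑ s, f s * coefficient σ (g α) ω w s := by
        intro f α
        rw [← Finset.sum_fiberwise (s := Finset.univ) (g := σ)]
        refine Finset.sum_congr rfl fun p _ => ?_
        rw [coefficient, Finset.mul_sum]
        exact Finset.sum_congr rfl fun i hi => by rw [(Finset.mem_filter.1 hi).2]
      simp only [← h4 (fun s => labelEigenvalue (κi _) (κo _) s _),
        ← h4 (fun t => labelEigenvalue (κi _) (κo _) _ t)]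
      have h5 : ∀ p : Fin n × Fin n, ∑ l, Q (σ p.1) (σ l) (σ p.2) (ω.1 p.1) (ω.1 p.2) =
          n / k * ∑ q, Q (σ p.1) q (σ p.2) (ω.1 p.1) (ω.1 p.2) := fun p =>
        hσ.sum_comp fun q => Q (σ p.1) q (σ p.2) (ω.1 p.1) (ω.1 p.2)
      simp only [h5, mul_assoc, ← Finset.mul_sum]
      congr 1
      simp only [Finset.sum_mul]
      rw [Finset.sum_comm]
      refine Finset.sum_congr rfl fun q _ => ?_
      simp only [Q, Finset.sum_mul]
      rw [Finset.sum_comm]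
      refine Finset.sum_congr rfl fun α _ => ?_
      rw [Fintype.sum_prod_type]
      refine Finset.sum_congr rfl fun i _ => ?_
      rw [Finset.mul_sum]
      exact Finset.sum_congr rfl fun j _ => by ring
    have h6 : ∀ (f : Fin k → ℝ) (α : ι), (∀ s, |f s| ≤ 1) →
        |∑ s, f s * coefficient σ (g α) ω w s| ≤ k * b := by
      intro f α hf
      refine (Finset.abs_sum_le_sum_abs _ _).trans ((Finset.sum_le_card_nsmul _ _ b fun s _ => ?_
        ).trans_eq (by simp))
      rw [abs_mul]
      exact (mul_le_of_le_one_left (abs_nonneg _) (hf s)).trans (hb α s)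
    have h7 : ∑ q, ∑ α, (∑ s, labelEigenvalue (κi α) (κo α) s q *
          coefficient σ (g α) ω w s) * ∑ t, labelEigenvalue (κi α) (κo α) q t *
          coefficient σ (g α) ω w t ≤ ∑ _q : Fin k, ∑ _α : ι, (k * b) * (k * b) := by
      refine Finset.sum_le_sum fun q _ => Finset.sum_le_sum fun α _ => ?_
      refine (le_abs_self _).trans ?_
      rw [abs_mul]
      have ha := h6 (fun s => labelEigenvalue (κi α) (κo α) s q) α
        fun s => (hF.eigen α).abs_eigenvalue_le_one s q
      have hb := h6 (fun t => labelEigenvalue (κi α) (κo α) q t) α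
        fun t => (hF.eigen α).abs_eigenvalue_le_one q t
      exact mul_le_mul ha hb (abs_nonneg _) ((abs_nonneg _).trans ha)
    rw [h3]
    refine (mul_le_mul_of_nonneg_left h7 (by positivity)).trans_eq ?_
    simp only [Finset.sum_const, Finset.card_univ, Fintype.card_fin, nsmul_eq_mul]
    field_simp
  refine le_trans (le_of_eq ?_) (add_le_add h1 h2)
  rw [← Finset.sum_add_distrib]
  refine Finset.sum_congr rfl fun p _ => ?_
  rw [← add_mul, ← Finset.sum_add_distrib]
  simp

/-- On the vectors with equal label sums, the shifted adjacency matrix is bounded below. -/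
theorem SpectralFamily.le_norm_shift (hF : SpectralFamily k Fi Fo δ γ g κi κo) (hγ : 0 < γ)
    (hδ : 0 ≤ δ) (hσ : IsBalanced σ) (hn : 0 < n) (hk : 0 < k) {ω : Space d n} {ε β : ℝ}
    (hε : 0 ≤ ε) (hβ : 0 ≤ β)
    (hε' : ε ≤ (density Fi - density Fo) / (2 * k))
    (hsmall : β + δ + k ^ 2 * Fintype.card ι * (((k / γ + 1) / γ + k / γ) * (2 * k * ε)) ^ 2 <
      ((density Fi - density Fo) / (2 * k)) ^ 2)
    (hω : ∀ α q, quasimodeError hFi hFo σ (g α) (labelEigenvalue (κi α) (κo α)) q ω ≤ ε ^ 2 * n ^ 3)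
    (hω' : squareError hFi hFo σ ω ≤ β ^ 2 * n ^ 4)
    {w : EuclideanSpace ℝ (Fin n)}
    (hw : ∀ q q', ∑ i with σ i = q, w i = ∑ i with σ i = q', w i) (hw0 : w ≠ 0) :
    ε * n * ‖w‖ ≤ ‖shift (randomGraph hFi hFo σ ω) (n * (density Fi - density Fo) / k) w‖ := by
  by_contra! hlt
  have hn' : (0 : ℝ) < n := by positivity
  have hk' : (0 : ℝ) < k := by positivity
  have hw' : 0 < ‖w‖ := norm_pos_iff.2 hw0
  set Δ := density Fi - density Fo with hΔ
  -- The assumption that the lower bound fails is what makes `w` nearly orthogonal to all the modes.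
  have hcoef := hF.abs_coefficient_le hFi hFo hγ hσ hn hε hω hw hlt.le
  set M := (k / γ + 1) / γ + k / γ with hM
  have h1 := norm_sq_mulVec hFi hFo (σ := σ) ω w
  have h2 := hF.abs_sum_pathMean_le hFi hFo hδ hσ hk ω hcoef
  have h3 : ∑ p : Fin n × Fin n, (∑ l, pathDeviation hFi hFo σ p.1 p.2 l ω) * (w p.1 * w p.2) ≤
      β * n ^ 2 * ‖w‖ ^ 2 := by
    refine (le_abs_self _).trans (abs_sum_mul_le _ _ _ (by positivity) (by positivity) ?_
      (sum_mul_sq_le w).le)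
    rw [Fintype.sum_prod_type]
    exact hω'.trans_eq (by ring)
  -- The triangle inequality: ‖Aw‖ ≥ c‖w‖ − εn‖w‖ ≥ (c/2)‖w‖ for c = nΔ/k, since ε ≤ Δ/(2k).
  have h4 : (n * (Δ / (2 * k)) * ‖w‖) ^ 2 ≤
      ∑ i, (∑ j, randomAdj hFi hFo σ ω i j * w j) ^ 2 := by
    have h5 : ∑ i, (∑ j, randomAdj hFi hFo σ ω i j * w j) ^ 2 =
        ‖shift (randomGraph hFi hFo σ ω) (n * Δ / k) w + (n * Δ / k) • w‖ ^ 2 := by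
      rw [EuclideanSpace.real_norm_sq_eq]
      refine Finset.sum_congr rfl fun i _ => ?_
      simp [shift_apply, randomAdj]
    rw [h5]
    have h0 : 0 ≤ Δ / (2 * k) := hε.trans hε'
    gcongr
    have h6 := norm_sub_le (shift (randomGraph hFi hFo σ ω) (n * Δ / k) w + (n * Δ / k) • w)
      (shift (randomGraph hFi hFo σ ω) (n * Δ / k) w)
    rw [add_sub_cancel_left, norm_smul, Real.norm_eq_abs] at h6
    have h7 : n * Δ / k * ‖w‖ ≤ |n * Δ / k| * ‖w‖ := by
      gcongr
      exact le_abs_self _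
    have h8 : n * Δ / k * ‖w‖ = n * (Δ / (2 * k)) * ‖w‖ + n * (Δ / (2 * k)) * ‖w‖ := by
      field_simp
      ring
    have h9 : ε * n * ‖w‖ ≤ n * (Δ / (2 * k)) * ‖w‖ := by
      rw [mul_comm ε]
      gcongr
    linarith
  have h10 : (M * (2 * k * ε * (√n * ‖w‖))) ^ 2 = (M * (2 * k * ε)) ^ 2 * n * ‖w‖ ^ 2 := by
    have hsq : √(n : ℝ) ^ 2 = n := Real.sq_sqrt hn'.le
    calc _ = (M * (2 * k * ε)) ^ 2 * √n ^ 2 * ‖w‖ ^ 2 := by ring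
      _ = _ := by rw [hsq]
  rw [h10] at h2
  rw [h1] at h4
  have h11 : (n * ‖w‖) ^ 2 * ((Δ / (2 * k)) ^ 2) ≤ (n * ‖w‖) ^ 2 *
      (β + δ + k ^ 2 * Fintype.card ι * (M * (2 * k * ε)) ^ 2) := by
    calc _ = (n * (Δ / (2 * k)) * ‖w‖) ^ 2 := by ring
      _ ≤ _ := h4
      _ ≤ _ := add_le_add h3 h2
      _ = _ := by ring
  exact absurd (le_of_mul_le_mul_left h11 (by positivity)) (not_le.2 hsmall)

end Gap

end SGBM

namespace SGBM

/-! ### The constant mode: label vectors and degrees. -/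

section Constant

variable {d n k : ℕ} {Fi Fo : UnitAddTorus (Fin d) → ℝ}
  (hFi : IsConnectivity Fi) (hFo : IsConnectivity Fo) {σ : Fin n → Fin k}

include hFi in
theorem density_mem_Icc : density Fi ∈ Set.Icc (0 : ℝ) 1 := by
  refine ⟨integral_nonneg fun y => (hFi.mem_Icc y).1, ?_⟩
  exact (integral_mono_of_nonneg (ae_of_all _ fun y => (hFi.mem_Icc y).1)
    (integrable_const (1 : ℝ)) (ae_of_all _ fun y => (hFi.mem_Icc y).2)).trans_eq (by simp)

include hFi hFo in
theorem labelEigenvalue_density_mem_Icc (s t : Fin k) :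
    labelEigenvalue (density Fi) (density Fo) s t ∈ Set.Icc (0 : ℝ) 1 := by
  unfold labelEigenvalue
  split_ifs
  exacts [density_mem_Icc hFi, density_mem_Icc hFo]

include hFi hFo in
theorem isEigenfunction_one : IsEigenfunction Fi Fo (fun _ => 1)
    (labelEigenvalue (k := k) (density Fi) (density Fo)) where
  measurable := measurable_const
  abs_le_one := by simp
  abs_eigenvalue_le_one s t := by
    have := labelEigenvalue_density_mem_Icc hFi hFo s t
    rw [abs_of_nonneg this.1]
    exact this.2
  integral_eq s t x := by
    simp only [mul_one]
    rw [integral_sub_left_eq_self (fun y => connection Fi Fo y s t) (torusMeasure d) x]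
    unfold connection labelEigenvalue density
    split_ifs <;> rfl

/-- As ∑ h = 0, the averaged row sum is exactly (nΔ/k) h(σ i), so (A − c) applied to the label
vector is a combination of row deviations alone; Cauchy–Schwarz over the labels finishes. -/
theorem norm_sq_shift_labelVec_le (hσ : IsBalanced σ) (hn : 0 < n) (hk : 0 < k) {ω : Space d n}
    {E : ℝ} (hE : ∀ q, quasimodeError hFi hFo σ (fun _ => 1)
      (labelEigenvalue (density Fi) (density Fo)) q ω ≤ E) {h : Fin k → ℝ} (hh : ∑ q, h q = 0) :
    ‖shift (randomGraph hFi hFo σ ω) (n * (density Fi - density Fo) / k) (labelVec σ h)‖ ^ 2 ≤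
      k ^ 2 * E / n * ‖labelVec σ h‖ ^ 2 := by
  have hn' : (0 : ℝ) < n := by positivity
  have hk' : (0 : ℝ) < k := by positivity
  set κ : Fin k → Fin k → ℝ := labelEigenvalue (density Fi) (density Fo) with hκ
  have h1 : ∀ i, shift (randomGraph hFi hFo σ ω) (n * (density Fi - density Fo) / k)
      (labelVec σ h) i =
      ∑ q, h q * ∑ j with σ j = q, rowDeviation hFi hFo σ (fun _ => 1) κ i j ω := by
    intro i
    have h2 : ∑ q, h q * ∑ j with σ j = q, rowDeviation hFi hFo σ (fun _ => 1) κ i j ω =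
        ∑ j, h (σ j) * rowDeviation hFi hFo σ (fun _ => 1) κ i j ω := by
      rw [← Finset.sum_fiberwise (s := Finset.univ) (g := σ)]
      refine Finset.sum_congr rfl fun q _ => ?_
      rw [Finset.mul_sum]
      exact Finset.sum_congr rfl fun j hj => by rw [(Finset.mem_filter.1 hj).2]
    have h3 : ∑ j, h (σ j) * κ (σ i) (σ j) = n / k * ((density Fi - density Fo) * h (σ i)) := by
      rw [hσ.sum_comp fun q => h q * κ (σ i) q]
      congr 1
      have h4 : ∀ q, h q * κ (σ i) q =
          (if σ i = q then (density Fi - density Fo) * h q else 0) + density Fo * h q := by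
        intro q
        simp only [hκ, labelEigenvalue]
        split_ifs <;> ring
      simp only [h4, Finset.sum_add_distrib, Finset.sum_ite_eq, Finset.mem_univ, if_true,
        ← Finset.mul_sum, hh, mul_zero, add_zero]
    rw [h2]
    simp only [rowDeviation, mul_one, mul_sub, Finset.sum_sub_distrib]
    rw [h3, shift_apply]
    simp only [labelVec_apply, randomAdj, mul_comm (h _)]
    ring
  rw [EuclideanSpace.real_norm_sq_eq, hσ.norm_sq_labelVec]
  calc ∑ i, shift (randomGraph hFi hFo σ ω) (n * (density Fi - density Fo) / k)
        (labelVec σ h) i ^ 2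
      ≤ ∑ i, (∑ q, h q ^ 2) *
        ∑ q, (∑ j with σ j = q, rowDeviation hFi hFo σ (fun _ => 1) κ i j ω) ^ 2 := by
        refine Finset.sum_le_sum fun i _ => ?_
        rw [h1]
        exact Finset.sum_mul_sq_le_sq_mul_sq _ _ _
    _ = (∑ q, h q ^ 2) * ∑ q, quasimodeError hFi hFo σ (fun _ => 1) κ q ω := by
        rw [← Finset.mul_sum, Finset.sum_comm]
        rfl
    _ ≤ (∑ q, h q ^ 2) * (k * E) := by
        refine mul_le_mul_of_nonneg_left ?_ (Finset.sum_nonneg fun _ _ => sq_nonneg _)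
        refine (Finset.sum_le_card_nsmul _ _ E fun q _ => hE q).trans_eq (by simp)
    _ = _ := by
        field_simp

theorem labelCount_eq_sum (ω : Space d n) (i : Fin n) (q : Fin k) :
    (labelCount (randomGraph hFi hFo σ ω) σ i q : ℝ) =
      ∑ j ∈ (Finset.univ.filter fun j => σ j = q).erase i, randomAdj hFi hFo σ ω i j := by
  classical
  simp only [labelCount, randomAdj, adj, SimpleGraph.adjMatrix_apply]
  rw [Finset.sum_boole]
  congr 2
  ext j
  simp only [Finset.mem_filter, Finset.mem_univ, true_and, Finset.mem_erase]
  exact ⟨fun h => ⟨⟨h.1.ne', h.2⟩, h.1⟩, fun h => ⟨h.2, h.1.2⟩⟩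

/-- The two counts concentrate around (n/k)μ_out and (n/k − 1)μ_in. The missing neighbour in the
vertex's own class accounts for the 1 in `hb`. -/
theorem labelCount_add_lt (hσ : IsBalanced σ) {ω : Space d n} {c b : ℝ}
    (hω : ∀ i q, |∑ j ∈ (Finset.univ.filter fun j => σ j = q).erase i, rowDeviation hFi hFo σ
      (fun _ => 1) (labelEigenvalue (density Fi) (density Fo)) i j ω| ≤ c)
    (hb : 2 * c + 1 + b < n / k * (density Fi - density Fo)) {i : Fin n} {q : Fin k}
    (hq : q ≠ σ i) :
    (labelCount (randomGraph hFi hFo σ ω) σ i q : ℝ) + b <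
      labelCount (randomGraph hFi hFo σ ω) σ i (σ i) := by
  have h1 : ∀ p, ∑ j ∈ (Finset.univ.filter fun j => σ j = p).erase i, rowDeviation hFi hFo σ
      (fun _ => 1) (labelEigenvalue (density Fi) (density Fo)) i j ω =
      labelCount (randomGraph hFi hFo σ ω) σ i p -
        ((Finset.univ.filter fun j => σ j = p).erase i).card *
          labelEigenvalue (density Fi) (density Fo) (σ i) p := by
    intro p
    rw [labelCount_eq_sum]
    simp only [rowDeviation, mul_one, Finset.sum_sub_distrib]
    congr 1
    rw [Finset.sum_congr rfl (g := fun _ => labelEigenvalue (density Fi) (density Fo) (σ i) p)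
      fun j hj => by rw [(Finset.mem_filter.1 (Finset.mem_of_mem_erase hj)).2]]
    simp
  have h2 := hω i q
  have h3 := hω i (σ i)
  rw [h1] at h2 h3
  have h4 : (((Finset.univ.filter fun j => σ j = q).erase i).card : ℝ) = n / k := by
    rw [Finset.erase_eq_of_notMem (by simpa using hq.symm), hσ.card_eq]
  have h5 : (((Finset.univ.filter fun j => σ j = σ i).erase i).card : ℝ) = n / k - 1 := by
    rw [Finset.card_erase_of_mem (by simp), Nat.cast_sub (Finset.card_pos.2 ⟨i, by simp⟩),
      hσ.card_eq, Nat.cast_one]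
  have h6 : labelEigenvalue (density Fi) (density Fo) (σ i) q = density Fo := if_neg hq.symm
  have h7 : labelEigenvalue (density Fi) (density Fo) (σ i) (σ i) = density Fi := if_pos rfl
  rw [h4, h6] at h2
  rw [h5, h7] at h3
  have h8 := (abs_le.1 h2).2
  have h9 := (abs_le.1 h3).1
  have h10 := (density_mem_Icc hFi).2
  linarith

end Constant

/-! ### Typical outcomes: the deterministic conclusion and the probability. -/

section Main

variable {d n k : ℕ} {Fi Fo : UnitAddTorus (Fin d) → ℝ} {ι : Type*} [Fintype ι]
  {δ γ : ℝ} {g : ι → UnitAddTorus (Fin d) → ℝ} {κi κo : ι → ℝ}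
  (hFi : IsConnectivity Fi) (hFo : IsConnectivity Fo) {σ : Fin n → Fin k}

/-- The bounds on the random fluctuations from which the clustering is analysed
deterministically. -/
structure IsTypical (σ : Fin n → Fin k) (g : ι → UnitAddTorus (Fin d) → ℝ) (κi κo : ι → ℝ)
    (ε β E c : ℝ) (ω : Space d n) : Prop where
  quasimode : ∀ α q, quasimodeError hFi hFo σ (g α) (labelEigenvalue (κi α) (κo α)) q ω ≤
    ε ^ 2 * n ^ 3
  square : squareError hFi hFo σ ω ≤ β ^ 2 * n ^ 4
  quasimode_one : ∀ q, quasimodeError hFi hFo σ (fun _ => 1)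
    (labelEigenvalue (density Fi) (density Fo)) q ω ≤ E
  degree : ∀ i q, |∑ j ∈ (Finset.univ.filter fun j => σ j = q).erase i, rowDeviation hFi hFo σ
    (fun _ => 1) (labelEigenvalue (density Fi) (density Fo)) i j ω| ≤ c

theorem IsTypical.clustering {ε β E c τ η : ℝ} {ω : Space d n}
    (hω : IsTypical hFi hFo σ g κi κo ε β E c ω)
    (hF : SpectralFamily k Fi Fo δ γ g κi κo) (hγ : 0 < γ)
    (hδ : 0 ≤ δ) (hσ : IsBalanced σ) (hn : 0 < n) (hk : 0 < k)
    (hβ : 0 ≤ β) (hE : 0 ≤ E) (hη : 0 ≤ η) (hτ : 0 < τ) (hτε : τ < ε)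
    (hε' : ε ≤ (density Fi - density Fo) / (2 * k))
    (hsmall : β + δ + k ^ 2 * Fintype.card ι * (((k / γ + 1) / γ + k / γ) * (2 * k * ε)) ^ 2 <
      ((density Fi - density Fo) / (2 * k)) ^ 2)
    (hE₁ : k ^ 2 * E / n ≤ (τ * n) ^ 2)
    (hE₂ : 16 * (1 + η) * (k ^ 2 * E / n) ≤ τ * Real.log n * (ε ^ 2 * n))
    (hlog : k * (τ * Real.log n) < n)
    (hc : 2 * c + 1 + 2 * (τ * Real.log n) < n / k * (density Fi - density Fo)) :
    (∃ e : Fin (k - 1) ↪ Fin n, IsSelection (randomGraph hFi hFo σ ω)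
      (n * (density Fi - density Fo) / k) (τ * n) (ε * n) e) ∧
    ∀ e : Fin (k - 1) ↪ Fin n, IsSelection (randomGraph hFi hFo σ ω)
      (n * (density Fi - density Fo) / k) (τ * n) (ε * n) e →
    ∀ v : Fin (k - 1) → EuclideanSpace ℝ (Fin n), IsEigenframe (randomGraph hFi hFo σ ω) e v →
    ∀ s : Fin n → Fin k, IsKMeansOutput η (row v) s →
      loss σ s ≤ τ * Real.log n / n ∧
      ∀ s' : Fin n → Fin k, IsRefinement (randomGraph hFi hFo σ ω) s s' → loss σ s' = 0 := by
  have hn' : (0 : ℝ) < n := by positivity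
  have hk' : (0 : ℝ) < k := by positivity
  have hε : 0 < ε := hτ.trans hτε
  have hshift := fun (h : Fin k → ℝ) (hh : ∑ q, h q = 0) =>
    norm_sq_shift_labelVec_le hFi hFo hσ hn hk hω.quasimode_one hh
  refine ⟨exists_isSelection hk (hσ.surjective hn) (by positivity) (by gcongr) (fun h hh => ?_)
    fun w hw hw0 => hF.le_norm_shift hFi hFo hγ hδ hσ hn hk hε.le hβ hε' hsmall hω.quasimode
      hω.square hw hw0, ?_⟩
  · refine le_of_sq_le_sq ?_ (by positivity)
    rw [mul_pow]
    exact (hshift h hh).trans (mul_le_mul_of_nonneg_right hE₁ (sq_nonneg _))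
  · intro e he v hv s hs
    -- The squared ratio of the two bounds on A − c: the fraction of a label vector's squared norm
    -- that can lie outside the eigenframe.
    set ρ := k ^ 2 * E / n / (ε * n) ^ 2 with hρ
    have hρ0 : 0 ≤ ρ := by positivity
    have hclose : ∀ h : Fin k → ℝ, ∑ q, h q = 0 →
        ‖labelVec σ h‖ ^ 2 - ∑ j, inner ℝ (v j) (labelVec σ h) ^ 2 ≤ ρ * ‖labelVec σ h‖ ^ 2 := by
      intro h hh
      have h1 := hv.norm_sq_sub_le (by gcongr) (by positivity) he (labelVec σ h)
      have h2 := h1.trans (hshift h hh)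
      rw [hρ, div_mul_eq_mul_div, le_div_iff₀ (by positivity), mul_comm]
      exact h2
    have herr : 16 * (1 + η) * n * ρ ≤ τ * Real.log n := by
      have : 16 * (1 + η) * n * ρ = 16 * (1 + η) * (k ^ 2 * E / n) / (ε ^ 2 * n) := by
        rw [hρ]
        field_simp
      rw [this, div_le_iff₀ (by positivity)]
      exact hE₂
    have hρ1 : 16 * (1 + η) * k * ρ < 1 := by
      have h1 : k * (16 * (1 + η) * n * ρ) < n := (mul_le_mul_of_nonneg_left herr hk'.le).trans_lt
        hlog
      have h2 : k * (16 * (1 + η) * n * ρ) = (16 * (1 + η) * k * ρ) * n := by ring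
      rw [h2] at h1
      by_contra! h3
      nlinarith
    obtain ⟨π, hπ⟩ := exists_perm_of_kMeans hσ hn hk hv.1 hη hρ1 hρ0 hclose hs
    have hπ' := hπ.trans herr
    refine ⟨?_, fun s' hs' => loss_refinement_eq_zero π le_rfl (fun i q hq => ?_) hs'⟩
    · rw [loss]
      gcongr
      refine le_trans ?_ hπ'
      exact_mod_cast classificationError_le π
    · have h1 := labelCount_add_lt hFi hFo hσ hω.degree hc hq
      have h2 : (labelCount (randomGraph hFi hFo σ ω) σ i q : ℝ) +
          2 * ((Finset.univ.filter fun i => s i ≠ π (σ i)).card : ℝ) <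
          labelCount (randomGraph hFi hFo σ ω) σ i (σ i) := by linarith
      exact_mod_cast h2

theorem prob_not_isTypical_le (hF : SpectralFamily k Fi Fo δ γ g κi κo) (hn : 0 < n)
    {ε β E c : ℝ} (hε : 0 < ε) (hβ : 0 < β) (hE : 0 < E) (hc0 : 0 ≤ c) (hc : c ≤ 2) :
    (prob d n).real {ω | ¬IsTypical hFi hFo σ g κi κo ε β E (c * n) ω} ≤
      Fintype.card ι * (k * (16 / ε ^ 2 / n)) + 11 / β ^ 2 / n + k * (16 * n ^ 2 / E) +
        n * (k * (2 * Real.exp (-(c ^ 2 / 4 * n)))) := by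
  have hn' : (0 : ℝ) < n := by positivity
  set κ : Fin k → Fin k → ℝ := labelEigenvalue (density Fi) (density Fo) with hκ
  set B1 : ι → Fin k → Set (Space d n) := fun α q => {ω | ε ^ 2 * n ^ 3 ≤
    quasimodeError hFi hFo σ (g α) (labelEigenvalue (κi α) (κo α)) q ω} with hB1
  set B2 : Set (Space d n) := {ω | β ^ 2 * n ^ 4 ≤ squareError hFi hFo σ ω} with hB2
  set B3 : Fin k → Set (Space d n) := fun q => {ω | E ≤
    quasimodeError hFi hFo σ (fun _ => 1) κ q ω} with hB3
  set B4 : Fin n → Fin k → Set (Space d n) := fun i q => {ω | c * n ≤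
    |∑ j ∈ (Finset.univ.filter fun j => σ j = q).erase i,
      rowDeviation hFi hFo σ (fun _ => 1) κ i j ω|} with hB4
  have hsub : {ω | ¬IsTypical hFi hFo σ g κi κo ε β E (c * n) ω} ⊆
      (⋃ α, ⋃ q, B1 α q) ∪ B2 ∪ (⋃ q, B3 q) ∪ ⋃ i, ⋃ q, B4 i q := by
    intro ω hω
    by_contra hcon
    simp only [Set.mem_union, Set.mem_iUnion, not_or, not_exists, hB1, hB2, hB3, hB4,
      Set.mem_ofPred_eq, not_le] at hcon
    exact hω ⟨fun α q => (hcon.1.1.1 α q).le, hcon.1.1.2.le, fun q => (hcon.1.2 q).le,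
      fun i q => (hcon.2 i q).le⟩
  have hb1 : ∀ α q, (prob d n).real (B1 α q) ≤ 16 / ε ^ 2 / n := by
    intro α q
    have := prob_quasimodeError_ge hFi hFo σ (hF.eigen α) q (ε ^ 2 * n ^ 3)
    rw [div_div, le_div_iff₀ (by positivity)]
    have h2 : (n : ℝ) ^ 2 * ((prob d n).real (B1 α q) * (ε ^ 2 * n)) ≤ n ^ 2 * 16 := by
      calc _ = ε ^ 2 * n ^ 3 * (prob d n).real (B1 α q) := by ring
        _ ≤ _ := this
        _ = _ := by ring
    exact le_of_mul_le_mul_left h2 (by positivity)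
  have hb2 : (prob d n).real B2 ≤ 11 / β ^ 2 / n := by
    have := prob_squareError_ge hFi hFo σ (β ^ 2 * n ^ 4)
    rw [div_div, le_div_iff₀ (by positivity)]
    have h2 : (n : ℝ) ^ 3 * ((prob d n).real B2 * (β ^ 2 * n)) ≤ n ^ 3 * 11 := by
      calc _ = β ^ 2 * n ^ 4 * (prob d n).real B2 := by ring
        _ ≤ _ := this
        _ = _ := by ring
    exact le_of_mul_le_mul_left h2 (by positivity)
  have hb3 : ∀ q, (prob d n).real (B3 q) ≤ 16 * n ^ 2 / E := by
    intro q
    rw [le_div_iff₀ hE, mul_comm]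
    exact prob_quasimodeError_ge hFi hFo σ (isEigenfunction_one hFi hFo) q E
  have hb4 : ∀ i q, (prob d n).real (B4 i q) ≤ 2 * Real.exp (-(c ^ 2 / 4 * n)) := by
    intro i q
    -- The choice t = c/2 minimises t²n − t·cn, with value −c²n/4; it is admissible because c ≤ 2.
    refine (prob_abs_sum_rowDeviation_ge hFi hFo σ (isEigenfunction_one hFi hFo) i
      (Finset.notMem_erase i _) (fun j ω => ?_) (t := c / 2) (by positivity) (by linarith)
      (c * n)).trans_eq ?_
    · have h1 := randomAdj_mem_Icc hFi hFo σ ω i j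
      have h2 := labelEigenvalue_density_mem_Icc hFi hFo (σ i) (σ j)
      simp only [rowDeviation, mul_one]
      rw [abs_le]
      constructor <;> linarith [h1.1, h1.2, h2.1, h2.2]
    · congr 2
      ring
  refine (measureReal_mono hsub).trans ((measureReal_union_le _ _).trans (add_le_add
    ((measureReal_union_le _ _).trans (add_le_add ((measureReal_union_le _ _).trans
      (add_le_add ?_ hb2)) ?_)) ?_))
  · refine (measureReal_iUnion_fintype_le _).trans
      ((Finset.sum_le_card_nsmul _ _ (k * (16 / ε ^ 2 / n)) fun α _ =>
        (measureReal_iUnion_fintype_le _).trans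
        ((Finset.sum_le_card_nsmul _ _ _ fun x _ => hb1 α x).trans_eq (by simp))).trans_eq
        (by simp))
  · refine (measureReal_iUnion_fintype_le _).trans
      ((Finset.sum_le_card_nsmul _ _ _ fun x _ => hb3 x).trans_eq (by simp))
  · refine (measureReal_iUnion_fintype_le _).trans
      ((Finset.sum_le_card_nsmul _ _ (k * (2 * Real.exp (-(c ^ 2 / 4 * n)))) fun i _ =>
        (measureReal_iUnion_fintype_le _).trans
        ((Finset.sum_le_card_nsmul _ _ _ fun x _ => hb4 i x).trans_eq (by simp))).trans_eq
        (by simp))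

theorem eventually_log_le {a : ℝ} (ha : 0 < a) : ∀ᶠ n : ℕ in atTop, Real.log n ≤ a * n := by
  have h := (Real.isLittleO_log_id_atTop.comp_tendsto tendsto_natCast_atTop_atTop).def ha
  filter_upwards [h] with n hn
  simpa using (le_abs_self _).trans hn

/-- With E = θn² log n the Markov bound 16n²/E is of order 1/log n; this is the only term that
decays slowly. -/
theorem tendsto_tail (a b c e θ : ℝ) (he : 0 < e) (hθ : 0 < θ) :
    Tendsto (fun n : ℕ => a / n + b / n + c * (16 * n ^ 2 / (θ * n ^ 2 * Real.log n)) +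
      n * (c * (2 * Real.exp (-(e * n))))) atTop (𝓝 0) := by
  have hcast : Tendsto (fun n : ℕ => (n : ℝ)) atTop atTop := tendsto_natCast_atTop_atTop
  have h1 : ∀ a : ℝ, Tendsto (fun n : ℕ => a / n) atTop (𝓝 0) := fun a =>
    tendsto_const_nhds.div_atTop hcast
  have h2 : Tendsto (fun n : ℕ => c * (16 * n ^ 2 / (θ * n ^ 2 * Real.log n))) atTop (𝓝 0) := by
    have h3 : Tendsto (fun n : ℕ => 16 * c / θ / Real.log n) atTop (𝓝 0) :=
      tendsto_const_nhds.div_atTop (Real.tendsto_log_atTop.comp hcast)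
    refine h3.congr' ?_
    filter_upwards [eventually_gt_atTop 0] with n hn
    have : (n : ℝ) ≠ 0 := by positivity
    field_simp
  have h4 : Tendsto (fun n : ℕ => (n : ℝ) * (c * (2 * Real.exp (-(e * n))))) atTop (𝓝 0) := by
    have h5 := (Real.tendsto_pow_mul_exp_neg_atTop_nhds_zero 1).comp
      (hcast.const_mul_atTop he)
    have h6 := h5.const_mul (2 * c / e)
    rw [mul_zero] at h6
    refine h6.congr fun n => ?_
    simp only [Function.comp_apply, pow_one]
    field_simp
  simpa using (((h1 a).add (h1 b)).add h2).add h4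

end Main

end SGBM

/-! ### Choice of the constants and the limit. -/

theorem mainTheorem1 (d k : ℕ) (hk : 2 ≤ k) (Fi Fo : UnitAddTorus (Fin d) → ℝ)
    (hFi : SGBM.IsConnectivity Fi) (hFo : SGBM.IsConnectivity Fo)
    (hout : 0 < SGBM.density Fo) (hin : SGBM.density Fo < SGBM.density Fi)
    (hFi0 : SGBM.EqFourierSeriesAt Fi 0) (hFo0 : SGBM.EqFourierSeriesAt Fo 0)
    (hsum : ∀ z : Fin d → ℤ,
      SGBM.fourierCoefficient Fi z + ((k : ℂ) - 1) * SGBM.fourierCoefficient Fo z ≠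
        ((SGBM.density Fi - SGBM.density Fo : ℝ) : ℂ))
    (hdiff : ∀ z : Fin d → ℤ, z ≠ 0 →
      SGBM.fourierCoefficient Fi z - SGBM.fourierCoefficient Fo z ≠
        ((SGBM.density Fi - SGBM.density Fo : ℝ) : ℂ)) :
    ∃ ε : ℝ, 0 < ε ∧ ∀ τ : ℝ, 0 < τ → τ < ε → ∀ η : ℝ, 0 ≤ η →
      ∀ σ : (n : ℕ) → Fin n → Fin k, (∀ n, k ∣ n → SGBM.IsBalanced (σ n)) →
        Tendsto
          (fun n : ℕ => SGBM.law Fi Fo (σ n)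
            {G : SimpleGraph (Fin n) |
              (∃ e : Fin (k - 1) ↪ Fin n, SGBM.IsSelection G
                (n * (SGBM.density Fi - SGBM.density Fo) / k) (τ * n) (ε * n) e) ∧
              ∀ e : Fin (k - 1) ↪ Fin n, SGBM.IsSelection G
                (n * (SGBM.density Fi - SGBM.density Fo) / k) (τ * n) (ε * n) e →
              ∀ v : Fin (k - 1) → EuclideanSpace ℝ (Fin n), SGBM.IsEigenframe G e v →
              ∀ s : Fin n → Fin k, SGBM.IsKMeansOutput η (SGBM.row v) s →
                SGBM.loss (σ n) s ≤ τ * Real.log n / n ∧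
                ∀ s' : Fin n → Fin k, SGBM.IsRefinement G s s' → SGBM.loss (σ n) s' = 0})
          (atTop ⊓ 𝓟 {n : ℕ | k ∣ n}) (𝓝 1) := by
  have hk0 : 0 < k := by omega
  have hk' : (0 : ℝ) < k := by positivity
  set Δ := SGBM.density Fi - SGBM.density Fo with hΔ
  have hΔ0 : 0 < Δ := sub_pos.2 hin
  have hΔ1 : Δ ≤ 1 := by linarith [(SGBM.density_mem_Icc hFi).2]
  set D := Δ / (2 * k) with hD
  have hD0 : 0 < D := by positivity
  obtain ⟨S, γ, hγ, hF⟩ := SGBM.exists_spectralFamily hFi hFo hsum hdiff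
    (δ := D ^ 2 / 4) (by positivity)
  set B := k ^ 2 * Fintype.card (S × Bool) * (((k / γ + 1) / γ + k / γ) * (2 * k)) ^ 2 with hB
  have hB0 : 0 ≤ B := by positivity
  -- The coefficient term of `hsmall` becomes Bε² = (D²/4)·B/(B + 1)² ≤ D²/4. Together with δ = β =
  -- D²/4 the total is at most 3D²/4 < D².
  refine ⟨D / (2 * (B + 1)), by positivity, ?_⟩
  set ε := D / (2 * (B + 1)) with hε
  have hε0 : 0 < ε := by positivity
  have hεD : ε ≤ D := div_le_self hD0.le (by linarith)
  have hsmall : D ^ 2 / 4 + D ^ 2 / 4 + k ^ 2 * Fintype.card (S × Bool) *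
      (((k / γ + 1) / γ + k / γ) * (2 * k * ε)) ^ 2 < D ^ 2 := by
    have h1 : k ^ 2 * Fintype.card (S × Bool) *
        (((k / γ + 1) / γ + k / γ) * (2 * k * ε)) ^ 2 = B * ε ^ 2 := by
      rw [hB]
      ring
    have h2 : B * ε ^ 2 = D ^ 2 / 4 * (B / (B + 1) ^ 2) := by
      rw [hε]
      field_simp
      ring
    have h3 : B / (B + 1) ^ 2 ≤ 1 := (div_le_one (by positivity)).2 (by nlinarith)
    rw [h1, h2]
    nlinarith [sq_pos_of_pos hD0]
  intro τ hτ hτε η hη σ hσ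
  -- The expected majority margin nΔ/k is 8cn. For large n the degree errors take 2cn, the missing
  -- neighbour less than cn, and the mislabelled vertices at most 2cn.
  set c := Δ / (8 * k) with hc
  have hc0 : 0 < c := by positivity
  have hc2 : c ≤ 2 := by
    rw [hc, div_le_iff₀ (by positivity)]
    have : (1 : ℝ) ≤ k := by exact_mod_cast hk0
    linarith
  -- With E = θn² log n this makes the condition `hE₂` of `IsTypical.clustering` an equality, so
  -- that k-means makes at most τ log n errors. Here θ may depend on τ and η, while ε may not.
  set θ := τ * ε ^ 2 / (16 * (1 + η) * k ^ 2) with hθ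
  have hθ0 : 0 < θ := by positivity
  have htail := SGBM.tendsto_tail (Fintype.card (S × Bool) * (k * (16 / ε ^ 2)))
    (11 / (D ^ 2 / 4) ^ 2) k (c ^ 2 / 4) θ (by positivity) hθ0
  have hlow := ENNReal.Tendsto.sub (tendsto_const_nhds (x := (1 : ℝ≥0∞)))
    (ENNReal.tendsto_ofReal htail) (Or.inl ENNReal.one_ne_top)
  rw [ENNReal.ofReal_zero, tsub_zero] at hlow
  -- The probability is squeezed between 1 minus the tail bound and 1.
  refine tendsto_of_tendsto_of_tendsto_of_le_of_le' (hlow.mono_left inf_le_left)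
    tendsto_const_nhds ?_ (Eventually.of_forall fun n => SGBM.law_le_one hFi hFo _ _)
  rw [eventually_inf_principal]
  filter_upwards [eventually_ge_atTop 2,
    SGBM.eventually_log_le (a := 1 / (2 * k * τ)) (by positivity),
    SGBM.eventually_log_le (a := τ ^ 2 / (k ^ 2 * θ)) (by positivity),
    SGBM.eventually_log_le (a := c / τ) (by positivity),
    (tendsto_natCast_atTop_atTop (R := ℝ)).eventually_gt_atTop (1 / c)] with n hn2 hl1 hl2 hl3 hnc hkn
  have hn : 0 < n := by omega
  have hn' : (0 : ℝ) < n := by positivity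
  have hlogn : 0 < Real.log n := Real.log_pos (by exact_mod_cast hn2)
  set E := θ * n ^ 2 * Real.log n with hE
  have hE0 : 0 < E := by positivity
  have hbad := SGBM.prob_not_isTypical_le hFi hFo (σ := σ n) hF hn hε0
    (β := D ^ 2 / 4) (by positivity) hE0 hc0.le hc2
  refine le_trans ?_ (SGBM.prob_le_law hFi hFo (σ n) _)
  have hgood : {ω | SGBM.IsTypical hFi hFo (σ n) (fun p : S × Bool => SGBM.realCharacter (p.1.1, p.2))
      (fun p => (SGBM.fourierCoefficient Fi p.1).re)
      (fun p => (SGBM.fourierCoefficient Fo p.1).re) ε (D ^ 2 / 4) E (c * n) ω} ⊆ _ := fun ω hω =>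
    SGBM.IsTypical.clustering hFi hFo (τ := τ) (η := η) hω hF hγ (by positivity) (hσ n hkn) hn hk0
      (by positivity) hE0.le hη hτ hτε hεD hsmall ?_ ?_ ?_ ?_
  · refine le_trans ?_ (measure_mono hgood)
    rw [tsub_le_iff_right]
    calc (1 : ℝ≥0∞) = SGBM.prob d n Set.univ := measure_univ.symm
      _ ≤ _ := by
        refine (measure_mono ?_).trans ((measure_union_le _ {ω | ¬SGBM.IsTypical hFi hFo (σ n)
          (fun p : S × Bool => SGBM.realCharacter (p.1.1, p.2))
          (fun p => (SGBM.fourierCoefficient Fi p.1).re)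
          (fun p => (SGBM.fourierCoefficient Fo p.1).re) ε (D ^ 2 / 4) E (c * n) ω}).trans
          (add_le_add le_rfl ?_))
        · exact fun ω _ => em _
        · rw [← ofReal_measureReal]
          refine ENNReal.ofReal_le_ofReal (hbad.trans_eq ?_)
          ring
  · rw [hE, div_le_iff₀ hn']
    rw [div_mul_eq_mul_div, le_div_iff₀ (by positivity)] at hl2
    calc (k : ℝ) ^ 2 * (θ * n ^ 2 * Real.log n) = n ^ 2 * (Real.log n * (k ^ 2 * θ)) := by ring
      _ ≤ n ^ 2 * (τ ^ 2 * n) := by gcongr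
      _ = _ := by ring
  · refine le_of_eq ?_
    rw [hE, hθ]
    field_simp
  · rw [div_mul_eq_mul_div, le_div_iff₀ (by positivity)] at hl1
    have : k * (τ * Real.log n) = Real.log n * (2 * k * τ) / 2 := by ring
    rw [this]
    linarith
  · rw [div_mul_eq_mul_div, le_div_iff₀ hτ] at hl3
    rw [div_lt_iff₀ hc0] at hnc
    have : n / k * Δ = 8 * (c * n) := by
      rw [hc]
      field_simp
    rw [this]
    linarith
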